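/- Let $n\ge 1$ and let $A(t,\xi)=(a_{ij}(t,\xi))_{i,j=1}^m$ ($t\in\mathbb R$, $\xi\in\mathbb R^n\setminus 0$) be a complex $m\times m$ matrix symbol whose entries are continuous in $\xi\ne0$ and positively homogeneous of order one, $a_{ij}(t,\lambda\xi)=\lambda a_{ij}(t,\xi)$ for $\lambda>0$. Assume that for each $\xi\neq 0$ the functions $a_{ij}(\cdot,\xi)$ are locally Lipschitz on $\mathbb R$ with $\partial_t a_{ij}(\cdot,\xi)\in L^1(\mathbb R)$, uniformly in the direction of $\xi$: $\sup_{|\xi|=1}\int_{\mathbb R}|\partial_t a_{ij}(t,\xi)|\,dt<\infty$. Assume that the system is regularly hyperbolic: $\det(\tau I-A(t,\xi))=\prod_{j=1}^m(\tau-\varphi_j(t,\xi))$ with real roots $\varphi_j$, labelled continuously in $t$ for each $\xi\ne0$, and $\inf_{t\in\mathbb R,\,|\xi|=1,\,j\ne k}|\varphi_j(t,\xi)-\varphi_k(t,\xi)|>0$. Let $D_t=-i\partial_t$, $D_x=-i\partial_x$, and let $A(t,D_x)$ be the Fourier multiplier with symbol $A(t,\xi)$. A solution of $D_tU=A(t,D_x)U$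 is a function $U\in C(\mathbb R;(L^2(\mathbb R^n))^m)$ such that for every Schwartz function $\chi$ the function $t\mapsto\langle \chi,U(t)\rangle$ is differentiable with derivative $\langle \chi,iA(t,D_x)U(t)\rangle$, the last pairing being evaluated on the Fourier side. Fix a sign $\pm$. Then the limits $A_\pm(\xi)=\lim_{t\to\pm\infty}A(t,\xi)$ and $\varphi_j^\pm(\xi)=\lim_{t\to\pm\infty}\varphi_j(t,\xi)$ exist for $\xi\neq0$. A solution $U$ is called asymptotically free as $t\to\pm\infty$ if there is a solution $V_\pm\in C(\mathbb R;(L^2(\mathbb R^n))^m)$ of $D_tV=A_\pm(D_x)V$ with $\|U(t)-V_\pm(t)\|_{(L^2)^m}\to0$ as $t\to\pm\infty$. Put $\psi_{j,\pm}(t,\xi)=\int_0^t(\varphi_j(s,\xi)-\varphi_j^\pm(\xi))\,ds$. (i) If for every $j$ and every $\xi\ne0$ the function $\psi_{j,\pm}(t,\xi)$ has a finite limit as $t\to\pm\infty$, then every solution $U$ of $D_tU=A(t,D_x)U$ is asymptotically free as $t\to\pm\infty$. Moreover every initial value $U(0)\in(L^2(\mathbb R^n))^m$ belongs to exactly one solution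 $U$, and the map $\mathscr W_\pm^{-1}:U(0)\mapsto V_\pm(0)$, where $V_\pm$ is a solution of the limiting system to which $U$ is asymptotic, is well defined, linear, bounded and bijective on $(L^2(\mathbb R^n))^m$. (ii) If $|\psi_{j,\pm}(t,\xi)|\to\infty$ as $t\to\pm\infty$ for every $j$ and every $\xi\ne0$, then no solution $U\not\equiv0$ of $D_tU=A(t,D_x)U$ is asymptotically free as $t\to\pm\infty$. -/

import Mathlib

open MeasureTheory Filter Topology
open scoped FourierTransform SchwartzMap

/-- The frequency (and physical) space `ℝⁿ`. -/
abbrev Space (n : ℕ) : Type := EuclideanSpace ℝ (Fin n)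

/-- The space `(L²(ℝⁿ))ᵐ`, realised as the `L²` functions on `ℝⁿ` with values in `ℂᵐ`. -/
abbrev L2Vec (n m : ℕ) : Type :=
  Lp (EuclideanSpace ℂ (Fin m)) 2 (volume : Measure (Space n))

/-- `A(t, ξ)` is the symbol of a first order regularly hyperbolic system with integrable time
derivative, and `φ j t ξ` are its characteristic roots. Values at `ξ = 0` play no role. -/
structure IsRegularlyHyperbolic {n m : ℕ} (A : ℝ → Space n → Matrix (Fin m) (Fin m) ℂ)
    (φ : Fin m → ℝ → Space n → ℝ) : Prop where
  /-- Positive homogeneity of order one in `ξ`. -/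
  homogeneous : ∀ (t c : ℝ) (ξ : Space n), 0 < c → ξ ≠ 0 → A t (c • ξ) = (c : ℂ) • A t ξ
  /-- Continuity of the symbol in `ξ ≠ 0`. -/
  continuousOn_freq : ∀ (t : ℝ) (i j : Fin m), ContinuousOn (fun ξ => A t ξ i j) {0}ᶜ
  /-- The coefficients are locally Lipschitz in time. -/
  locallyLipschitz : ∀ (ξ : Space n) (i j : Fin m), ξ ≠ 0 → LocallyLipschitz (fun t => A t ξ i j)
  /-- The time derivatives are integrable over `ℝ`. -/
  integrable_deriv : ∀ (ξ : Space n) (i j : Fin m), ξ ≠ 0 →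
    Integrable (deriv (fun t => A t ξ i j))
  /-- Their `L¹(ℝ)` norms are bounded over the directions `|ξ| = 1`. -/
  uniform_deriv : ∃ K : ℝ, ∀ (ξ : Space n) (i j : Fin m), ‖ξ‖ = 1 →
    ∫ t, ‖deriv (fun s => A s ξ i j) t‖ ≤ K
  /-- The `φ j t ξ` are the roots `τ` of `det (τ I - A(t, ξ))`, and they are real. -/
  roots : ∀ (t : ℝ) (ξ : Space n), ξ ≠ 0 → ∀ τ : ℂ,
    (τ • (1 : Matrix (Fin m) (Fin m) ℂ) - A t ξ).det = ∏ j, (τ - (φ j t ξ : ℂ))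
  /-- The roots are labelled continuously in time. -/
  continuous_roots : ∀ (j : Fin m) (ξ : Space n), ξ ≠ 0 → Continuous (fun t => φ j t ξ)
  /-- The roots are uniformly separated. -/
  separated : ∃ d : ℝ, 0 < d ∧ ∀ (t : ℝ) (ξ : Space n), ‖ξ‖ = 1 → ∀ j k : Fin m, j ≠ k →
    d ≤ |φ j t ξ - φ k t ξ|

/-- `U ∈ C(ℝ; (L²(ℝⁿ))ᵐ)` solves `D_t U = A(t, D_x) U` with `D_t = -i ∂_t`, `D_x = -i ∂_x`, in
the weak sense: for each Schwartz function `χ`,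
`d/dt ⟨χ, U(t)⟩ = ⟨χ, i A(t, D_x) U(t)⟩`,
where the right-hand side is computed on the Fourier side. The Fourier transform
used here is `∫ e^{-2πi x·ξ} f(x) dx`, so `D_x` becomes multiplication by `2πξ`. -/
def IsSolution {n m : ℕ} (A : ℝ → Space n → Matrix (Fin m) (Fin m) ℂ)
    (U : ℝ → L2Vec n m) : Prop :=
  Continuous U ∧
  ∀ (χ : 𝓢(Space n, EuclideanSpace ℂ (Fin m))) (t : ℝ),
    HasDerivAt (fun s : ℝ => ∫ x, inner ℂ (χ x) (U s x))
      (∫ ξ, inner ℂ (𝓕 χ ξ)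
        (Complex.I • Matrix.toEuclideanLin (A t ((2 * Real.pi) • ξ)) (𝓕 (U t) ξ))) t

/-- `‖U(t) - V(t)‖ → 0` in `(L²(ℝⁿ))ᵐ` along `l` (the end `t → +∞` or `t → -∞`). -/
def IsAsymptoticTo {n m : ℕ} (l : Filter ℝ) (U V : ℝ → L2Vec n m) : Prop :=
  Tendsto (fun t => ‖U t - V t‖) l (𝓝 0)

/-- `U` is asymptotically free along `l`: it is asymptotic to some solution `V` of the constant
coefficient system `D_t V = B(D_x) V`. -/
def IsAsymptoticallyFree {n m : ℕ} (l : Filter ℝ) (B : Space n → Matrix (Fin m) (Fin m) ℂ)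
    (U : ℝ → L2Vec n m) : Prop :=
  ∃ V : ℝ → L2Vec n m, IsSolution (fun _ => B) V ∧ IsAsymptoticTo l U V

/-!
On the Fourier side the system decouples into ordinary differential equations
`u' = i λ M(t) u`, one for each frequency `ξ`, where `M(t) = A(t, ξ / |ξ|)` depends on the direction
of `ξ` only and `λ = 2π|ξ|`. Everything rests on estimates for this equation that are uniform in
`λ` and in the direction.

Fix a direction and let `ω(t)` be (a multiple of) the variation of the symbol on `[0, t]`, a bounded
continuous increasing function, called the clock below. The eigenvalues of `M(t)` move at most as
fast as the clock, by the Bauer–Fike bound and the separation of the roots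
(`abs_eigenvalue_sub_le`); hence so do the spectral projections `P_j(t)`, which are Lagrange
interpolation polynomials in `M(t)` (`exists_spectralFamily`). The clock has limits at `±∞`, so the
symbol, its roots and its projections have them too.

The mode amplitude `exp(-iλ ∫₀ᵗ φ_j) P_j(t) u(t)` would be constant if `P_j` were. Since the
derivative of `exp(-iλ ∫₀ᵗ φ_j) P_j(x) u(t)` vanishes at `t = x`, its increments are bounded by
those of the clock times `‖u‖`, *whatever the value of `λ`*
(`SpectralFamily.mode_right_increment`). A Gronwall argument relative to the clock bounds `u`
uniformly (`SpectralFamily.norm_solution_le`), so the propagators `E(t, ξ)` of the equation are bounded and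
define Fourier multipliers on `L²`. They solve the Cauchy problem
(`isMultiplierSolution_propagator`), and uniqueness follows by cutting off high frequencies and
applying the Lipschitz theory in `L²` (`IsMultiplierSolution.ext`). Moreover each mode amplitude has
a limit `y_j` at `±∞` (`SpectralFamily.exists_tendsto_mode`).

Comparing with the limiting equation, whose mode amplitudes are constant, the `j`-th component of
the solution carried back by the limiting flow is asymptotically `exp(iλ ψ_j(t)) y_j`
(`SpectralFamily.tendsto_proj_sub_mode`).

* If every `ψ_j` converges, then so does `E_±(t)⁻¹ E(t)` at every frequency, boundedly, and by
  dominated convergence the corresponding multipliers converge strongly. The limit is the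
  wave operator; it is invertible because the inverses converge too (`wave_operator`).
* If every `|ψ_j|` tends to infinity and the solution is asymptotically free, then on almost every
  ray of frequencies and along a sequence of times, `exp(iλ ψ_j(t_k)) y_j(λ)` converges for almost
  every `λ`. By the Riemann–Lebesgue lemma it converges weakly to zero in `λ`, while its modulus is
  constant in `k`; hence `y_j = 0` (`ae_eq_zero_of_tendsto_exp_smul`), and a solution whose mode
  amplitudes all tend to zero vanishes (`SpectralFamily.eq_zero_of_tendsto_mode_zero`).
-/

/-! ### Calculus with one-sided increments and Lipschitz functions -/

/-- A continuous function whose increments to the right of each point are at most `o(z - x)` is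
antitone. The error term `ε (z - x)` is what differentiability at `x` alone provides. -/
theorem antitone_of_right_increment_le {f : ℝ → ℝ} (hf : Continuous f)
    (h : ∀ x, ∀ ε > 0, ∀ᶠ z in 𝓝[>] x, f z ≤ f x + ε * (z - x)) : Antitone f := by
  intro a b hab
  refine image_le_of_liminf_slope_right_le_deriv_boundary (f := f) (a := a) (b := b)
    (B := fun _ => f a) (B' := fun _ => 0) hf.continuousOn le_rfl continuousOn_const
    (fun x _ => hasDerivWithinAt_const _ _ _) ?_ (Set.right_mem_Icc.2 hab)
  intro x _ r hr
  refine Eventually.frequently ?_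
  filter_upwards [h x (r / 2) (by linarith), self_mem_nhdsWithin] with z hz hxz
  have hxz' : 0 < z - x := sub_pos.2 hxz
  rw [slope_def_field, div_lt_iff₀ hxz']
  nlinarith

/-- The clock version of the mean value inequality: bounds for the infinitesimal increments of `f`
by those of `ω` add up, although neither `f` nor `ω` need be differentiable anywhere. -/
theorem norm_sub_le_of_right_increment_le {E : Type*} [NormedAddCommGroup E] {f : ℝ → E}
    {ω : ℝ → ℝ} {C : ℝ} (hf : Continuous f) (hω : Continuous ω)
    (h : ∀ x, ∀ ε > 0, ∀ᶠ z in 𝓝[>] x, ‖f z - f x‖ ≤ C * (ω z - ω x) + ε * (z - x))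
    {a b : ℝ} (hab : a ≤ b) : ‖f b - f a‖ ≤ C * (ω b - ω a) := by
  have hanti : Antitone (fun z => ‖f z - f a‖ - C * ω z) := by
    refine antitone_of_right_increment_le (by fun_prop) ?_
    intro x ε hε
    filter_upwards [h x ε hε] with z hz
    have := norm_sub_le_norm_sub_add_norm_sub (f z) (f x) (f a)
    linarith
  have := hanti hab
  simp only [sub_self, norm_zero] at this
  linarith

theorem exists_tendsto_of_norm_sub_le {E : Type*} [NormedAddCommGroup E] [CompleteSpace E]
    {f : ℝ → E} {ω : ℝ → ℝ} {C c : ℝ} {l : Filter ℝ} [l.NeBot] (hω : Tendsto ω l (𝓝 c))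
    (h : ∀ s t, ‖f t - f s‖ ≤ C * |ω t - ω s|) : ∃ y, Tendsto f l (𝓝 y) := by
  refine cauchy_map_iff_exists_tendsto.1 (cauchy_map_iff.2 ⟨inferInstance, ?_⟩)
  have h1 := (cauchy_map_iff.1 hω.cauchy_map).2
  rw [tendsto_uniformity_iff_dist_tendsto_zero] at h1 ⊢
  refine squeeze_zero (fun _ => dist_nonneg) (fun p => ?_) (by simpa using h1.const_mul C)
  rw [dist_eq_norm, Real.dist_eq]
  exact h _ _

theorem LocallyLipschitz.integral_deriv_eq_sub_real {f : ℝ → ℝ} (hf : LocallyLipschitz f)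
    (a b : ℝ) : ∫ t in a..b, deriv f t = f b - f a := by
  obtain ⟨K, hK⟩ := (hf.locallyLipschitzOn (s := Set.uIcc a b)).exists_lipschitzOnWith_of_compact
    isCompact_uIcc
  exact hK.absolutelyContinuousOnInterval.integral_deriv_eq_sub

theorem LocallyLipschitz.integral_deriv_eq_sub {f : ℝ → ℂ} (hf : LocallyLipschitz f)
    (hint : Integrable (deriv f)) (a b : ℝ) : ∫ t in a..b, deriv f t = f b - f a := by
  have hre : LocallyLipschitz (fun t => (f t).re) :=
    (Complex.reCLM.lipschitz.locallyLipschitz).comp hf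
  have him : LocallyLipschitz (fun t => (f t).im) :=
    (Complex.imCLM.lipschitz.locallyLipschitz).comp hf
  have hd : ∀ᵐ t, DifferentiableAt ℝ f t := by
    have hN : ∀ k : ℕ, ∀ᵐ t, t ∈ Set.Ioo (-(k : ℝ)) k → DifferentiableAt ℝ f t := by
      intro k
      obtain ⟨K, hK⟩ := (hf.locallyLipschitzOn (s := Set.Icc (-(k : ℝ)) k)
        ).exists_lipschitzOnWith_of_compact isCompact_Icc
      filter_upwards [hK.ae_differentiableWithinAt_of_mem] with t ht htm
      exact (ht (Set.Ioo_subset_Icc_self htm)).differentiableAt (Icc_mem_nhds htm.1 htm.2)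
    filter_upwards [ae_all_iff.2 hN] with t ht
    obtain ⟨k, hk⟩ := exists_nat_gt |t|
    exact ht k (abs_lt.1 hk)
  have e1 : (fun t => (deriv f t).re) =ᵐ[volume] deriv (fun t => (f t).re) := by
    filter_upwards [hd] with t ht
    exact ((Complex.reCLM.hasFDerivAt.comp_hasDerivAt t ht.hasDerivAt).deriv).symm
  have e2 : (fun t => (deriv f t).im) =ᵐ[volume] deriv (fun t => (f t).im) := by
    filter_upwards [hd] with t ht
    exact ((Complex.imCLM.hasFDerivAt.comp_hasDerivAt t ht.hasDerivAt).deriv).symm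
  have hi : IntervalIntegrable (deriv f) volume a b := hint.intervalIntegrable
  apply Complex.ext
  · have := Complex.reCLM.intervalIntegral_comp_comm hi
    simp only [Complex.reCLM_apply] at this
    rw [← this, intervalIntegral.integral_congr_ae (e1.mono fun t h _ => h),
      hre.integral_deriv_eq_sub_real]; simp
  · have := Complex.imCLM.intervalIntegral_comp_comm hi
    simp only [Complex.imCLM_apply] at this
    rw [← this, intervalIntegral.integral_congr_ae (e2.mono fun t h _ => h),
      him.integral_deriv_eq_sub_real]; simp

/-! ### Spectral families and the energy estimate -/

/-- Gronwall's inequality relative to a continuous increasing clock `ω`, in both directions of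
time. -/
theorem le_exp_mul_of_right_increment_le {N ω : ℝ → ℝ} {K : ℝ} (hN : Continuous N)
    (hN0 : ∀ t, 0 ≤ N t) (hω : Continuous ω) (hmono : Monotone ω) (hK : 0 ≤ K)
    (h : ∀ x, ∀ ε > 0, ∀ᶠ z in 𝓝[>] x, |N z - N x| ≤ K * (ω z - ω x) * N z + ε * (z - x))
    (s t : ℝ) : N t ≤ Real.exp (2 * K * |ω t - ω s|) * N s := by
  have hsmall : ∀ x, ∀ᶠ z in 𝓝[>] x, K * (ω z - ω x) ≤ 1 / 2 := by
    intro x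
    have : Tendsto (fun z => K * (ω z - ω x)) (𝓝[>] x) (𝓝 0) := by
      have : Continuous (fun z => K * (ω z - ω x)) := by fun_prop
      simpa using (this.tendsto x).mono_left nhdsWithin_le_nhds
    exact (this.eventually (gt_mem_nhds (by norm_num : (0 : ℝ) < 1 / 2))).mono fun z hz => hz.le
  -- the constant `2` in the exponent comes from this inequality
  have hexp : ∀ z : ℝ, 0 ≤ z → z ≤ 1 / 2 → Real.exp (-(2 * z)) ≤ 1 - z := by
    intro z h0 h1
    rw [Real.exp_neg, inv_le_comm₀ (Real.exp_pos _) (by linarith)]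
    have h2 : (1 - z)⁻¹ ≤ 1 + 2 * z := by
      rw [inv_le_iff_one_le_mul₀ (by linarith)]; nlinarith
    have := Real.add_one_le_exp (2 * z)
    linarith
  have hup : Antitone (fun z => N z * Real.exp (-(2 * K * ω z))) := by
    refine antitone_of_right_increment_le (by fun_prop) ?_
    intro x ε hε
    filter_upwards [h x (ε * Real.exp (2 * K * ω x)) (by positivity), hsmall x,
      self_mem_nhdsWithin] with z hz hz2 hxz
    have hxz' : x < z := hxz
    have hd : 0 ≤ K * (ω z - ω x) := mul_nonneg hK (sub_nonneg.2 (hmono hxz'.le))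
    have h1 : N z * (1 - K * (ω z - ω x)) ≤ N x + ε * Real.exp (2 * K * ω x) * (z - x) := by
      have := (abs_le.1 hz).2; linarith
    have h2 : N z * Real.exp (-(2 * (K * (ω z - ω x))))
        ≤ N x + ε * Real.exp (2 * K * ω x) * (z - x) :=
      (mul_le_mul_of_nonneg_left (hexp _ hd hz2) (hN0 z)).trans h1
    have h3 := mul_le_mul_of_nonneg_right h2 (Real.exp_pos (-(2 * K * ω x))).le
    have e1 : Real.exp (-(2 * K * ω z))
        = Real.exp (-(2 * (K * (ω z - ω x)))) * Real.exp (-(2 * K * ω x)) := by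
      rw [← Real.exp_add]; ring_nf
    have e2 : Real.exp (2 * K * ω x) * Real.exp (-(2 * K * ω x)) = 1 := by
      rw [← Real.exp_add]; simp
    rw [e1]
    calc _ = N z * Real.exp (-(2 * (K * (ω z - ω x)))) * Real.exp (-(2 * K * ω x)) := by ring
      _ ≤ _ := h3
      _ = N x * Real.exp (-(2 * K * ω x)) +
          ε * (z - x) * (Real.exp (2 * K * ω x) * Real.exp (-(2 * K * ω x))) := by ring
      _ = _ := by rw [e2]; ring
  have hdown : Antitone (fun z => -(N z * Real.exp (2 * K * ω z))) := by
    refine antitone_of_right_increment_le (by fun_prop) ?_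
    intro x ε hε
    filter_upwards [h x (ε * Real.exp (-(2 * K * ω x))) (by positivity),
      self_mem_nhdsWithin] with z hz hxz
    have hxz' : x < z := hxz
    have hd : 0 ≤ K * (ω z - ω x) := mul_nonneg hK (sub_nonneg.2 (hmono hxz'.le))
    have h1 : N x ≤ N z * (1 + K * (ω z - ω x)) + ε * Real.exp (-(2 * K * ω x)) * (z - x) := by
      have := (abs_le.1 hz).1; linarith
    have h0 : 1 + K * (ω z - ω x) ≤ Real.exp (2 * (K * (ω z - ω x))) := by
      have := Real.add_one_le_exp (2 * (K * (ω z - ω x))); linarith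
    have h2 := mul_le_mul_of_nonneg_left h0 (hN0 z)
    have h3 : N x ≤ N z * Real.exp (2 * (K * (ω z - ω x)))
      + ε * Real.exp (-(2 * K * ω x)) * (z - x) := by linarith
    have h4 := mul_le_mul_of_nonneg_right h3 (Real.exp_pos (2 * K * ω x)).le
    have e1 : Real.exp (2 * K * ω z)
        = Real.exp (2 * (K * (ω z - ω x))) * Real.exp (2 * K * ω x) := by
      rw [← Real.exp_add]; ring_nf
    have e2 : Real.exp (-(2 * K * ω x)) * Real.exp (2 * K * ω x) = 1 := by
      rw [← Real.exp_add]; simp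
    have e3 : (N z * Real.exp (2 * (K * (ω z - ω x)))
      + ε * Real.exp (-(2 * K * ω x)) * (z - x)) * Real.exp (2 * K * ω x)
      = N z * (Real.exp (2 * (K * (ω z - ω x))) * Real.exp (2 * K * ω x))
        + ε * (z - x) * (Real.exp (-(2 * K * ω x)) * Real.exp (2 * K * ω x)) := by ring
    rw [e3, ← e1, e2] at h4
    linarith
  rcases le_total s t with hst | hst
  · rw [abs_of_nonneg (sub_nonneg.2 (hmono hst))]
    have h1 := mul_le_mul_of_nonneg_right (hup hst) (Real.exp_pos (2 * K * ω t)).le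
    simp only [mul_assoc, ← Real.exp_add] at h1
    ring_nf at h1 ⊢
    simpa using h1
  · rw [abs_of_nonpos (sub_nonpos.2 (hmono hst))]
    have h1 := mul_le_mul_of_nonneg_right (neg_le_neg (hdown hst))
      (Real.exp_pos (-(2 * K * ω t))).le
    simp only [mul_assoc, ← Real.exp_add, neg_neg] at h1
    ring_nf at h1 ⊢
    simpa using h1

/-- A resolution of the identity `∑ P j t = 1` diagonalising `M t` with real eigenvalues `φ j t`,
whose members are bounded by `C` and have variation controlled by the increasing function `ω`. -/
structure SpectralFamily {ι E : Type*} [Fintype ι] [NormedAddCommGroup E] [NormedSpace ℂ E]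
    (M : ℝ → E →L[ℂ] E) (φ : ι → ℝ → ℝ) (P : ι → ℝ → E →L[ℂ] E) (ω : ℝ → ℝ) (C : ℝ) : Prop where
  continuous_clock : Continuous ω
  monotone_clock : Monotone ω
  continuous_phase : ∀ j, Continuous (φ j)
  sum_proj : ∀ t, ∑ j, P j t = 1
  proj_mul : ∀ j t, P j t * M t = (φ j t : ℂ) • P j t
  norm_proj_le : ∀ j t, ‖P j t‖ ≤ C
  norm_proj_sub_le : ∀ j s t, ‖P j t - P j s‖ ≤ C * |ω t - ω s|

namespace SpectralFamily

section Mode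

variable {ι E : Type*} [NormedAddCommGroup E] [NormedSpace ℂ E]

/-- The amplitude of the `j`-th mode of `u`, with the oscillation of frequency `r φ j` removed. -/
noncomputable def mode (φ : ι → ℝ → ℝ) (P : ι → ℝ → E →L[ℂ] E) (r : ℝ) (u : ℝ → E) (j : ι)
    (t : ℝ) : E :=
  Complex.exp (-(Complex.I * r * ((∫ s in (0 : ℝ)..t, φ j s : ℝ) : ℂ))) • P j t (u t)

theorem norm_phase (r x : ℝ) : ‖Complex.exp (-(Complex.I * r * (x : ℂ)))‖ = 1 := by
  have : -(Complex.I * r * (x : ℂ)) = ((-(r * x) : ℝ) : ℂ) * Complex.I := by push_cast; ring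
  rw [this, Complex.norm_exp_ofReal_mul_I]

theorem norm_mode (φ : ι → ℝ → ℝ) (P : ι → ℝ → E →L[ℂ] E) (r : ℝ) (u : ℝ → E) (j : ι) (t : ℝ) :
    ‖mode φ P r u j t‖ = ‖P j t (u t)‖ := by
  rw [mode, norm_smul, norm_phase, one_mul]

end Mode

variable {ι E : Type*} [Fintype ι] [NormedAddCommGroup E] [NormedSpace ℂ E]
  {M : ℝ → E →L[ℂ] E} {φ : ι → ℝ → ℝ} {P : ι → ℝ → E →L[ℂ] E} {ω : ℝ → ℝ} {C : ℝ}

theorem continuous_proj (h : SpectralFamily M φ P ω C) (j : ι) : Continuous (P j) := by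
  refine continuous_iff_continuousAt.2 fun x => ?_
  rw [ContinuousAt, tendsto_iff_norm_sub_tendsto_zero]
  refine squeeze_zero (fun _ => norm_nonneg _) (fun z => h.norm_proj_sub_le j x z) ?_
  have : Continuous (fun z => C * |ω z - ω x|) := by
    have := h.continuous_clock; fun_prop
  simpa using this.tendsto x

theorem norm_le_sum (h : SpectralFamily M φ P ω C) (t : ℝ) (v : E) :
    ‖v‖ ≤ ∑ j, ‖P j t v‖ := by
  have : v = ∑ j, P j t v := by
    have := congrArg (fun T : E →L[ℂ] E => T v) (h.sum_proj t)
    simpa using this.symm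
  calc ‖v‖ = ‖∑ j, P j t v‖ := by rw [← this]
    _ ≤ _ := norm_sum_le _ _

theorem hasDerivAt_phase (h : SpectralFamily M φ P ω C) (r : ℝ) (j : ι) (x : ℝ) :
    HasDerivAt (fun t => Complex.exp (-(Complex.I * r * ((∫ s in (0 : ℝ)..t, φ j s : ℝ) : ℂ))))
      (Complex.exp (-(Complex.I * r * ((∫ s in (0 : ℝ)..x, φ j s : ℝ) : ℂ)))
        * (-(Complex.I * r * φ j x))) x := by
  have h1 : HasDerivAt (fun t => ∫ s in (0 : ℝ)..t, φ j s) (φ j x) x :=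
    intervalIntegral.integral_hasDerivAt_right ((h.continuous_phase j).intervalIntegrable _ _)
      ((h.continuous_phase j).stronglyMeasurableAtFilter _ _) (h.continuous_phase j).continuousAt
  exact ((h1.ofReal_comp.const_mul (Complex.I * r)).neg).cexp

section Solution

variable {r : ℝ} {u : ℝ → E}

theorem continuous_mode (h : SpectralFamily M φ P ω C)
    (hu : Continuous u) (j : ι) :
    Continuous (mode φ P r u j) := by
  have h1 : Continuous (fun t => Complex.exp
      (-(Complex.I * r * ((∫ s in (0 : ℝ)..t, φ j s : ℝ) : ℂ)))) :=
    continuous_iff_continuousAt.2 fun x => (h.hasDerivAt_phase r j x).continuousAt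
  exact h1.smul ((h.continuous_proj j).clm_apply hu)

/-- The increments of a mode amplitude come from the motion of the projection only: with the
projection frozen at time `x`, the amplitude has derivative zero at `x`, because the phase cancels
the action of `M x` on the range of `P j x`. Hence the bound by the clock is free of `r`. -/
theorem mode_right_increment (h : SpectralFamily M φ P ω C)
    (hu : ∀ t, HasDerivAt u ((Complex.I * r) • M t (u t)) t) (j : ι) (x : ℝ) {ε : ℝ} (hε : 0 < ε) :
    ∀ᶠ z in 𝓝[>] x, ‖mode φ P r u j z - mode φ P r u j x‖
      ≤ C * (ω z - ω x) * ‖u z‖ + ε * (z - x) := by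
  set e : ℝ → ℂ := fun t => Complex.exp
      (-(Complex.I * r * ((∫ s in (0 : ℝ)..t, φ j s : ℝ) : ℂ))) with he
  have hg : HasDerivAt (fun z => e z • P j x (u z)) 0 x := by
    have h1 := (h.hasDerivAt_phase r j x).smul
      (((P j x).restrictScalars ℝ).hasFDerivAt.comp_hasDerivAt x (hu x))
    refine h1.congr_deriv ?_
    have h2 : P j x (M x (u x)) = (φ j x : ℂ) • P j x (u x) := by
      have := congrArg (fun T : E →L[ℂ] E => T (u x)) (h.proj_mul j x)
      simpa using this
    simp only [ContinuousLinearMap.coe_restrictScalars', map_smul, h2, smul_smul, Function.comp]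
    rw [← add_smul]
    convert zero_smul ℂ _ using 2
    ring
  have ho := (hasDerivAt_iff_isLittleO.1 hg).def hε
  filter_upwards [nhdsWithin_le_nhds ho, self_mem_nhdsWithin] with z hz hxz
  have hxz' : x < z := hxz
  have e1 : mode φ P r u j z - mode φ P r u j x
      = e z • (P j z - P j x) (u z) + (e z • P j x (u z) - e x • P j x (u x)) := by
    simp only [mode, he, sub_apply, smul_sub]; abel
  rw [e1]
  refine (norm_add_le _ _).trans (add_le_add ?_ ?_)
  · rw [norm_smul, norm_phase, one_mul]
    refine ((P j z - P j x).le_opNorm _).trans ?_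
    refine mul_le_mul_of_nonneg_right ?_ (norm_nonneg _)
    have := h.norm_proj_sub_le j x z
    rwa [abs_of_nonneg (sub_nonneg.2 (h.monotone_clock hxz'.le))] at this
  · simpa [Real.norm_eq_abs, abs_of_pos (sub_pos.2 hxz')] using hz

/-- The energy estimate: the sum of the modes of a solution grows at most by the exponential of
the variation of `ω`, whatever the frequency `r`. -/
theorem sum_norm_le (h : SpectralFamily M φ P ω C) (hC : 0 ≤ C)
    (hu : ∀ t, HasDerivAt u ((Complex.I * r) • M t (u t)) t) (s t : ℝ) :
    ∑ j, ‖P j t (u t)‖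
      ≤ Real.exp (2 * (Fintype.card ι * C) * |ω t - ω s|) * ∑ j, ‖P j s (u s)‖ := by
  have hcu : Continuous u := continuous_iff_continuousAt.2 fun t => (hu t).continuousAt
  refine le_exp_mul_of_right_increment_le (N := fun t => ∑ j, ‖P j t (u t)‖) ?_
    (fun t => Finset.sum_nonneg fun _ _ => norm_nonneg _) h.continuous_clock h.monotone_clock
    (by positivity) ?_ s t
  · exact continuous_finsetSum _ fun j _ => ((h.continuous_proj j).clm_apply hcu).norm
  · intro x ε hε
    have hδ : 0 < ε / (Fintype.card ι + 1) := by positivity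
    filter_upwards [eventually_all.2 fun j => h.mode_right_increment hu j x hδ,
      self_mem_nhdsWithin] with z hz hxz
    have hxz' : 0 < z - x := sub_pos.2 hxz
    have hd : 0 ≤ ω z - ω x := sub_nonneg.2 (h.monotone_clock (le_of_lt hxz))
    simp only [← norm_mode φ P r u]
    rw [← Finset.sum_sub_distrib]
    calc |∑ j, (‖mode φ P r u j z‖ - ‖mode φ P r u j x‖)|
        ≤ ∑ j, |‖mode φ P r u j z‖ - ‖mode φ P r u j x‖| := Finset.abs_sum_le_sum_abs _ _
      _ ≤ ∑ j : ι, (C * (ω z - ω x) * ‖u z‖ + ε / (Fintype.card ι + 1) * (z - x)) :=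
          Finset.sum_le_sum fun j _ => (abs_norm_sub_norm_le _ _).trans (hz j)
      _ = Fintype.card ι * C * (ω z - ω x) * ‖u z‖
          + ε * (z - x) * (Fintype.card ι / (Fintype.card ι + 1)) := by
          rw [Finset.sum_const, Finset.card_univ, nsmul_eq_mul]; ring
      _ ≤ _ := by
          refine add_le_add (mul_le_mul_of_nonneg_left ?_ (by positivity)) ?_
          · simpa only [norm_mode] using h.norm_le_sum z (u z)
          · refine mul_le_of_le_one_right (by positivity) ?_
            rw [div_le_one (by positivity)]; linarith

/-- Solutions are bounded uniformly in time, and uniformly in the frequency `r`. -/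
theorem norm_solution_le (h : SpectralFamily M φ P ω C) (hC : 0 ≤ C) {K : ℝ}
    (hK : ∀ s t, |ω t - ω s| ≤ K)
    (hu : ∀ t, HasDerivAt u ((Complex.I * r) • M t (u t)) t) (s t : ℝ) :
    ‖u t‖ ≤ Real.exp (2 * (Fintype.card ι * C) * K) * (Fintype.card ι * C) * ‖u s‖ := by
  refine (h.norm_le_sum t (u t)).trans ((h.sum_norm_le hC hu s t).trans ?_)
  rw [mul_assoc (Real.exp _)]
  refine mul_le_mul (Real.exp_le_exp.2 (mul_le_mul_of_nonneg_left (hK s t) (by positivity))) ?_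
    (Finset.sum_nonneg fun _ _ => norm_nonneg _) (Real.exp_pos _).le
  calc ∑ j, ‖P j s (u s)‖ ≤ ∑ j : ι, C * ‖u s‖ :=
        Finset.sum_le_sum fun j _ => (P j s).le_of_opNorm_le (h.norm_proj_le j s) _
    _ = _ := by rw [Finset.sum_const, Finset.card_univ, nsmul_eq_mul]; ring

/-- The mode amplitudes vary no faster than the clock. -/
theorem norm_mode_sub_le (h : SpectralFamily M φ P ω C) (hC : 0 ≤ C) {D : ℝ}
    (hD : ∀ t, ‖u t‖ ≤ D)
    (hu : ∀ t, HasDerivAt u ((Complex.I * r) • M t (u t)) t) (j : ι) (s t : ℝ) :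
    ‖mode φ P r u j t - mode φ P r u j s‖ ≤ C * D * |ω t - ω s| := by
  have hcu : Continuous u := continuous_iff_continuousAt.2 fun t => (hu t).continuousAt
  have key : ∀ a b, a ≤ b →
      ‖mode φ P r u j b - mode φ P r u j a‖ ≤ C * D * (ω b - ω a) := by
    intro a b hab
    refine norm_sub_le_of_right_increment_le (h.continuous_mode hcu j) h.continuous_clock ?_ hab
    intro x ε hε
    filter_upwards [h.mode_right_increment hu j x hε, self_mem_nhdsWithin] with z hz hxz
    refine hz.trans (add_le_add ?_ le_rfl)
    have hd : 0 ≤ ω z - ω x := sub_nonneg.2 (h.monotone_clock (le_of_lt hxz))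
    calc C * (ω z - ω x) * ‖u z‖ ≤ C * (ω z - ω x) * D :=
          mul_le_mul_of_nonneg_left (hD z) (by positivity)
      _ = _ := by ring
  rcases le_total s t with hst | hst
  · rw [abs_of_nonneg (sub_nonneg.2 (h.monotone_clock hst))]; exact key s t hst
  · rw [abs_of_nonpos (sub_nonpos.2 (h.monotone_clock hst)), norm_sub_rev, neg_sub]
    exact key t s hst

theorem exists_tendsto_mode [CompleteSpace E] (h : SpectralFamily M φ P ω C) (hC : 0 ≤ C) {D : ℝ}
    (hD : ∀ t, ‖u t‖ ≤ D)
    (hu : ∀ t, HasDerivAt u ((Complex.I * r) • M t (u t)) t) (j : ι) {l : Filter ℝ} [l.NeBot]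
    {c : ℝ} (hl : Tendsto ω l (𝓝 c)) : ∃ y, Tendsto (mode φ P r u j) l (𝓝 y) :=
  exists_tendsto_of_norm_sub_le hl (h.norm_mode_sub_le hC hD hu j)

end Solution

end SpectralFamily

/-! ### Lagrange spectral projections of a matrix -/

/-- The operator on `ℂᵐ` with matrix `X`. -/
noncomputable abbrev matOp {m : ℕ} (X : Matrix (Fin m) (Fin m) ℂ) :
    EuclideanSpace ℂ (Fin m) →L[ℂ] EuclideanSpace ℂ (Fin m) :=
  Matrix.toEuclideanCLM (n := Fin m) (𝕜 := ℂ) X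

section Lagrange

variable {ι E : Type*} [Fintype ι] [DecidableEq ι] [NormedAddCommGroup E] [NormedSpace ℂ E]

/-- The value at `T` of the Lagrange basis polynomial of the node `v j`; it is the spectral
projection of `T` for the eigenvalue `v j` when the `v k` are the distinct eigenvalues of `T`. -/
noncomputable def lagrangeProj (T : E →L[ℂ] E) (v : ι → ℝ) (j : ι) : E →L[ℂ] E :=
  Polynomial.aeval T (Lagrange.basis Finset.univ (fun k => (v k : ℂ)) j)

theorem sum_lagrangeProj [Nonempty ι] (T : E →L[ℂ] E) {v : ι → ℝ} (hv : Function.Injective v) :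
    ∑ j, lagrangeProj T v j = 1 := by
  have h := Lagrange.sum_basis (s := Finset.univ) (v := fun k => (v k : ℂ))
    ((Complex.ofReal_injective.comp hv).injOn) Finset.univ_nonempty
  simp only [lagrangeProj]
  rw [← map_sum, h, map_one]

theorem lagrangeProj_mul (T : E →L[ℂ] E) (v : ι → ℝ) (j : ι)
    (hT : Polynomial.aeval T (Lagrange.nodal Finset.univ (fun k => (v k : ℂ))) = 0) :
    lagrangeProj T v j * T = (v j : ℂ) • lagrangeProj T v j := by
  have h1 : Lagrange.basis Finset.univ (fun k => (v k : ℂ)) j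
        * (Polynomial.X - Polynomial.C (v j : ℂ))
      = (∏ k ∈ Finset.univ.erase j, Polynomial.C (((v j : ℂ) - v k)⁻¹))
        * Lagrange.nodal Finset.univ (fun k => (v k : ℂ)) := by
    rw [Lagrange.nodal_eq_mul_nodal_erase (Finset.mem_univ j), Lagrange.basis, Lagrange.nodal_eq]
    simp only [Lagrange.basisDivisor, Finset.prod_mul_distrib]
    ring
  have h2 := congrArg (Polynomial.aeval T) h1
  rw [map_mul, map_mul, hT, mul_zero, map_sub, Polynomial.aeval_X, Polynomial.aeval_C, mul_sub,
    sub_eq_zero] at h2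
  rw [lagrangeProj, h2, Algebra.algebraMap_eq_smul_one, mul_smul_comm, mul_one]

theorem aeval_basisDivisor (T : E →L[ℂ] E) (x y : ℝ) :
    Polynomial.aeval T (Lagrange.basisDivisor (x : ℂ) (y : ℂ))
      = ((x - y : ℝ)⁻¹ : ℂ) • (T - (y : ℂ) • (1 : E →L[ℂ] E)) := by
  simp [Lagrange.basisDivisor, Algebra.algebraMap_eq_smul_one]

end Lagrange

section Product

variable {ι E : Type*} [DecidableEq ι] [NormedAddCommGroup E] [NormedSpace ℂ E]

theorem norm_aeval_prod_le {T : E →L[ℂ] E} {p : ι → Polynomial ℂ} {b : ℝ} (hb : 1 ≤ b)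
    (s : Finset ι) (h : ∀ k ∈ s, ‖Polynomial.aeval T (p k)‖ ≤ b) :
    ‖Polynomial.aeval T (∏ k ∈ s, p k)‖ ≤ b ^ s.card := by
  induction s using Finset.induction_on with
  | empty =>
    rw [Finset.prod_empty, map_one, Finset.card_empty, pow_zero]
    exact ContinuousLinearMap.norm_id_le
  | insert a s ha ih =>
    rw [Finset.prod_insert ha, map_mul, Finset.card_insert_of_notMem ha, pow_succ']
    exact (norm_mul_le _ _).trans (mul_le_mul (h a (Finset.mem_insert_self _ _))
      (ih fun k hk => h k (Finset.mem_insert_of_mem hk)) (norm_nonneg _) (by linarith))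

theorem norm_aeval_prod_sub_le {T T' : E →L[ℂ] E} {p p' : ι → Polynomial ℂ} {b δ : ℝ} (hb : 1 ≤ b)
    (hδ : 0 ≤ δ) (s : Finset ι) (h : ∀ k ∈ s, ‖Polynomial.aeval T (p k)‖ ≤ b)
    (h' : ∀ k ∈ s, ‖Polynomial.aeval T' (p' k)‖ ≤ b)
    (hd : ∀ k ∈ s, ‖Polynomial.aeval T (p k) - Polynomial.aeval T' (p' k)‖ ≤ δ) :
    ‖Polynomial.aeval T (∏ k ∈ s, p k) - Polynomial.aeval T' (∏ k ∈ s, p' k)‖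
      ≤ s.card * b ^ s.card * δ := by
  induction s using Finset.induction_on with
  | empty => simp
  | insert a s ha ih =>
    have ih' := ih (fun k hk => h k (Finset.mem_insert_of_mem hk))
      (fun k hk => h' k (Finset.mem_insert_of_mem hk))
      (fun k hk => hd k (Finset.mem_insert_of_mem hk))
    have hs := norm_aeval_prod_le (T := T) hb s (fun k hk => h k (Finset.mem_insert_of_mem hk))
    have ha1 := h' a (Finset.mem_insert_self _ _)
    have ha2 := hd a (Finset.mem_insert_self _ _)
    rw [Finset.prod_insert ha, Finset.prod_insert ha, map_mul, map_mul,
      Finset.card_insert_of_notMem ha]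
    set x := Polynomial.aeval T (p a)
    set x' := Polynomial.aeval T' (p' a)
    set y := Polynomial.aeval T (∏ k ∈ s, p k)
    set y' := Polynomial.aeval T' (∏ k ∈ s, p' k)
    have e : x * y - x' * y' = (x - x') * y + x' * (y - y') := by noncomm_ring
    have hbs : 0 ≤ b ^ s.card := by positivity
    rw [e]
    calc ‖(x - x') * y + x' * (y - y')‖ ≤ ‖x - x'‖ * ‖y‖ + ‖x'‖ * ‖y - y'‖ :=
          (norm_add_le _ _).trans (add_le_add (norm_mul_le _ _) (norm_mul_le _ _))
      _ ≤ δ * b ^ s.card + b * (s.card * b ^ s.card * δ) :=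
          add_le_add (mul_le_mul ha2 hs (norm_nonneg _) hδ)
            (mul_le_mul ha1 ih' (norm_nonneg _) (by linarith))
      _ ≤ δ * (b * b ^ s.card) + b * (s.card * b ^ s.card * δ) := by
          gcongr; exact le_mul_of_one_le_left hbs hb
      _ = _ := by push_cast; ring

end Product

section Matrix

variable {m : ℕ} {X : Matrix (Fin m) (Fin m) ℂ} {v : Fin m → ℝ}

/-- The Cayley–Hamilton theorem: the characteristic polynomial of `X` is the nodal polynomial of
the roots. -/
theorem aeval_matOp_nodal
    (h : ∀ τ : ℂ, (τ • (1 : Matrix (Fin m) (Fin m) ℂ) - X).det = ∏ j, (τ - (v j : ℂ))) :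
    Polynomial.aeval (matOp X) (Lagrange.nodal Finset.univ (fun k => (v k : ℂ))) = 0 := by
  have h1 : X.charpoly = Lagrange.nodal Finset.univ (fun k => (v k : ℂ)) := by
    refine Polynomial.funext fun τ => ?_
    rw [Matrix.eval_charpoly, Lagrange.eval_nodal, ← h τ, Matrix.smul_one_eq_diagonal]
    rfl
  rw [← h1]
  have := Polynomial.aeval_algHom_apply
    (Matrix.toEuclideanCLM (n := Fin m) (𝕜 := ℂ)).toAlgEquiv.toAlgHom X X.charpoly
  rw [Matrix.aeval_self_charpoly, map_zero] at this
  exact this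

theorem exists_eigenvector_matOp
    (h : ∀ τ : ℂ, (τ • (1 : Matrix (Fin m) (Fin m) ℂ) - X).det = ∏ j, (τ - (v j : ℂ)))
    (j : Fin m) : ∃ x : EuclideanSpace ℂ (Fin m), x ≠ 0 ∧ matOp X x = (v j : ℂ) • x := by
  have h0 : ((v j : ℂ) • (1 : Matrix (Fin m) (Fin m) ℂ) - X).det = 0 := by
    rw [h, Finset.prod_eq_zero (Finset.mem_univ j) (sub_self _)]
  obtain ⟨x, hx, hx0⟩ := Matrix.exists_mulVec_eq_zero_iff.2 h0
  refine ⟨WithLp.toLp 2 x, fun h => hx (by simpa using h), ?_⟩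
  rw [Matrix.sub_mulVec, Matrix.smul_mulVec, Matrix.one_mulVec, sub_eq_zero] at hx0
  rw [Matrix.toEuclideanCLM_toLp, ← hx0]
  rfl

theorem abs_root_le
    (h : ∀ τ : ℂ, (τ • (1 : Matrix (Fin m) (Fin m) ℂ) - X).det = ∏ j, (τ - (v j : ℂ)))
    (j : Fin m) : |v j| ≤ ‖matOp X‖ := by
  obtain ⟨x, hx, hx0⟩ := exists_eigenvector_matOp h j
  have h1 := (matOp X).le_opNorm x
  rw [hx0, norm_smul, Complex.norm_real, Real.norm_eq_abs] at h1
  exact le_of_mul_le_mul_right h1 (norm_pos_iff.2 hx)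

end Matrix

/-! ### Perturbation of eigenvalues and spectral projections -/

/-- The Bauer–Fike bound: an eigenvalue of `T'` lies within a multiple of `‖T - T'‖` of the
spectrum of a diagonalisable operator `T`. -/
theorem exists_abs_sub_eigenvalue_le {ι E : Type*} [Fintype ι] [NormedAddCommGroup E]
    [NormedSpace ℂ E] {T T' : E →L[ℂ] E} {P : ι → E →L[ℂ] E} {v : ι → ℝ} {C μ : ℝ} {x : E}
    (hsum : ∑ j, P j = 1) (hmul : ∀ j, P j * T = (v j : ℂ) • P j) (hC : ∀ j, ‖P j‖ ≤ C)
    (hx : x ≠ 0) (hx' : T' x = (μ : ℂ) • x) :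
    ∃ k, |v k - μ| ≤ Fintype.card ι * C * ‖T - T'‖ := by
  have hx1 : x = ∑ j, P j x := by
    have := congrArg (fun S : E →L[ℂ] E => S x) hsum
    simpa using this.symm
  have hxn : 0 < ‖x‖ := norm_pos_iff.2 hx
  have hne : Nonempty ι := by
    by_contra hne
    rw [not_nonempty_iff] at hne
    exact hx (hx1.trans (by simp))
  have hcard : (0 : ℝ) < Fintype.card ι := by exact_mod_cast Fintype.card_pos
  obtain ⟨k, -, hk⟩ := Finset.exists_le_of_sum_le (s := (Finset.univ : Finset ι))
    (f := fun _ => ‖x‖ / Fintype.card ι) (g := fun j => ‖P j x‖) Finset.univ_nonempty (by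
      rw [Finset.sum_const, Finset.card_univ, nsmul_eq_mul, mul_div_cancel₀ _ hcard.ne']
      conv_lhs => rw [hx1]
      exact norm_sum_le _ _)
  refine ⟨k, le_of_mul_le_mul_right ?_ hxn⟩
  have h1 : ((v k - μ : ℝ) : ℂ) • P k x = P k ((T - T') x) := by
    have h2 : P k (T x) = (v k : ℂ) • P k x := by
      have := congrArg (fun S : E →L[ℂ] E => S x) (hmul k)
      simpa using this
    rw [sub_apply, map_sub, h2, hx', map_smul]
    push_cast
    rw [sub_smul]
  have h3 : |v k - μ| * ‖P k x‖ ≤ C * (‖T - T'‖ * ‖x‖) := by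
    rw [← Real.norm_eq_abs, ← Complex.norm_real, ← norm_smul, h1]
    exact ((P k).le_of_opNorm_le (hC k) _).trans
      (mul_le_mul_of_nonneg_left ((T - T').le_opNorm x) ((norm_nonneg _).trans (hC k)))
  rw [div_le_iff₀ hcard] at hk
  calc |v k - μ| * ‖x‖ ≤ |v k - μ| * (‖P k x‖ * Fintype.card ι) :=
        mul_le_mul_of_nonneg_left hk (abs_nonneg _)
    _ = Fintype.card ι * (|v k - μ| * ‖P k x‖) := by ring
    _ ≤ Fintype.card ι * (C * (‖T - T'‖ * ‖x‖)) := mul_le_mul_of_nonneg_left h3 hcard.le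
    _ = _ := by ring

/-- A continuous eigenvalue `f` of a matrix family with separated real spectrum varies no faster
than the clock `ω` that controls the matrix: the Bauer–Fike bound locates an eigenvalue `φ k` near
the old value of `f`, and continuity with the separation shows that it is the new value of `f`. -/
theorem abs_eigenvalue_sub_le {ι E : Type*} [Fintype ι] [NormedAddCommGroup E]
    [NormedSpace ℂ E] {T : ℝ → E →L[ℂ] E} {P : ι → ℝ → E →L[ℂ] E} {φ : ι → ℝ → ℝ} {ω : ℝ → ℝ}
    {C d : ℝ} (hd : 0 < d) (hω : Continuous ω) (hωm : Monotone ω)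
    (hT : ∀ s t, ‖T t - T s‖ ≤ |ω t - ω s|)
    (hsum : ∀ t, ∑ j, P j t = 1) (hmul : ∀ j t, P j t * T t = (φ j t : ℂ) • P j t)
    (hC : ∀ j t, ‖P j t‖ ≤ C) (hC0 : 0 ≤ C)
    (hsep : ∀ t j k, j ≠ k → d ≤ |φ j t - φ k t|) {f : ℝ → ℝ} (hf : Continuous f)
    (hev : ∀ t, ∃ x : E, x ≠ 0 ∧ T t x = (f t : ℂ) • x) (s t : ℝ) :
    |f t - f s| ≤ Fintype.card ι * C * |ω t - ω s| := by
  have key : ∀ a b, a ≤ b → |f b - f a| ≤ Fintype.card ι * C * (ω b - ω a) := by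
    intro a b hab
    rw [← Real.norm_eq_abs]
    refine norm_sub_le_of_right_increment_le hf hω ?_ hab
    intro x ε hε
    have e1 : ∀ᶠ z in 𝓝[>] x, |f z - f x| < d / 2 := by
      have : Tendsto (fun z => |f z - f x|) (𝓝[>] x) (𝓝 0) := by
        have h : Continuous (fun z => |f z - f x|) := (hf.sub continuous_const).abs
        simpa using (h.tendsto x).mono_left nhdsWithin_le_nhds
      exact this.eventually (gt_mem_nhds (by positivity))
    have e2 : ∀ᶠ z in 𝓝[>] x, Fintype.card ι * C * (ω z - ω x) < d / 2 := by
      have : Tendsto (fun z => Fintype.card ι * C * (ω z - ω x)) (𝓝[>] x) (𝓝 0) := by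
        have h : Continuous (fun z => Fintype.card ι * C * (ω z - ω x)) := by fun_prop
        simpa using (h.tendsto x).mono_left nhdsWithin_le_nhds
      exact this.eventually (gt_mem_nhds (by positivity))
    filter_upwards [e1, e2, self_mem_nhdsWithin] with z h1 h2 hxz
    have hxz' : x < z := hxz
    obtain ⟨w, hw, hw'⟩ := hev x
    obtain ⟨k, hk⟩ := exists_abs_sub_eigenvalue_le (hsum z) (fun j => hmul j z)
      (fun j => hC j z) hw hw'
    obtain ⟨w₁, hw₁, hw₁'⟩ := hev z
    obtain ⟨i, hi⟩ := exists_abs_sub_eigenvalue_le (hsum z) (fun j => hmul j z)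
      (fun j => hC j z) hw₁ hw₁'
    have hi0 : φ i z = f z := by
      rw [sub_self, norm_zero, mul_zero] at hi
      exact sub_eq_zero.1 (abs_nonpos_iff.1 hi)
    have hk2 : |φ k z - f x| ≤ Fintype.card ι * C * (ω z - ω x) := by
      refine hk.trans (mul_le_mul_of_nonneg_left ?_ (by positivity))
      have := hT x z
      rwa [abs_of_nonneg (sub_nonneg.2 (hωm hxz'.le))] at this
    have hki : k = i := by
      by_contra hki
      have h3 := hsep z k i hki
      have h4 : |φ k z - φ i z| ≤ |φ k z - f x| + |f z - f x| := by
        rw [hi0, abs_sub_comm (f z)]; exact abs_sub_le _ _ _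
      linarith
    rw [hki, hi0] at hk2
    rw [Real.norm_eq_abs]
    have : 0 ≤ ε * (z - x) := mul_nonneg hε.le (sub_nonneg.2 hxz'.le)
    linarith
  rcases le_total s t with hst | hst
  · rw [abs_of_nonneg (sub_nonneg.2 (hωm hst))]; exact key s t hst
  · rw [abs_of_nonpos (sub_nonpos.2 (hωm hst)), abs_sub_comm, neg_sub]; exact key t s hst

theorem abs_inv_sub_inv_le {d x y : ℝ} (hd : 0 < d) (hx : d ≤ |x|) (hy : d ≤ |y|) :
    |x⁻¹ - y⁻¹| ≤ d⁻¹ * d⁻¹ * |x - y| := by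
  have hx0 : x ≠ 0 := abs_pos.1 (hd.trans_le hx)
  have hy0 : y ≠ 0 := abs_pos.1 (hd.trans_le hy)
  rw [inv_sub_inv hx0 hy0, abs_div, abs_mul, abs_sub_comm, div_eq_mul_inv, mul_comm, mul_inv]
  gcongr

/-- The spectral projections of a separated matrix family form a `SpectralFamily` whose constant
depends only on the size of the matrices, the bound `K` and the gap `d`. -/
theorem exists_spectralFamily (m : ℕ) {d K : ℝ} (hd : 0 < d) (hK : 0 ≤ K) :
    ∃ C : ℝ, 0 ≤ C ∧ ∀ (X : ℝ → Matrix (Fin m) (Fin m) ℂ) (φ : Fin m → ℝ → ℝ) (ω : ℝ → ℝ),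
      Continuous ω → Monotone ω → (∀ t, ‖matOp (X t)‖ ≤ K) →
      (∀ s t, ‖matOp (X t) - matOp (X s)‖ ≤ |ω t - ω s|) →
      (∀ t, ∀ τ : ℂ, (τ • (1 : Matrix (Fin m) (Fin m) ℂ) - X t).det = ∏ j, (τ - (φ j t : ℂ))) →
      (∀ j, Continuous (φ j)) → (∀ t j k, j ≠ k → d ≤ |φ j t - φ k t|) →
      ∃ P, SpectralFamily (fun t => matOp (X t)) φ P ω C ∧
        ∀ f : ℝ → ℝ, Continuous f → (∀ t, ∃ x, x ≠ 0 ∧ matOp (X t) x = (f t : ℂ) • x) →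
          ∀ s t, |f t - f s| ≤ C * |ω t - ω s| := by
  set b : ℝ := max 1 (d⁻¹ * (2 * K)) with hb
  have hb1 : 1 ≤ b := le_max_left _ _
  have hbm : 1 ≤ b ^ m := one_le_pow₀ hb1
  set L : ℝ := m * b ^ m with hL
  have hL0 : 0 ≤ L := by positivity
  set δ : ℝ := d⁻¹ * (1 + L) + d⁻¹ * d⁻¹ * (2 * L) * (2 * K) with hδ
  have hδ0 : 0 ≤ δ := by positivity
  set C : ℝ := b ^ m + L + m * b ^ m * δ with hC
  have hLC : L ≤ C := by have : 0 ≤ m * b ^ m * δ := by positivity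
                         linarith
  refine ⟨C, by positivity, ?_⟩
  intro X φ ω hω hωm hXK hXω hroots hφ hsep
  have hinj : ∀ t, Function.Injective (fun k => φ k t) := by
    intro t j k hjk
    by_contra hne
    have := hsep t j k hne
    simp only at hjk
    rw [hjk, sub_self, abs_zero] at this
    linarith
  have hroot : ∀ j t, |φ j t| ≤ K := fun j t => (abs_root_le (hroots t) j).trans (hXK t)
  have hshift : ∀ k t, ‖matOp (X t) - (φ k t : ℂ) • (1 : _ →L[ℂ] _)‖ ≤ 2 * K := by
    intro k t
    refine (norm_sub_le _ _).trans ?_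
    rw [norm_smul, Complex.norm_real, Real.norm_eq_abs, two_mul]
    exact add_le_add (hXK t) ((mul_le_of_le_one_right (abs_nonneg _)
      ContinuousLinearMap.norm_id_le).trans (hroot k t))
  have hfac : ∀ j k t, j ≠ k → ‖Polynomial.aeval (matOp (X t))
      (Lagrange.basisDivisor (φ j t : ℂ) (φ k t : ℂ))‖ ≤ b := by
    intro j k t hjk
    rw [aeval_basisDivisor, norm_smul, norm_inv, Complex.norm_real, Real.norm_eq_abs]
    refine (mul_le_mul ?_ (hshift k t) (norm_nonneg _) (by positivity)).trans (le_max_right _ _)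
    exact inv_anti₀ hd (hsep t j k hjk)
  have hcard : ∀ j : Fin m, (Finset.univ.erase j).card ≤ m := fun j =>
    (Finset.card_le_univ _).trans_eq (Fintype.card_fin m)
  set P : Fin m → ℝ → EuclideanSpace ℂ (Fin m) →L[ℂ] EuclideanSpace ℂ (Fin m) :=
    fun j t => lagrangeProj (matOp (X t)) (fun k => φ k t) j with hP
  have hPb : ∀ j t, ‖P j t‖ ≤ b ^ m := by
    intro j t
    refine (norm_aeval_prod_le hb1 _ fun k hk => ?_).trans (pow_le_pow_right₀ hb1 (hcard j))
    exact hfac j k t (Finset.ne_of_mem_erase hk).symm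
  have hsum : ∀ t, ∑ j, P j t = 1 := by
    intro t
    rcases Nat.eq_zero_or_pos m with h0 | h0
    · subst h0
      exact Subsingleton.elim _ _
    · have : Nonempty (Fin m) := ⟨⟨0, h0⟩⟩
      exact sum_lagrangeProj _ (hinj t)
  have hmul : ∀ j t, P j t * matOp (X t) = (φ j t : ℂ) • P j t := fun j t =>
    lagrangeProj_mul _ _ j (aeval_matOp_nodal (hroots t))
  have hfL : ∀ f : ℝ → ℝ, Continuous f → (∀ t, ∃ x, x ≠ 0 ∧ matOp (X t) x = (f t : ℂ) • x) →
      ∀ s t, |f t - f s| ≤ L * |ω t - ω s| := by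
    intro f hf hev s t
    have := abs_eigenvalue_sub_le hd hω hωm hXω hsum hmul hPb (by positivity) hsep hf hev s t
    rwa [Fintype.card_fin] at this
  have hφL : ∀ j s t, |φ j t - φ j s| ≤ L * |ω t - ω s| := fun j =>
    hfL (φ j) (hφ j) fun t => exists_eigenvector_matOp (hroots t) j
  refine ⟨P, ⟨hω, hωm, hφ, hsum, hmul, fun j t => (hPb j t).trans ?_, ?_⟩, fun f hf hev s t =>
    (hfL f hf hev s t).trans (mul_le_mul_of_nonneg_right hLC (abs_nonneg _))⟩
  · have : 0 ≤ L + m * b ^ m * δ := by positivity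
    linarith
  intro j s t
  set Δ := |ω t - ω s| with hΔ
  have hΔ0 : 0 ≤ Δ := abs_nonneg _
  have hfacd : ∀ k ∈ Finset.univ.erase j, ‖Polynomial.aeval (matOp (X t))
      (Lagrange.basisDivisor (φ j t : ℂ) (φ k t : ℂ)) - Polynomial.aeval (matOp (X s))
      (Lagrange.basisDivisor (φ j s : ℂ) (φ k s : ℂ))‖ ≤ δ * Δ := by
    intro k hk
    have hjk : j ≠ k := (Finset.ne_of_mem_erase hk).symm
    rw [aeval_basisDivisor, aeval_basisDivisor]
    set Y := matOp (X t) - (φ k t : ℂ) • (1 : _ →L[ℂ] _) with hY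
    set Z := matOp (X s) - (φ k s : ℂ) • (1 : _ →L[ℂ] _) with hZ
    have hYZ : ‖Y - Z‖ ≤ (1 + L) * Δ := by
      have e : Y - Z = (matOp (X t) - matOp (X s))
          - ((φ k t - φ k s : ℝ) : ℂ) • (1 : _ →L[ℂ] _) := by
        rw [hY, hZ]; push_cast; module
      rw [e]
      refine (norm_sub_le _ _).trans ?_
      rw [norm_smul, Complex.norm_real, Real.norm_eq_abs, add_mul, one_mul]
      exact add_le_add (hXω s t) ((mul_le_of_le_one_right (abs_nonneg _)
        ContinuousLinearMap.norm_id_le).trans (hφL k s t))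
    set p : ℝ := φ j t - φ k t with hp
    set q : ℝ := φ j s - φ k s with hq
    have hpq : |p - q| ≤ 2 * L * Δ := by
      have e : p - q = (φ j t - φ j s) - (φ k t - φ k s) := by ring
      rw [e]
      have := abs_sub (φ j t - φ j s) (φ k t - φ k s)
      have := hφL j s t
      have := hφL k s t
      linarith
    have e : ((p : ℂ)⁻¹) • Y - ((q : ℂ)⁻¹) • Z
        = (p : ℂ)⁻¹ • (Y - Z) + ((p⁻¹ - q⁻¹ : ℝ) : ℂ) • Z := by
      push_cast; module
    rw [e]
    refine (norm_add_le _ _).trans ?_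
    rw [norm_smul, norm_smul, norm_inv, Complex.norm_real, Complex.norm_real, Real.norm_eq_abs,
      Real.norm_eq_abs]
    calc |p|⁻¹ * ‖Y - Z‖ + |p⁻¹ - q⁻¹| * ‖Z‖
        ≤ d⁻¹ * ((1 + L) * Δ) + (d⁻¹ * d⁻¹ * (2 * L * Δ)) * (2 * K) := by
          refine add_le_add (mul_le_mul (inv_anti₀ hd (hsep t j k hjk)) hYZ (norm_nonneg _)
            (by positivity)) (mul_le_mul ?_ (hshift k s) (norm_nonneg _) (by positivity))
          exact (abs_inv_sub_inv_le hd (hsep t j k hjk) (hsep s j k hjk)).trans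
            (mul_le_mul_of_nonneg_left hpq (by positivity))
      _ = δ * Δ := by rw [hδ]; ring
  have := norm_aeval_prod_sub_le hb1 (mul_nonneg hδ0 hΔ0) (Finset.univ.erase j)
    (fun k hk => hfac j k t (Finset.ne_of_mem_erase hk).symm)
    (fun k hk => hfac j k s (Finset.ne_of_mem_erase hk).symm) hfacd
  refine this.trans ?_
  calc ((Finset.univ.erase j).card : ℝ) * b ^ (Finset.univ.erase j).card * (δ * Δ)
      ≤ m * b ^ m * (δ * Δ) := by
        gcongr
        · exact_mod_cast hcard j
        · exact hcard j
    _ = (m * b ^ m * δ) * Δ := by ring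
    _ ≤ C * Δ := by
        refine mul_le_mul_of_nonneg_right ?_ hΔ0
        have : 0 ≤ b ^ m + L := by positivity
        linarith

/-! ### The symbol along a direction -/

theorem matOp_eq_sum {m : ℕ} (X : Matrix (Fin m) (Fin m) ℂ) :
    matOp X = ∑ i, ∑ j, X i j • matOp (Matrix.single i j (1 : ℂ)) := by
  conv_lhs => rw [Matrix.matrix_eq_sum_single X]
  simp only [map_sum]
  refine Finset.sum_congr rfl fun i _ => Finset.sum_congr rfl fun j _ => ?_
  rw [← map_smul, Matrix.smul_single, smul_eq_mul, mul_one]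

theorem exists_norm_matOp_le (m : ℕ) : ∃ c : ℝ, 0 ≤ c ∧
    ∀ X : Matrix (Fin m) (Fin m) ℂ, ‖matOp X‖ ≤ c * ∑ i, ∑ j, ‖X i j‖ := by
  set f : Fin m → Fin m → ℝ := fun i j => ‖matOp (Matrix.single i j (1 : ℂ))‖ with hf
  refine ⟨∑ i, ∑ j, f i j, Finset.sum_nonneg fun i _ => Finset.sum_nonneg fun j _ =>
    norm_nonneg _, fun X => ?_⟩
  have hle : ∀ i j, f i j ≤ ∑ i, ∑ j, f i j := fun i j =>
    (Finset.single_le_sum (f := fun j => f i j) (fun _ _ => norm_nonneg _)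
      (Finset.mem_univ j)).trans
    (Finset.single_le_sum (f := fun i => ∑ j, f i j)
      (fun _ _ => Finset.sum_nonneg fun _ _ => norm_nonneg _) (Finset.mem_univ i))
  rw [matOp_eq_sum X, Finset.mul_sum]
  refine (norm_sum_le _ _).trans (Finset.sum_le_sum fun i _ => ?_)
  rw [Finset.mul_sum]
  refine (norm_sum_le _ _).trans (Finset.sum_le_sum fun j _ => ?_)
  rw [norm_smul, mul_comm]
  exact mul_le_mul_of_nonneg_right (hle i j) (norm_nonneg _)

theorem exists_tendsto_intervalIntegral {g : ℝ → ℝ} (hg : Integrable g) {l : Filter ℝ}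
    (hl : l = atTop ∨ l = atBot) : ∃ c, Tendsto (fun t => ∫ s in (0 : ℝ)..t, g s) l (𝓝 c) := by
  rcases hl with rfl | rfl
  · exact ⟨_, intervalIntegral_tendsto_integral_Ioi 0 hg.integrableOn tendsto_id⟩
  · refine ⟨-∫ x in Set.Iic 0, g x, ?_⟩
    have := (intervalIntegral_tendsto_integral_Iic 0 hg.integrableOn
      (tendsto_id (α := ℝ) (x := atBot))).neg
    refine this.congr fun t => ?_
    rw [id, intervalIntegral.integral_symm, neg_neg]

theorem abs_intervalIntegral_sub_le {g : ℝ → ℝ} (hg : Integrable g) (hg0 : ∀ t, 0 ≤ g t)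
    (s t : ℝ) : |(∫ x in (0 : ℝ)..t, g x) - ∫ x in (0 : ℝ)..s, g x| ≤ ∫ x, g x := by
  rw [intervalIntegral.integral_interval_sub_left hg.intervalIntegrable hg.intervalIntegrable,
    ← Real.norm_eq_abs]
  refine intervalIntegral.norm_integral_le_integral_norm_uIoc.trans ?_
  simp only [Real.norm_eq_abs, abs_of_nonneg (hg0 _)]
  exact setIntegral_le_integral hg (Eventually.of_forall hg0)

namespace IsRegularlyHyperbolic

variable {n m : ℕ} {A : ℝ → Space n → Matrix (Fin m) (Fin m) ℂ} {φ : Fin m → ℝ → Space n → ℝ}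

theorem exists_entry_bound (hA : IsRegularlyHyperbolic A φ) :
    ∃ K : ℝ, 0 ≤ K ∧ ∀ (e : Space n) (i j : Fin m), ‖e‖ = 1 → ‖A 0 e i j‖ ≤ K := by
  have h : ∀ i j, ∃ K, ∀ e ∈ Metric.sphere (0 : Space n) 1, ‖A 0 e i j‖ ≤ K := fun i j =>
    (isCompact_sphere (0 : Space n) 1).exists_bound_of_continuousOn
      ((hA.continuousOn_freq 0 i j).mono fun e he => by
        rintro rfl
        simp at he)
  choose K hK using h
  refine ⟨∑ i, ∑ j, |K i j|, Finset.sum_nonneg fun i _ => Finset.sum_nonneg fun j _ =>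
    abs_nonneg _, fun e i j he => ?_⟩
  refine (hK i j e (by simpa using he)).trans ((le_abs_self _).trans ?_)
  exact (Finset.single_le_sum (f := fun j => |K i j|) (fun _ _ => abs_nonneg _)
      (Finset.mem_univ j)).trans
    (Finset.single_le_sum (f := fun i => ∑ j, |K i j|)
      (fun _ _ => Finset.sum_nonneg fun _ _ => abs_nonneg _) (Finset.mem_univ i))

/-- In each direction `e` the total variation of the symbol furnishes a clock for which its
spectral projections form a `SpectralFamily`; the constants are uniform in the direction. -/
theorem exists_spectralFamily (hA : IsRegularlyHyperbolic A φ) {l : Filter ℝ}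
    (hl : l = atTop ∨ l = atBot) :
    ∃ C K : ℝ, 0 ≤ C ∧ 0 ≤ K ∧ ∀ e : Space n, ‖e‖ = 1 → ∃ P ω,
      SpectralFamily (fun t => matOp (A t e)) (fun j t => φ j t e) P ω C ∧
      (∀ s t, |ω t - ω s| ≤ K) ∧ (∃ c, Tendsto ω l (𝓝 c)) ∧
      (∀ t, ‖matOp (A t e)‖ ≤ K) ∧
      (∀ s t, ‖matOp (A t e) - matOp (A s e)‖ ≤ |ω t - ω s|) ∧
      ∀ f : ℝ → ℝ, Continuous f → (∀ t, ∃ x, x ≠ 0 ∧ matOp (A t e) x = (f t : ℂ) • x) →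
        ∀ s t, |f t - f s| ≤ C * |ω t - ω s| := by
  obtain ⟨c, hc0, hc⟩ := exists_norm_matOp_le m
  obtain ⟨K₀, hK₀0, hK₀⟩ := hA.exists_entry_bound
  obtain ⟨K₁, hK₁⟩ := hA.uniform_deriv
  obtain ⟨d, hd, hsep⟩ := hA.separated
  set K₂ : ℝ := c * ∑ _i : Fin m, ∑ _j : Fin m, |K₁| with hK₂
  have hK₂0 : 0 ≤ K₂ := mul_nonneg hc0
    (Finset.sum_nonneg fun i _ => Finset.sum_nonneg fun j _ => abs_nonneg _)
  set K : ℝ := c * (∑ _i : Fin m, ∑ _j : Fin m, K₀) + K₂ with hK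
  have hK3 : 0 ≤ c * (∑ _i : Fin m, ∑ _j : Fin m, K₀) := mul_nonneg hc0
    (Finset.sum_nonneg fun i _ => Finset.sum_nonneg fun j _ => hK₀0)
  have hK0 : 0 ≤ K := by linarith
  obtain ⟨C, hC0, hC⟩ := _root_.exists_spectralFamily m hd hK0
  refine ⟨C, K, hC0, hK0, fun e he => ?_⟩
  have hne : e ≠ 0 := by rintro rfl; simp at he
  set g : ℝ → ℝ := fun t => c * ∑ i, ∑ j, ‖deriv (fun s => A s e i j) t‖ with hg
  have hgij : ∀ i j, Integrable (fun t => ‖deriv (fun s => A s e i j) t‖) := fun i j =>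
    (hA.integrable_deriv e i j hne).norm
  have hgi : Integrable g := (integrable_finsetSum _ fun i _ => integrable_finsetSum _ fun j _ =>
    hgij i j).const_mul c
  have hg0 : ∀ t, 0 ≤ g t := fun t => mul_nonneg hc0
    (Finset.sum_nonneg fun i _ => Finset.sum_nonneg fun j _ => norm_nonneg _)
  set ω : ℝ → ℝ := fun t => ∫ s in (0 : ℝ)..t, g s with hω
  have hωsub : ∀ s t, ω t - ω s = ∫ x in s..t, g x := fun s t =>
    intervalIntegral.integral_interval_sub_left hgi.intervalIntegrable hgi.intervalIntegrable
  have hωc : Continuous ω := intervalIntegral.continuous_primitive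
    (fun a b => hgi.intervalIntegrable) 0
  have hωm : Monotone ω := fun s t hst => by
    have : 0 ≤ ω t - ω s := by
      rw [hωsub]; exact intervalIntegral.integral_nonneg hst fun x _ => hg0 x
    linarith
  have hωK : ∀ s t, |ω t - ω s| ≤ K₂ := by
    intro s t
    refine (abs_intervalIntegral_sub_le hgi hg0 s t).trans ?_
    rw [hg, integral_const_mul, integral_finsetSum _ fun i _ => integrable_finsetSum _ fun j _ =>
      hgij i j]
    refine mul_le_mul_of_nonneg_left (Finset.sum_le_sum fun i _ => ?_) hc0
    rw [integral_finsetSum _ fun j _ => hgij i j]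
    exact Finset.sum_le_sum fun j _ => (hK₁ e i j he).trans (le_abs_self _)
  have hlip1 : ∀ s t, s ≤ t → ‖matOp (A t e) - matOp (A s e)‖ ≤ ω t - ω s := by
    intro s t hst
    rw [← map_sub]
    refine (hc _).trans ?_
    rw [hωsub, hg, intervalIntegral.integral_const_mul, intervalIntegral.integral_finsetSum
      fun i _ => IntegrableOn.intervalIntegrable
        (integrable_finsetSum _ fun j _ => hgij i j).integrableOn]
    refine mul_le_mul_of_nonneg_left (Finset.sum_le_sum fun i _ => ?_) hc0
    rw [intervalIntegral.integral_finsetSum fun j _ => (hgij i j).intervalIntegrable]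
    refine Finset.sum_le_sum fun j _ => ?_
    rw [Matrix.sub_apply, ← (hA.locallyLipschitz e i j hne).integral_deriv_eq_sub
      (hA.integrable_deriv e i j hne) s t]
    exact intervalIntegral.norm_integral_le_integral_norm hst
  have hlip : ∀ s t, ‖matOp (A t e) - matOp (A s e)‖ ≤ |ω t - ω s| := by
    intro s t
    rcases le_total s t with hst | hst
    · exact (hlip1 s t hst).trans (le_abs_self _)
    · rw [norm_sub_rev, abs_sub_comm]; exact (hlip1 t s hst).trans (le_abs_self _)
  have hMK : ∀ t, ‖matOp (A t e)‖ ≤ K := by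
    intro t
    have h1 : matOp (A t e) = matOp (A 0 e) + (matOp (A t e) - matOp (A 0 e)) := by abel
    rw [h1]
    refine (norm_add_le _ _).trans (add_le_add ((hc _).trans ?_) ((hlip 0 t).trans (hωK 0 t)))
    exact mul_le_mul_of_nonneg_left (Finset.sum_le_sum fun i _ => Finset.sum_le_sum fun j _ =>
      hK₀ e i j he) hc0
  obtain ⟨P, hP, hev⟩ := hC (fun t => A t e) (fun j t => φ j t e) ω hωc hωm hMK hlip
    (fun t τ => hA.roots t e hne τ) (fun j => hA.continuous_roots j e hne)
    (fun t j k hjk => hsep t e he j k hjk)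
  exact ⟨P, ω, hP, fun s t => (hωK s t).trans (by linarith), exists_tendsto_intervalIntegral hgi hl,
    hMK, hlip, hev⟩

end IsRegularlyHyperbolic

/-! ### The Peano–Baker series and propagators -/

section PeanoBaker

variable {X : Type*} [NormedAddCommGroup X] [NormedSpace ℝ X]

/-- The `k`-th term of the Peano–Baker series for the solution of `y' = L(t) y`, `y(0) = x₀`: the
`k`-fold iterated integral of `L` applied to `x₀`. -/
noncomputable def peanoTerm (L : ℝ → X →L[ℝ] X) (x₀ : X) : ℕ → ℝ → X
  | 0 => fun _ => x₀
  | k + 1 => fun t => ∫ s in (0 : ℝ)..t, L s (peanoTerm L x₀ k s)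

variable {L : ℝ → X →L[ℝ] X} {x₀ : X}

theorem continuous_peanoTerm (hL : Continuous L) (k : ℕ) : Continuous (peanoTerm L x₀ k) := by
  induction k with
  | zero => exact continuous_const
  | succ k ih =>
    exact intervalIntegral.continuous_primitive
      (fun a b => (hL.clm_apply ih).intervalIntegrable a b) 0

theorem hasDerivAt_peanoTerm_succ [CompleteSpace X] (hL : Continuous L) (k : ℕ) (t : ℝ) :
    HasDerivAt (peanoTerm L x₀ (k + 1)) (L t (peanoTerm L x₀ k t)) t := by
  have hc : Continuous (fun s => L s (peanoTerm L x₀ k s)) :=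
    hL.clm_apply (continuous_peanoTerm hL k)
  exact intervalIntegral.integral_hasDerivAt_right (hc.intervalIntegrable _ _)
    (hc.stronglyMeasurableAtFilter _ _) hc.continuousAt

theorem norm_peanoTerm_le (hL : Continuous L) {K : ℝ} (hK : ∀ t, ‖L t‖ ≤ K) (k : ℕ) (t : ℝ) :
    ‖peanoTerm L x₀ k t‖ ≤ ‖x₀‖ * ((K * |t|) ^ k / k.factorial) := by
  have hK0 : 0 ≤ K := (norm_nonneg _).trans (hK 0)
  induction k generalizing t with
  | zero => simp [peanoTerm]
  | succ k ih =>
    have hi : IntegrableOn (fun s : ℝ => K * (‖x₀‖ * (K ^ k / k.factorial) * |s| ^ k))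
        (Set.uIoc 0 t) := by
      have : Continuous (fun s : ℝ => K * (‖x₀‖ * (K ^ k / k.factorial) * |s| ^ k)) := by fun_prop
      exact (this.intervalIntegrable 0 t).def'
    have hi2 : IntegrableOn (fun s : ℝ => ‖L s (peanoTerm L x₀ k s)‖) (Set.uIoc 0 t) :=
      (((hL.clm_apply (continuous_peanoTerm hL k)).norm).intervalIntegrable 0 t).def'
    have h0 := integral_pow_abs_sub_uIoc (a := 0) (b := t) (n := k)
    simp only [sub_zero] at h0
    calc ‖peanoTerm L x₀ (k + 1) t‖ ≤ ∫ s in Set.uIoc 0 t, ‖L s (peanoTerm L x₀ k s)‖ :=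
          intervalIntegral.norm_integral_le_integral_norm_uIoc
      _ ≤ ∫ s in Set.uIoc 0 t, K * (‖x₀‖ * (K ^ k / k.factorial) * |s| ^ k) := by
          refine setIntegral_mono hi2 hi fun s => ?_
          refine ((L s).le_of_opNorm_le (hK s) _).trans (mul_le_mul_of_nonneg_left ?_ hK0)
          refine (ih s).trans_eq ?_
          rw [mul_pow]; ring
      _ = K * (‖x₀‖ * (K ^ k / k.factorial)) * (|t| ^ (k + 1) / (k + 1)) := by
          rw [← h0, ← integral_const_mul]
          exact integral_congr_ae (Eventually.of_forall fun s => by ring)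
      _ = _ := by
          rw [Nat.factorial_succ, mul_pow]
          push_cast
          field_simp
          ring

theorem hasDerivAt_tsum_peanoTerm [CompleteSpace X] (hL : Continuous L) {K : ℝ}
    (hK : ∀ t, ‖L t‖ ≤ K) (t : ℝ) :
    HasDerivAt (fun s => ∑' k, peanoTerm L x₀ k s) (L t (∑' k, peanoTerm L x₀ k t)) t := by
  have hK0 : 0 ≤ K := (norm_nonneg _).trans (hK 0)
  have hsum : ∀ s, Summable (fun k => peanoTerm L x₀ k s) := fun s =>
    Summable.of_norm_bounded ((Real.summable_pow_div_factorial _).mul_left _)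
      (fun k => norm_peanoTerm_le hL hK k s)
  set R := |t| + 1 with hR
  set b : ℕ → ℝ := fun k => K * (‖x₀‖ * ((K * R) ^ k / k.factorial)) with hb
  have hbs : Summable b := ((Real.summable_pow_div_factorial _).mul_left _).mul_left _
  have htm : t ∈ Set.Ioo (-R) R := abs_lt.1 (by rw [hR]; linarith)
  have h0m : (0 : ℝ) ∈ Set.Ioo (-R) R := abs_lt.1 (by rw [hR, abs_zero]; positivity)
  have h1 : HasDerivAt (fun s => ∑' k, peanoTerm L x₀ (k + 1) s)
      (∑' k, L t (peanoTerm L x₀ k t)) t := by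
    refine hasDerivAt_tsum_of_isPreconnected (g := fun k s => peanoTerm L x₀ (k + 1) s)
      (g' := fun k s => L s (peanoTerm L x₀ k s)) hbs isOpen_Ioo isPreconnected_Ioo
      (fun k s _ => hasDerivAt_peanoTerm_succ hL k s) (fun k s hs => ?_) h0m
      ((summable_nat_add_iff 1).2 (hsum 0)) htm
    refine ((L s).le_of_opNorm_le (hK s) _).trans (mul_le_mul_of_nonneg_left ?_ hK0)
    refine (norm_peanoTerm_le hL hK k s).trans (mul_le_mul_of_nonneg_left ?_ (norm_nonneg _))
    have := (abs_lt.2 hs).le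
    gcongr
  rw [(L t).map_tsum (hsum t)]
  have e : (fun s => ∑' k, peanoTerm L x₀ k s)
      = fun s => x₀ + ∑' k, peanoTerm L x₀ (k + 1) s := by
    funext s
    rw [(hsum s).tsum_eq_zero_add]
    rfl
  rw [e]
  exact h1.const_add x₀

theorem tsum_peanoTerm_zero : ∑' k, peanoTerm L x₀ k 0 = x₀ := by
  rw [tsum_eq_single 0]
  · rfl
  · intro k hk
    obtain ⟨k, rfl⟩ := Nat.exists_eq_succ_of_ne_zero hk
    exact intervalIntegral.integral_same

theorem stronglyMeasurable_intervalIntegral {Ω : Type*} [MeasurableSpace Ω] {f : ℝ → Ω → X}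
    (hc : ∀ ω, Continuous fun t => f t ω) (hm : ∀ t, StronglyMeasurable (f t)) (a b : ℝ) :
    StronglyMeasurable (fun ω => ∫ s in a..b, f s ω) := by
  have h := stronglyMeasurable_uncurry_of_continuous_of_stronglyMeasurable hc hm
  have h2 : StronglyMeasurable (fun p : Ω × ℝ => f p.2 p.1) :=
    h.comp_measurable measurable_swap
  simp only [intervalIntegral]
  exact (StronglyMeasurable.integral_prod_right' h2).sub
    (StronglyMeasurable.integral_prod_right' h2)

theorem stronglyMeasurable_tsum_peanoTerm [CompleteSpace X] {Ω : Type*} [MeasurableSpace Ω]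
    {L : ℝ → Ω → X →L[ℝ] X}
    (hc : ∀ ω, Continuous fun t => L t ω) (hm : ∀ t, StronglyMeasurable (L t))
    (hb : ∀ ω, ∃ K, ∀ t, ‖L t ω‖ ≤ K) (x₀ : X) (t : ℝ) :
    StronglyMeasurable (fun ω => ∑' k, peanoTerm (fun s => L s ω) x₀ k t) := by
  have h1 : ∀ k t, StronglyMeasurable (fun ω => peanoTerm (fun s => L s ω) x₀ k t) := by
    intro k
    induction k with
    | zero => exact fun t => stronglyMeasurable_const
    | succ k ih =>
      intro t
      refine stronglyMeasurable_intervalIntegral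
        (fun ω => (hc ω).clm_apply (continuous_peanoTerm (hc ω) k)) (fun s => ?_) 0 t
      exact isBoundedBilinearMap_apply.continuous.comp_stronglyMeasurable ((hm s).prodMk (ih s))
  refine stronglyMeasurable_of_tendsto atTop
    (f := fun N ω => ∑ k ∈ Finset.range N, peanoTerm (fun s => L s ω) x₀ k t)
    (fun N => Finset.stronglyMeasurable_fun_sum _ fun k _ => h1 k t) ?_
  rw [tendsto_pi_nhds]
  intro ω
  obtain ⟨K, hK⟩ := hb ω
  exact (Summable.of_norm_bounded ((Real.summable_pow_div_factorial _).mul_left _)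
      (fun k => norm_peanoTerm_le (hc ω) hK k t)).hasSum.tendsto_sum_nat

/-- Linear differential equations depending measurably on a parameter have global solutions
depending measurably on that parameter. -/
theorem exists_measurable_linear_solution [CompleteSpace X] {Ω : Type*} [MeasurableSpace Ω]
    {L : ℝ → Ω → X →L[ℝ] X}
    (hc : ∀ ω, Continuous fun t => L t ω) (hm : ∀ t, StronglyMeasurable (L t))
    (hb : ∀ ω, ∃ K, ∀ t, ‖L t ω‖ ≤ K) (x₀ : X) :
    ∃ y : ℝ → Ω → X, (∀ ω, y 0 ω = x₀) ∧
      (∀ t ω, HasDerivAt (fun s => y s ω) (L t ω (y t ω)) t) ∧ ∀ t, StronglyMeasurable (y t) := by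
  refine ⟨fun t ω => ∑' k, peanoTerm (fun s => L s ω) x₀ k t, fun ω => tsum_peanoTerm_zero,
    fun t ω => ?_, stronglyMeasurable_tsum_peanoTerm hc hm hb x₀⟩
  obtain ⟨K, hK⟩ := hb ω
  exact hasDerivAt_tsum_peanoTerm (hc ω) hK t

/-- The fundamental solution of `E' = a(t) E` and a left inverse of it, obtained from the adjoint
equation `F' = -F a(t)`. -/
theorem exists_measurable_fundamental_solution {Ω 𝔸 : Type*} [MeasurableSpace Ω] [NormedRing 𝔸]
    [NormedAlgebra ℝ 𝔸] [CompleteSpace 𝔸] {a : ℝ → Ω → 𝔸}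
    (hc : ∀ ξ, Continuous fun t => a t ξ) (hm : ∀ t, StronglyMeasurable (a t))
    (hb : ∀ ξ, ∃ K, ∀ t, ‖a t ξ‖ ≤ K) :
    ∃ E F : ℝ → Ω → 𝔸, (∀ ξ, E 0 ξ = 1) ∧
      (∀ t ξ, HasDerivAt (fun s => E s ξ) (a t ξ * E t ξ) t) ∧
      (∀ t, StronglyMeasurable (E t)) ∧ (∀ t, StronglyMeasurable (F t)) ∧
      ∀ t ξ, F t ξ * E t ξ = 1 := by
  set Φ : 𝔸 →L[ℝ] 𝔸 →L[ℝ] 𝔸 := ContinuousLinearMap.mul ℝ 𝔸 with hΦ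
  have hcl : Continuous fun T : 𝔸 => Φ T := Φ.continuous
  have hcr : Continuous fun T : 𝔸 => -Φ.flip T := Φ.flip.continuous.neg
  obtain ⟨E, hE0, hE1, hE2⟩ := exists_measurable_linear_solution
    (L := fun t ξ => Φ (a t ξ)) (fun ξ => hcl.comp (hc ξ))
    (fun t => hcl.comp_stronglyMeasurable (hm t)) (fun ξ => by
      obtain ⟨K, hK⟩ := hb ξ
      exact ⟨‖Φ‖ * K, fun t => Φ.le_opNorm_of_le (hK t)⟩) (1 : 𝔸)
  obtain ⟨F, hF0, hF1, hF2⟩ := exists_measurable_linear_solution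
    (L := fun t ξ => -Φ.flip (a t ξ)) (fun ξ => hcr.comp (hc ξ))
    (fun t => hcr.comp_stronglyMeasurable (hm t)) (fun ξ => by
      obtain ⟨K, hK⟩ := hb ξ
      refine ⟨‖Φ.flip‖ * K, fun t => ?_⟩
      rw [norm_neg]
      exact Φ.flip.le_opNorm_of_le (hK t)) (1 : 𝔸)
  have hE1' : ∀ t ξ, HasDerivAt (fun s => E s ξ) (a t ξ * E t ξ) t := hE1
  have hF1' : ∀ t ξ, HasDerivAt (fun s => F s ξ) (-(F t ξ * a t ξ)) t := hF1
  refine ⟨E, F, hE0, hE1', hE2, hF2, fun t ξ => ?_⟩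
  have hd : ∀ t, HasDerivAt (fun s => F s ξ * E s ξ) 0 t := by
    intro t
    refine ((hF1' t ξ).mul (hE1' t ξ)).congr_deriv ?_
    rw [neg_mul, mul_assoc, neg_add_cancel]
  have := is_const_of_deriv_eq_zero (fun s => (hd s).differentiableAt) (fun s => (hd s).deriv) t 0
  rw [this, hE0, hF0, one_mul]

end PeanoBaker

/-- `E t ξ` and `F t ξ` are the propagator of `u' = i G(t, ξ) u` started at time `0` and its
inverse. -/
structure IsPropagator {Ω H : Type*} [MeasurableSpace Ω] [NormedAddCommGroup H] [NormedSpace ℂ H]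
    (G E F : ℝ → Ω → H →L[ℂ] H) : Prop where
  zero : ∀ ξ, E 0 ξ = 1
  hasDerivAt : ∀ t ξ, HasDerivAt (fun s => E s ξ) (Complex.I • (G t ξ * E t ξ)) t
  stronglyMeasurable : ∀ t, StronglyMeasurable (E t)
  stronglyMeasurable_inv : ∀ t, StronglyMeasurable (F t)
  inv_mul : ∀ t ξ, F t ξ * E t ξ = 1
  mul_inv : ∀ t ξ, E t ξ * F t ξ = 1

theorem exists_isPropagator {Ω H : Type*} [MeasurableSpace Ω] [NormedAddCommGroup H]
    [NormedSpace ℂ H] [FiniteDimensional ℂ H] {G : ℝ → Ω → H →L[ℂ] H}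
    (hc : ∀ ξ, Continuous fun t => G t ξ) (hm : ∀ t, StronglyMeasurable (G t))
    (hb : ∀ ξ, ∃ K, ∀ t, ‖G t ξ‖ ≤ K) : ∃ E F, IsPropagator G E F := by
  have : CompleteSpace H := FiniteDimensional.complete ℂ H
  obtain ⟨E, F, hE0, hE1, hE2, hF2, hinv⟩ := exists_measurable_fundamental_solution
    (a := fun t ξ => Complex.I • G t ξ) (fun ξ => (hc ξ).const_smul Complex.I)
    (fun t => (hm t).const_smul Complex.I) (fun ξ => by
      obtain ⟨K, hK⟩ := hb ξ
      refine ⟨K, fun t => ?_⟩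
      rw [norm_smul, Complex.norm_I, one_mul]
      exact hK t)
  refine ⟨E, F, hE0, fun t ξ => ?_, hE2, hF2, hinv, fun t ξ => ?_⟩
  · rw [← smul_mul_assoc]
    exact hE1 t ξ
  -- in finite dimension a left inverse is a right inverse
  have h1 : (F t ξ : H →ₗ[ℂ] H) * (E t ξ : H →ₗ[ℂ] H) = 1 :=
    congrArg (fun T : H →L[ℂ] H => (T : H →ₗ[ℂ] H)) (hinv t ξ)
  have h2 := mul_eq_one_comm.1 h1
  ext x
  exact congrArg (fun T : H →ₗ[ℂ] H => T x) h2

/-! ### Operator-valued Fourier multipliers on `L²` -/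

section Multiplier

variable {α H : Type*} [MeasurableSpace α] {μ : Measure α} [NormedAddCommGroup H]
  [InnerProductSpace ℂ H]

theorem norm_sq_eq_integral (f : Lp H 2 μ) : ‖f‖ ^ 2 = ∫ x, ‖f x‖ ^ 2 ∂μ := by
  have h := inner_self_eq_norm_sq_to_K (𝕜 := ℂ) f
  rw [L2.inner_def] at h
  simp only [inner_self_eq_norm_sq_to_K] at h
  norm_cast at h
  rw [← h]

theorem memLp_clm_apply {q : α → H →L[ℂ] H} (hq : StronglyMeasurable q) {K : ℝ}
    (hK : ∀ ξ, ‖q ξ‖ ≤ K) (f : Lp H 2 μ) : MemLp (fun ξ => q ξ (f ξ)) 2 μ := by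
  refine (Lp.memLp f).of_le_mul (c := K) ?_ (Eventually.of_forall fun ξ => ?_)
  · exact isBoundedBilinearMap_apply.continuous.comp_aestronglyMeasurable
      (hq.aestronglyMeasurable.prodMk (Lp.aestronglyMeasurable f))
  · exact (q ξ).le_of_opNorm_le (hK ξ) _

/-- Multiplication by a bounded measurable operator-valued function, as an operator on `L²`. -/
noncomputable def multiplier (q : α → H →L[ℂ] H) (hq : StronglyMeasurable q) {K : ℝ}
    (hK : ∀ ξ, ‖q ξ‖ ≤ K) : Lp H 2 μ →L[ℂ] Lp H 2 μ :=
  LinearMap.mkContinuous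
    { toFun := fun f => (memLp_clm_apply hq hK f).toLp
      map_add' := fun f g => by
        rw [← MemLp.toLp_add]
        refine MemLp.toLp_congr _ _ ?_
        filter_upwards [Lp.coeFn_add f g] with ξ h
        rw [Pi.add_apply, h, Pi.add_apply, map_add]
      map_smul' := fun c f => by
        rw [RingHom.id_apply, ← MemLp.toLp_const_smul]
        refine MemLp.toLp_congr _ _ ?_
        filter_upwards [Lp.coeFn_smul c f] with ξ h
        rw [Pi.smul_apply, h, Pi.smul_apply, map_smul] }
    K fun f => by
      refine Lp.norm_le_mul_norm_of_ae_le_mul ?_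
      filter_upwards [(memLp_clm_apply hq hK f).coeFn_toLp] with ξ h
      exact h ▸ (q ξ).le_of_opNorm_le (hK ξ) _

theorem coeFn_multiplier {q : α → H →L[ℂ] H} (hq : StronglyMeasurable q) {K : ℝ}
    (hK : ∀ ξ, ‖q ξ‖ ≤ K) (f : Lp H 2 μ) :
    multiplier q hq hK f =ᵐ[μ] fun ξ => q ξ (f ξ) :=
  (memLp_clm_apply hq hK f).coeFn_toLp

theorem norm_multiplier_apply_le {q : α → H →L[ℂ] H} (hq : StronglyMeasurable q) {K : ℝ}
    (hK : ∀ ξ, ‖q ξ‖ ≤ K) (f : Lp H 2 μ) : ‖multiplier q hq hK f‖ ≤ K * ‖f‖ := by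
  refine Lp.norm_le_mul_norm_of_ae_le_mul ?_
  filter_upwards [coeFn_multiplier hq hK f] with ξ h
  exact h ▸ (q ξ).le_of_opNorm_le (hK ξ) _

theorem multiplier_comp {p q r : α → H →L[ℂ] H} (hp : StronglyMeasurable p)
    (hq : StronglyMeasurable q) (hr : StronglyMeasurable r) {K K' K'' : ℝ}
    (hK : ∀ ξ, ‖p ξ‖ ≤ K) (hK' : ∀ ξ, ‖q ξ‖ ≤ K') (hK'' : ∀ ξ, ‖r ξ‖ ≤ K'')
    (h : ∀ ξ, p ξ * q ξ = r ξ) (f : Lp H 2 μ) :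
    multiplier p hp hK (multiplier q hq hK' f) = multiplier r hr hK'' f := by
  refine Lp.ext ?_
  filter_upwards [coeFn_multiplier hp hK (multiplier q hq hK' f), coeFn_multiplier hq hK' f,
    coeFn_multiplier hr hK'' f] with ξ h1 h2 h3
  rw [h1, h2, h3, ← h ξ]
  rfl

theorem multiplier_eq_self {q : α → H →L[ℂ] H} (hq : StronglyMeasurable q) {K : ℝ}
    (hK : ∀ ξ, ‖q ξ‖ ≤ K) (h : ∀ ξ, q ξ = 1) (f : Lp H 2 μ) : multiplier q hq hK f = f := by
  refine Lp.ext ?_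
  filter_upwards [coeFn_multiplier hq hK f] with ξ h1
  rw [h1, h]
  rfl

theorem tendsto_norm_Lp_zero_of_dominated {ι : Type*} {l : Filter ι} [l.IsCountablyGenerated]
    {F : ι → Lp H 2 μ} {g : ι → α → H} {b : α → ℝ} (hF : ∀ t, F t =ᵐ[μ] g t)
    (hb : MemLp b 2 μ) (hg : ∀ t, ∀ᵐ x ∂μ, ‖g t x‖ ≤ b x)
    (hlim : ∀ᵐ x ∂μ, Tendsto (fun t => g t x) l (𝓝 0)) :
    Tendsto (fun t => ‖F t‖) l (𝓝 0) := by
  have h1 : Tendsto (fun t => ∫ x, ‖g t x‖ ^ 2 ∂μ) l (𝓝 (∫ _x, (0 : ℝ) ∂μ)) := by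
    refine tendsto_integral_filter_of_dominated_convergence (fun x => b x ^ 2)
      (Eventually.of_forall fun t => ?_) (Eventually.of_forall fun t => ?_) ?_ ?_
    · exact (((Lp.aestronglyMeasurable (F t)).congr (hF t)).norm.pow 2)
    · filter_upwards [hg t] with x hx
      rw [norm_pow, norm_norm]
      gcongr
    · exact (memLp_two_iff_integrable_sq hb.1).1 hb
    · filter_upwards [hlim] with x hx
      simpa using (hx.norm.pow 2)
  rw [integral_zero] at h1
  have h2 : Tendsto (fun t => ‖F t‖ ^ 2) l (𝓝 0) := by
    refine h1.congr fun t => ?_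
    rw [norm_sq_eq_integral]
    exact integral_congr_ae ((hF t).mono fun x hx => by simp only [hx])
  simpa using h2.sqrt

/-- Bounded pointwise convergence of symbols implies strong convergence of the multipliers. -/
theorem tendsto_multiplier_apply {ι : Type*} {l : Filter ι} [l.IsCountablyGenerated]
    {q : ι → α → H →L[ℂ] H} {q₀ : α → H →L[ℂ] H} (hq : ∀ t, StronglyMeasurable (q t))
    (hq₀ : StronglyMeasurable q₀) {K : ℝ} (hK : ∀ t ξ, ‖q t ξ‖ ≤ K) (hK₀ : ∀ ξ, ‖q₀ ξ‖ ≤ K)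
    (h : ∀ ξ, Tendsto (fun t => q t ξ) l (𝓝 (q₀ ξ))) (f : Lp H 2 μ) :
    Tendsto (fun t => multiplier (q t) (hq t) (hK t) f) l (𝓝 (multiplier q₀ hq₀ hK₀ f)) := by
  rw [tendsto_iff_norm_sub_tendsto_zero]
  refine tendsto_norm_Lp_zero_of_dominated (g := fun t ξ => q t ξ (f ξ) - q₀ ξ (f ξ))
    (b := fun ξ => 2 * K * ‖f ξ‖) (fun t => ?_) ((Lp.memLp f).norm.const_mul _) (fun t => ?_) ?_
  · filter_upwards [Lp.coeFn_sub (multiplier (q t) (hq t) (hK t) f) (multiplier q₀ hq₀ hK₀ f),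
      coeFn_multiplier (hq t) (hK t) f, coeFn_multiplier hq₀ hK₀ f] with ξ h1 h2 h3
    rw [h1, Pi.sub_apply, h2, h3]
  · refine Eventually.of_forall fun ξ => (norm_sub_le _ _).trans ?_
    have h1 := (q t ξ).le_of_opNorm_le (hK t ξ) (f ξ)
    have h2 := (q₀ ξ).le_of_opNorm_le (hK₀ ξ) (f ξ)
    linarith
  · refine Eventually.of_forall fun ξ => ?_
    have : Tendsto (fun t => q t ξ (f ξ)) l (𝓝 (q₀ ξ (f ξ))) :=
      ((ContinuousLinearMap.apply ℂ H (f ξ)).continuous.tendsto _).comp (h ξ)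
    simpa using this.sub_const (q₀ ξ (f ξ))

theorem continuous_multiplier_apply {q : ℝ → α → H →L[ℂ] H}
    (hq : ∀ t, StronglyMeasurable (q t)) {K : ℝ} (hK : ∀ t ξ, ‖q t ξ‖ ≤ K)
    (hc : ∀ ξ, Continuous fun t => q t ξ) {u : ℝ → Lp H 2 μ} (hu : Continuous u) :
    Continuous fun t => multiplier (q t) (hq t) (hK t) (u t) := by
  refine continuous_iff_continuousAt.2 fun s => ?_
  have h1 := tendsto_multiplier_apply hq (hq s) hK (hK s) (fun ξ => (hc ξ).tendsto s) (u s)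
  have h2 : Tendsto (fun t => multiplier (q t) (hq t) (hK t) (u t - u s)) (𝓝 s) (𝓝 0) := by
    refine squeeze_zero_norm (a := fun t => K * ‖u t - u s‖)
      (fun t => norm_multiplier_apply_le _ _ _) ?_
    have : Continuous fun t => K * ‖u t - u s‖ := by fun_prop
    simpa using this.tendsto s
  have h3 := h2.add h1
  rw [zero_add] at h3
  refine h3.congr fun t => ?_
  rw [map_sub, sub_add_cancel]

theorem inner_multiplier_eq {q : α → H →L[ℂ] H} (hq : StronglyMeasurable q) {K : ℝ}
    (hK : ∀ ξ, ‖q ξ‖ ≤ K) (g f : Lp H 2 μ) :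
    inner ℂ g (multiplier q hq hK f) = ∫ ξ, inner ℂ (g ξ) (q ξ (f ξ)) ∂μ := by
  rw [L2.inner_def]
  exact integral_congr_ae ((coeFn_multiplier hq hK f).mono fun ξ h => by simp only [h])

end Multiplier

/-! ### Weak solutions: existence and uniqueness -/

/-- A curve in a Hilbert space that is differentiable when tested against a dense family, with a
continuous candidate for the derivative, is differentiable. -/
theorem hasDerivAt_of_inner_dense {ℋ ι : Type*} [NormedAddCommGroup ℋ] [InnerProductSpace ℂ ℋ]
    [CompleteSpace ℋ] {g : ι → ℋ} (hg : DenseRange g) {z r : ℝ → ℋ} (hr : Continuous r)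
    (h : ∀ i t, HasDerivAt (fun s => inner ℂ (g i) (z s)) (inner ℂ (g i) (r t)) t) (t : ℝ) :
    HasDerivAt z (r t) t := by
  set w : ℝ → ℋ := fun t => ∫ s in (0 : ℝ)..t, r s with hw
  have hwd : ∀ t, HasDerivAt w (r t) t := fun t =>
    intervalIntegral.integral_hasDerivAt_right (hr.intervalIntegrable _ _)
      (hr.stronglyMeasurableAtFilter _ _) hr.continuousAt
  have key : ∀ t, z t - w t = z 0 - w 0 := by
    intro t
    refine ext_inner_left ℂ fun v => ?_
    refine DenseRange.induction_on (p := fun v => inner ℂ v (z t - w t) = inner ℂ v (z 0 - w 0))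
      hg v (isClosed_eq (by fun_prop) (by fun_prop)) fun i => ?_
    have hd : ∀ s, HasDerivAt (fun s => inner ℂ (g i) (z s - w s)) 0 s := by
      intro s
      simp only [inner_sub_right]
      have h2 : HasDerivAt (fun s => inner ℂ (g i) (w s)) (inner ℂ (g i) (r s)) s :=
        (((innerSL ℂ (g i)).restrictScalars ℝ).hasFDerivAt.comp_hasDerivAt s (hwd s))
      exact ((h i s).sub h2).congr_deriv (sub_self _)
    exact is_const_of_deriv_eq_zero (fun s => (hd s).differentiableAt) (fun s => (hd s).deriv) t 0
  have e : z = fun s => w s + (z 0 - w 0) := by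
    funext s
    rw [← key s]
    abel
  rw [e]
  exact (hwd t).add_const _

section Solution

variable {n m : ℕ}

/-- The weak form of `U' = i G(t, D) U` with the frequency variable normalised as in the Fourier
transform, for an operator-valued symbol `G`. -/
def IsMultiplierSolution
    (G : ℝ → Space n → EuclideanSpace ℂ (Fin m) →L[ℂ] EuclideanSpace ℂ (Fin m))
    (U : ℝ → L2Vec n m) : Prop :=
  Continuous U ∧
  ∀ (χ : 𝓢(Space n, EuclideanSpace ℂ (Fin m))) (t : ℝ),
    HasDerivAt (fun s : ℝ => ∫ x, inner ℂ (χ x) (U s x))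
      (∫ ξ, inner ℂ (𝓕 χ ξ) (Complex.I • G t ξ (𝓕 (U t) ξ))) t

/-- Plancherel's identity moves the pairing with a test function to the Fourier side. -/
theorem integral_inner_schwartz_eq (χ : 𝓢(Space n, EuclideanSpace ℂ (Fin m))) (f : L2Vec n m) :
    ∫ x, inner ℂ (χ x) (f x) = inner ℂ ((𝓕 χ).toLp 2 : L2Vec n m) (𝓕 f) := by
  rw [← SchwartzMap.toLp_fourier_eq, Lp.inner_fourier_eq, L2.inner_def]
  exact integral_congr_ae ((χ.coeFn_toLp 2 (volume : Measure (Space n))).mono fun x h => by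
    simp only [h])

theorem isMultiplierSolution_iff
    {G : ℝ → Space n → EuclideanSpace ℂ (Fin m) →L[ℂ] EuclideanSpace ℂ (Fin m)}
    {U : ℝ → L2Vec n m} : IsMultiplierSolution G U ↔ Continuous U ∧
      ∀ (χ : 𝓢(Space n, EuclideanSpace ℂ (Fin m))) (t : ℝ),
        HasDerivAt (fun s : ℝ => inner ℂ (χ.toLp 2 : L2Vec n m) (𝓕 (U s)))
          (∫ ξ, inner ℂ (χ ξ) (Complex.I • G t ξ (𝓕 (U t) ξ))) t := by
  simp only [IsMultiplierSolution, integral_inner_schwartz_eq]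
  refine and_congr_right fun _ => ⟨fun h χ t => ?_, fun h χ t => h (𝓕 χ) t⟩
  have := h (𝓕⁻ χ) t
  rwa [FourierTransform.fourier_fourierInv_eq] at this

theorem isSolution_iff_isMultiplierSolution (hn : 1 ≤ n)
    {A : ℝ → Space n → Matrix (Fin m) (Fin m) ℂ}
    {G : ℝ → Space n → EuclideanSpace ℂ (Fin m) →L[ℂ] EuclideanSpace ℂ (Fin m)}
    (hG : ∀ t ξ, ξ ≠ 0 → G t ξ = matOp (A t ((2 * Real.pi) • ξ))) {U : ℝ → L2Vec n m} :
    IsSolution A U ↔ IsMultiplierSolution G U := by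
  have : Nonempty (Fin n) := ⟨⟨0, hn⟩⟩
  have h0 : ∀ᵐ ξ : Space n, ξ ≠ 0 := compl_mem_ae_iff.2 (measure_singleton _)
  have e : ∀ (χ : 𝓢(Space n, EuclideanSpace ℂ (Fin m))) (t : ℝ),
      ∫ ξ, inner ℂ (𝓕 χ ξ)
        (Complex.I • Matrix.toEuclideanLin (A t ((2 * Real.pi) • ξ)) (𝓕 (U t) ξ))
      = ∫ ξ, inner ℂ (𝓕 χ ξ) (Complex.I • G t ξ (𝓕 (U t) ξ)) := fun χ t =>
    integral_congr_ae (h0.mono fun ξ h => by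
      simp only [hG t ξ h]
      rfl)
  simp only [IsSolution, IsMultiplierSolution, e]

variable {G E F : ℝ → Space n → EuclideanSpace ℂ (Fin m) →L[ℂ] EuclideanSpace ℂ (Fin m)}

theorem memLp_norm_mul_schwartz (χ : 𝓢(Space n, EuclideanSpace ℂ (Fin m))) :
    MemLp (fun ξ => ‖ξ‖ * ‖χ ξ‖) 2 (volume : Measure (Space n)) := by
  have hc : Continuous fun ξ : Space n => ‖ξ‖ * ‖χ ξ‖ := by
    have := χ.continuous; fun_prop
  rw [memLp_two_iff_integrable_sq hc.aestronglyMeasurable]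
  obtain ⟨K, -, hK⟩ := χ.decay 0 0
  have h1 := (SchwartzMap.integrable_pow_mul (volume : Measure (Space n)) χ 2).mul_bdd (c := K)
    (g := fun ξ => ‖χ ξ‖) χ.continuous.norm.aestronglyMeasurable
    (Eventually.of_forall fun ξ => by simpa using hK ξ)
  exact h1.congr (Eventually.of_forall fun ξ => by simp only; ring)

/-- Existence: the propagator, acting as a Fourier multiplier, solves the Cauchy problem. -/
theorem isMultiplierSolution_propagator (hG : ∀ t, StronglyMeasurable (G t)) {C D : ℝ}
    (hGC : ∀ t ξ, ‖G t ξ‖ ≤ C * ‖ξ‖) (hE : IsPropagator G E F) (hED : ∀ t ξ, ‖E t ξ‖ ≤ D)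
    (f : L2Vec n m) :
    IsMultiplierSolution G
      (fun t => 𝓕⁻ (multiplier (E t) (hE.stronglyMeasurable t) (hED t) (𝓕 f))) := by
  rw [isMultiplierSolution_iff]
  constructor
  · refine (Lp.fourierTransformₗᵢ (Space n) (EuclideanSpace ℂ (Fin m))).symm.continuous.comp ?_
    exact continuous_multiplier_apply hE.stronglyMeasurable hED
      (fun ξ => continuous_iff_continuousAt.2 fun t => (hE.hasDerivAt t ξ).continuousAt)
      continuous_const
  intro χ t
  simp only [FourierTransform.fourier_fourierInv_eq, inner_multiplier_eq]
  set g : L2Vec n m := 𝓕 f with hg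
  have hχ := χ.coeFn_toLp 2 (volume : Measure (Space n))
  have e1 : ∀ s, ∫ ξ, inner ℂ ((χ.toLp 2 : L2Vec n m) ξ) (E s ξ (g ξ))
      = ∫ ξ, inner ℂ (χ ξ) (E s ξ (g ξ)) := fun s =>
    integral_congr_ae (hχ.mono fun ξ h => by simp only [h])
  have e2 : ∫ ξ, inner ℂ (χ ξ) (Complex.I • G t ξ
        (multiplier (E t) (hE.stronglyMeasurable t) (hED t) g ξ))
      = ∫ ξ, inner ℂ (χ ξ) (Complex.I • G t ξ (E t ξ (g ξ))) :=
    integral_congr_ae ((coeFn_multiplier (hE.stronglyMeasurable t) (hED t) g).mono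
      fun ξ h => by simp only [h])
  simp only [e1, e2]
  have hgm := Lp.aestronglyMeasurable g
  have happ : ∀ {q : Space n → EuclideanSpace ℂ (Fin m) →L[ℂ] EuclideanSpace ℂ (Fin m)},
      StronglyMeasurable q → ∀ {v : Space n → EuclideanSpace ℂ (Fin m)},
      AEStronglyMeasurable v volume → AEStronglyMeasurable (fun ξ => q ξ (v ξ)) volume :=
    fun hq _ hv => isBoundedBilinearMap_apply.continuous.comp_aestronglyMeasurable
      (hq.aestronglyMeasurable.prodMk hv)
  have hmeas : ∀ s, AEStronglyMeasurable (fun ξ => inner ℂ (χ ξ) (E s ξ (g ξ))) volume := fun s =>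
    χ.continuous.aestronglyMeasurable.inner (happ (hE.stronglyMeasurable s) hgm)
  have hEg : ∀ s ξ, ‖E s ξ (g ξ)‖ ≤ D * ‖g ξ‖ := fun s ξ => (E s ξ).le_of_opNorm_le (hED s ξ) _
  refine (hasDerivAt_integral_of_dominated_loc_of_deriv_le (𝕜 := ℝ) (s := Set.univ)
    (bound := fun ξ => C * D * ((‖ξ‖ * ‖χ ξ‖) * ‖g ξ‖)) (F' := fun s ξ =>
      inner ℂ (χ ξ) (Complex.I • G s ξ (E s ξ (g ξ)))) univ_mem
    (Eventually.of_forall hmeas) ?_ ?_ ?_ ?_ ?_).2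
  · have h1 : Integrable (fun ξ => D * (‖χ ξ‖ * ‖g ξ‖)) :=
      ((χ.memLp 2 (volume : Measure (Space n))).norm.integrable_mul (Lp.memLp g).norm).const_mul D
    refine h1.mono' (hmeas t) (Eventually.of_forall fun ξ => ?_)
    refine (norm_inner_le_norm _ _).trans ?_
    calc _ ≤ ‖χ ξ‖ * (D * ‖g ξ‖) := mul_le_mul_of_nonneg_left (hEg t ξ) (norm_nonneg _)
      _ = _ := by ring
  · exact χ.continuous.aestronglyMeasurable.inner
      ((happ (hG t) (happ (hE.stronglyMeasurable t) hgm)).const_smul Complex.I)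
  · refine Eventually.of_forall fun ξ s _ => (norm_inner_le_norm _ _).trans ?_
    rw [norm_smul, Complex.norm_I, one_mul]
    calc _ ≤ ‖χ ξ‖ * ((C * ‖ξ‖) * (D * ‖g ξ‖)) := mul_le_mul_of_nonneg_left
          (((G s ξ).le_of_opNorm_le (hGC s ξ) _).trans (mul_le_mul_of_nonneg_left (hEg s ξ)
            ((norm_nonneg _).trans (hGC s ξ)))) (norm_nonneg _)
      _ = _ := by ring
  · exact ((memLp_norm_mul_schwartz χ).integrable_mul (Lp.memLp g).norm).const_mul _
  · refine Eventually.of_forall fun ξ s _ => ?_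
    have h1 : HasDerivAt (fun s => E s ξ (g ξ)) (Complex.I • G s ξ (E s ξ (g ξ))) s :=
      (((ContinuousLinearMap.apply ℂ (EuclideanSpace ℂ (Fin m)) (g ξ)).restrictScalars
        ℝ).hasFDerivAt.comp_hasDerivAt s (hE.hasDerivAt s ξ))
    have h2 := (((innerSL ℂ (χ ξ)).restrictScalars ℝ).hasFDerivAt.comp_hasDerivAt s h1)
    exact h2

/-- A smooth compactly supported frequency cutoff of a weak solution is strongly differentiable:
it equals the primitive of the cut-off right-hand side, by testing against Schwartz functions. -/
theorem IsMultiplierSolution.hasDerivAt_cutoff (hGc : ∀ ξ, Continuous fun t => G t ξ)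
    {U : ℝ → L2Vec n m} (hU : IsMultiplierSolution G U) {η : Space n → ℝ}
    (hη : ContDiff ℝ (⊤ : ℕ∞) η) (hηc : HasCompactSupport η) {K K' : ℝ}
    (hm : StronglyMeasurable fun ξ => (η ξ : ℂ) • (1 : EuclideanSpace ℂ (Fin m) →L[ℂ]
      EuclideanSpace ℂ (Fin m)))
    (hb : ∀ ξ, ‖(η ξ : ℂ) • (1 : EuclideanSpace ℂ (Fin m) →L[ℂ] EuclideanSpace ℂ (Fin m))‖ ≤ K)
    (hm' : ∀ t, StronglyMeasurable fun ξ => (η ξ : ℂ) • Complex.I • G t ξ)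
    (hb' : ∀ t ξ, ‖(η ξ : ℂ) • Complex.I • G t ξ‖ ≤ K') (t : ℝ) :
    HasDerivAt (fun s => multiplier _ hm hb (𝓕 (U s)))
      (multiplier _ (hm' t) (hb' t) (𝓕 (U t))) t := by
  rw [isMultiplierSolution_iff] at hU
  obtain ⟨hUc, hU⟩ := hU
  have hFU : Continuous fun s => (𝓕 (U s) : L2Vec n m) :=
    (Lp.fourierTransformₗᵢ (Space n) (EuclideanSpace ℂ (Fin m))).continuous.comp hUc
  have hrc : Continuous fun s => multiplier _ (hm' s) (hb' s) (𝓕 (U s)) :=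
    continuous_multiplier_apply hm' hb'
      (fun ξ => ((hGc ξ).const_smul Complex.I).const_smul (η ξ : ℂ)) hFU
  have htg : Function.HasTemperateGrowth (fun ξ => (η ξ : ℂ)) := by
    refine HasCompactSupport.hasTemperateGrowth (hηc.comp_left (g := Complex.ofReal) (by simp)) ?_
    exact Complex.ofRealCLM.contDiff.comp hη
  refine hasDerivAt_of_inner_dense (g := fun χ : 𝓢(Space n, EuclideanSpace ℂ (Fin m)) =>
    (χ.toLp 2 : L2Vec n m)) (SchwartzMap.denseRange_toLpCLM (F := EuclideanSpace ℂ (Fin m)) (p := 2)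
      (μ := (volume : Measure (Space n))) ENNReal.ofNat_ne_top) hrc (fun χ t => ?_) t
  set χ' : 𝓢(Space n, EuclideanSpace ℂ (Fin m)) :=
    SchwartzMap.smulLeftCLM (EuclideanSpace ℂ (Fin m)) (fun ξ => (η ξ : ℂ)) χ with hχ'
  have hχ'a : ∀ ξ, χ' ξ = (η ξ : ℂ) • χ ξ := fun ξ => SchwartzMap.smulLeftCLM_apply_apply htg χ ξ
  have hχ := χ.coeFn_toLp 2 (volume : Measure (Space n))
  have hχ1 := χ'.coeFn_toLp 2 (volume : Measure (Space n))
  have e1 : ∀ s, inner ℂ (χ.toLp 2 : L2Vec n m) (multiplier _ hm hb (𝓕 (U s)))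
      = inner ℂ (χ'.toLp 2 : L2Vec n m) (𝓕 (U s)) := by
    intro s
    rw [inner_multiplier_eq, L2.inner_def]
    refine integral_congr_ae ?_
    filter_upwards [hχ, hχ1] with ξ h1 h2
    rw [h1, h2, hχ'a, inner_smul_left, Complex.conj_ofReal]
    exact inner_smul_right _ _ _
  have e2 : ∀ s, inner ℂ (χ.toLp 2 : L2Vec n m) (multiplier _ (hm' s) (hb' s) (𝓕 (U s)))
      = ∫ ξ, inner ℂ (χ' ξ) (Complex.I • G s ξ (𝓕 (U s) ξ)) := by
    intro s
    rw [inner_multiplier_eq]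
    refine integral_congr_ae ?_
    filter_upwards [hχ] with ξ h1
    rw [h1, hχ'a, inner_smul_left, Complex.conj_ofReal]
    exact inner_smul_right _ _ _
  simp only [e1, e2]
  exact hU χ' t

/-- Uniqueness: after a frequency cutoff the symbol is bounded, and Lipschitz uniqueness for
ordinary differential equations in `L²` applies. -/
theorem IsMultiplierSolution.ext (hG : ∀ t, StronglyMeasurable (G t))
    (hGc : ∀ ξ, Continuous fun t => G t ξ) {C : ℝ}
    (hGC : ∀ t ξ, ‖G t ξ‖ ≤ C * ‖ξ‖) {U V : ℝ → L2Vec n m} (hU : IsMultiplierSolution G U)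
    (hV : IsMultiplierSolution G V) (h0 : U 0 = V 0) : U = V := by
  have hcut : ∀ (N : ℕ) (t : ℝ), ∀ᵐ ξ, ‖ξ‖ < N + 1 →
      (𝓕 (U t) : L2Vec n m) ξ = (𝓕 (V t) : L2Vec n m) ξ := by
    intro N t
    set R : ℝ := N + 2 with hR
    have hR0 : (0 : ℝ) ≤ R := by positivity
    let b : ContDiffBump (0 : Space n) :=
      { rIn := N + 1, rOut := R, rIn_pos := by positivity, rIn_lt_rOut := by rw [hR]; linarith }
    have hη0 : ∀ ξ, 0 ≤ b ξ := fun ξ => b.nonneg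
    have hη1 : ∀ ξ, b ξ ≤ 1 := fun ξ => b.le_one
    have hηs : ∀ ξ, R ≤ ‖ξ‖ → b ξ = 0 := fun ξ h => b.zero_of_le_dist (by simpa using h)
    have hsm : StronglyMeasurable fun ξ => (b ξ : ℂ) :=
      (Complex.continuous_ofReal.comp b.continuous).stronglyMeasurable
    have hm : StronglyMeasurable
        fun ξ => (b ξ : ℂ) • (1 : EuclideanSpace ℂ (Fin m) →L[ℂ] EuclideanSpace ℂ (Fin m)) :=
      hsm.smul_const _
    have hb : ∀ ξ,
        ‖(b ξ : ℂ) • (1 : EuclideanSpace ℂ (Fin m) →L[ℂ] EuclideanSpace ℂ (Fin m))‖ ≤ 1 := by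
      intro ξ
      rw [norm_smul, Complex.norm_real, Real.norm_eq_abs, abs_of_nonneg (hη0 ξ)]
      exact mul_le_one₀ (hη1 ξ) (norm_nonneg _) ContinuousLinearMap.norm_id_le
    have hm' : ∀ t, StronglyMeasurable fun ξ => (b ξ : ℂ) • Complex.I • G t ξ := fun t =>
      hsm.smul ((hG t).const_smul Complex.I)
    have hCR : ∀ t ξ, ‖ξ‖ < R → ‖G t ξ‖ ≤ |C| * R := fun t ξ h =>
      (hGC t ξ).trans (mul_le_mul (le_abs_self C) h.le (norm_nonneg _) (abs_nonneg _))
    have hb' : ∀ t ξ, ‖(b ξ : ℂ) • Complex.I • G t ξ‖ ≤ |C| * R := by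
      intro t ξ
      rw [norm_smul, norm_smul, Complex.norm_I, one_mul, Complex.norm_real, Real.norm_eq_abs,
        abs_of_nonneg (hη0 ξ)]
      rcases lt_or_ge ‖ξ‖ R with h | h
      · exact (mul_le_of_le_one_left (norm_nonneg _) (hη1 ξ)).trans (hCR t ξ h)
      · rw [hηs ξ h, zero_mul]; positivity
    -- the bounded symbol of the equation satisfied by the cut-off solutions
    set q : ℝ → Space n → EuclideanSpace ℂ (Fin m) →L[ℂ] EuclideanSpace ℂ (Fin m) :=
      fun t => (Metric.ball (0 : Space n) R).indicator fun ξ => Complex.I • G t ξ with hq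
    have hqm : ∀ t, StronglyMeasurable (q t) := fun t =>
      ((hG t).const_smul Complex.I).indicator measurableSet_ball
    have hqb : ∀ t ξ, ‖q t ξ‖ ≤ |C| * R := by
      intro t ξ
      by_cases h : ξ ∈ Metric.ball (0 : Space n) R
      · simp only [hq, Set.indicator_of_mem h, norm_smul, Complex.norm_I, one_mul]
        exact hCR t ξ (by simpa using h)
      · simp only [hq, Set.indicator_of_notMem h, norm_zero]
        positivity
    have hode : ∀ {W : ℝ → L2Vec n m}, IsMultiplierSolution G W → ∀ t,
        HasDerivAt (fun s => multiplier _ hm hb (𝓕 (W s)))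
          (multiplier (q t) (hqm t) (hqb t) (multiplier _ hm hb (𝓕 (W t)))) t := by
      intro W hW t
      have h1 := hW.hasDerivAt_cutoff hGc b.contDiff b.hasCompactSupport hm hb hm' hb' t
      refine h1.congr_deriv (multiplier_comp _ _ _ _ _ _ (fun ξ => ?_) _).symm
      by_cases h : ξ ∈ Metric.ball (0 : Space n) R
      · simp only [hq, Set.indicator_of_mem h]
        rw [mul_smul_comm, mul_one]
      · simp only [hq, Set.indicator_of_notMem h]
        rw [hηs ξ (by simpa using h), zero_mul, Complex.ofReal_zero]
        exact (zero_smul ℂ _).symm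
    have huniq := ODE_solution_unique_univ (K := Real.toNNReal (|C| * R)) (s := fun _ => Set.univ)
      (t₀ := 0) (v := fun t => multiplier (μ := volume) (q t) (hqm t) (hqb t))
      (f := fun s => multiplier _ hm hb (𝓕 (U s))) (g := fun s => multiplier _ hm hb (𝓕 (V s)))
      (fun t => LipschitzOnWith.of_dist_le_mul fun x _ y _ => by
        rw [dist_eq_norm, dist_eq_norm, ← map_sub, Real.coe_toNNReal _ (by positivity)]
        exact norm_multiplier_apply_le _ _ _)
      (fun t => ⟨hode hU t, trivial⟩) (fun t => ⟨hode hV t, trivial⟩) (by simp only [h0])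
    have h1 := coeFn_multiplier hm hb (𝓕 (U t))
    have h2 := coeFn_multiplier hm hb (𝓕 (V t))
    rw [congrFun huniq t] at h1
    filter_upwards [h1, h2] with ξ h3 h4 hξ
    have hone : b ξ = 1 := b.one_of_mem_closedBall (by
      rw [mem_closedBall_zero_iff]
      exact hξ.le)
    rw [h3] at h4
    simpa [hone] using h4
  funext t
  refine (Lp.fourierTransformₗᵢ (Space n) (EuclideanSpace ℂ (Fin m))).injective (Lp.ext ?_)
  filter_upwards [ae_all_iff.2 fun N => hcut N t] with ξ h
  obtain ⟨N, hN⟩ := exists_nat_gt ‖ξ‖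
  exact h N (by linarith)

end Solution

/-! ### Riemann–Lebesgue lemma and dilations -/

/-- If the oscillating functions `exp(i s x_k) c(s)` with `|x_k| → ∞` converge almost everywhere,
then `c = 0`: their limit `v` has `‖v‖ = ‖c‖`, while the Riemann–Lebesgue lemma makes them converge
weakly to zero. -/
theorem ae_eq_zero_of_tendsto_exp_smul {H : Type*} [NormedAddCommGroup H] [InnerProductSpace ℂ H]
    {S : Set ℝ} (hS : MeasurableSet S) (hfin : volume S ≠ ⊤) {c v : ℝ → H}
    (hc : AEStronglyMeasurable c (volume.restrict S)) {x : ℕ → ℝ}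
    (hx : Tendsto (fun k => |x k|) atTop atTop)
    (h : ∀ᵐ s : ℝ ∂(volume.restrict S),
      Tendsto (fun k => Complex.exp (Complex.I * s * x k) • c s) atTop (𝓝 (v s))) :
    ∀ᵐ s ∂(volume.restrict S), c s = 0 := by
  have : IsFiniteMeasure (volume.restrict S) := ⟨by
    rw [Measure.restrict_apply_univ]; exact hfin.lt_top⟩
  have hexp : ∀ s y : ℝ, ‖Complex.exp (Complex.I * s * y)‖ = 1 := by
    intro s y
    have : Complex.I * s * y = ((s * y : ℝ) : ℂ) * Complex.I := by push_cast; ring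
    rw [this, Complex.norm_exp_ofReal_mul_I]
  have hexpm : ∀ y : ℝ, Continuous fun s : ℝ => Complex.exp (Complex.I * s * y) := by
    intro y; fun_prop
  have hv : AEStronglyMeasurable v (volume.restrict S) :=
    aestronglyMeasurable_of_tendsto_ae atTop
      (fun k => (hexpm (x k)).aestronglyMeasurable.smul hc) h
  have hnorm : ∀ᵐ s ∂(volume.restrict S), ‖v s‖ = ‖c s‖ := by
    filter_upwards [h] with s hs
    have h1 := hs.norm
    simp only [norm_smul, hexp, one_mul] at h1
    exact tendsto_nhds_unique h1 tendsto_const_nhds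
  -- the weight makes `f` bounded without any integrability assumption on `c`
  set f : ℝ → ℂ := fun s => ((1 + ‖c s‖ ^ 2 : ℝ) : ℂ)⁻¹ * inner ℂ (v s) (c s) with hf
  have hfm : AEStronglyMeasurable f (volume.restrict S) := by
    refine AEStronglyMeasurable.mul ?_ (hv.inner hc)
    have hcm := (hc.norm.pow 2).aemeasurable
    exact (Complex.measurable_ofReal.comp_aemeasurable
      (hcm.const_add 1)).inv.aestronglyMeasurable
  have hfb : ∀ᵐ s ∂(volume.restrict S), ‖f s‖ ≤ 1 := by
    filter_upwards [hnorm] with s hs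
    have h0 : (0 : ℝ) < 1 + ‖c s‖ ^ 2 := by positivity
    rw [hf, norm_mul, norm_inv, Complex.norm_real, Real.norm_eq_abs, abs_of_pos h0,
      inv_mul_le_one₀ h0]
    refine (norm_inner_le_norm _ _).trans ?_
    rw [hs]
    nlinarith
  have hRL : Tendsto (fun k => ∫ s in S, Complex.exp (Complex.I * s * x k) * f s) atTop (𝓝 0) := by
    have hw : Tendsto (fun k => -(x k) / (2 * Real.pi)) atTop (cocompact ℝ) := by
      rw [← Metric.cobounded_eq_cocompact, ← tendsto_norm_atTop_iff_cobounded]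
      simp only [norm_div, norm_neg, Real.norm_eq_abs]
      exact hx.atTop_div_const (by positivity)
    refine ((Real.tendsto_integral_exp_smul_cocompact (S.indicator f)).comp hw).congr fun k => ?_
    rw [Function.comp, ← integral_indicator hS]
    refine integral_congr_ae (Eventually.of_forall fun s => ?_)
    by_cases hs : s ∈ S
    · simp only [Set.indicator_of_mem hs, Circle.smul_def, Real.fourierChar_apply, smul_eq_mul]
      congr 2
      have : (Real.pi : ℂ) ≠ 0 := by exact_mod_cast Real.pi_ne_zero
      push_cast
      field_simp
    · simp only [Set.indicator_of_notMem hs, smul_zero]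
  have hDCT : Tendsto (fun k => ∫ s in S, Complex.exp (Complex.I * s * x k) * f s) atTop
      (𝓝 (∫ s in S, (((1 + ‖c s‖ ^ 2)⁻¹ * ‖v s‖ ^ 2 : ℝ) : ℂ))) := by
    refine tendsto_integral_of_dominated_convergence (fun _ => 1)
      (fun k => (hexpm (x k)).aestronglyMeasurable.mul hfm) (integrable_const _)
      (fun k => hfb.mono fun s hs => by rwa [norm_mul, hexp, one_mul]) ?_
    filter_upwards [h] with s hs
    have h1 : Tendsto (fun k => inner ℂ (v s) (Complex.exp (Complex.I * s * x k) • c s)) atTop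
        (𝓝 (inner ℂ (v s) (v s))) := tendsto_const_nhds.inner hs
    have h2 := h1.const_mul (((1 + ‖c s‖ ^ 2 : ℝ) : ℂ)⁻¹)
    rw [inner_self_eq_norm_sq_to_K] at h2
    push_cast at h2 ⊢
    refine h2.congr fun k => ?_
    rw [inner_smul_right, hf]
    push_cast
    ring
  have hzero := tendsto_nhds_unique hDCT hRL
  rw [show (∫ s in S, (((1 + ‖c s‖ ^ 2)⁻¹ * ‖v s‖ ^ 2 : ℝ) : ℂ))
    = ((∫ s in S, (1 + ‖c s‖ ^ 2)⁻¹ * ‖v s‖ ^ 2 : ℝ) : ℂ) from integral_ofReal,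
    Complex.ofReal_eq_zero] at hzero
  have hint : Integrable (fun s => (1 + ‖c s‖ ^ 2)⁻¹ * ‖v s‖ ^ 2) (volume.restrict S) := by
    refine (integrable_const (1 : ℝ)).mono' ?_ ?_
    · exact ((hc.norm.pow 2).aemeasurable.const_add 1).inv.aestronglyMeasurable.mul (hv.norm.pow 2)
    · filter_upwards [hnorm] with s hs
      have h0 : (0 : ℝ) < 1 + ‖c s‖ ^ 2 := by positivity
      rw [Real.norm_eq_abs, abs_of_nonneg (by positivity), hs, inv_mul_le_one₀ h0]
      linarith
  have := (integral_eq_zero_iff_of_nonneg (fun s => by positivity) hint).1 hzero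
  filter_upwards [this, hnorm] with s hs1 hs2
  have h0 : (1 + ‖c s‖ ^ 2)⁻¹ ≠ 0 := by positivity
  rw [Pi.zero_apply, mul_eq_zero, or_iff_right h0, hs2] at hs1
  simpa using hs1

section Dilation

variable {V : Type*} [NormedAddCommGroup V] [NormedSpace ℝ V] [FiniteDimensional ℝ V]
  [MeasurableSpace V] [BorelSpace V] {μ : Measure V} [μ.IsAddHaarMeasure]

theorem ae_ae_dilation_comm {T : Set V} (hT : MeasurableSet T) :
    (∀ᵐ ξ ∂μ, ∀ᵐ s ∂(volume.restrict (Set.Ioi (0 : ℝ))), s • ξ ∉ T) ↔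
      ∀ᵐ s ∂(volume.restrict (Set.Ioi (0 : ℝ))), ∀ᵐ ξ ∂μ, s • ξ ∉ T := by
  refine Measure.ae_ae_comm (p := fun ξ s => s • ξ ∉ T) ?_
  have : Measurable fun z : V × ℝ => z.2 • z.1 := (by fun_prop : Continuous _).measurable
  exact (this hT).compl

/-- Almost every ray meets a set of full measure in almost all of its points. -/
theorem ae_ae_dilation {p : V → Prop} (h : ∀ᵐ ξ ∂μ, p ξ) :
    ∀ᵐ ξ ∂μ, ∀ᵐ s ∂(volume.restrict (Set.Ioi (0 : ℝ))), p (s • ξ) := by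
  have h0 : μ (toMeasurable μ {ξ | ¬p ξ}) = 0 := by rw [measure_toMeasurable]; exact h
  have h1 : ∀ᵐ s ∂(volume.restrict (Set.Ioi (0 : ℝ))), ∀ᵐ ξ ∂μ,
      s • ξ ∉ toMeasurable μ {ξ | ¬p ξ} := by
    filter_upwards [ae_restrict_mem measurableSet_Ioi] with s hs
    refine compl_mem_ae_iff.2 ?_
    change μ ((fun ξ => s • ξ) ⁻¹' _) = 0
    rw [Measure.addHaar_preimage_smul μ (ne_of_gt hs), h0, mul_zero]
  filter_upwards [(ae_ae_dilation_comm (measurableSet_toMeasurable _ _)).2 h1] with ξ hξ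
  filter_upwards [hξ] with s hs
  by_contra hp
  exact hs (subset_toMeasurable _ _ hp)

/-- A set that almost every ray meets in a null set is itself null. -/
theorem ae_of_ae_ae_dilation {T : Set V} (hT : MeasurableSet T)
    (h : ∀ᵐ ξ ∂μ, ∀ᵐ s ∂(volume.restrict (Set.Ioi (0 : ℝ))), s • ξ ∉ T) : ∀ᵐ ξ ∂μ, ξ ∉ T := by
  have h1 := (ae_ae_dilation_comm hT).1 h
  have hne : (ae (volume.restrict (Set.Ioi (0 : ℝ)))).NeBot := by
    rw [ae_neBot, Ne, Measure.restrict_eq_zero]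
    simp
  obtain ⟨s, hs, hs0⟩ := (h1.and (ae_restrict_mem measurableSet_Ioi)).exists
  have hs2 : μ ((fun ξ => s • ξ) ⁻¹' T) = 0 := compl_mem_ae_iff.1 hs
  rw [Measure.addHaar_preimage_smul μ (ne_of_gt hs0), mul_eq_zero] at hs2
  refine compl_mem_ae_iff.2 (hs2.resolve_left ?_)
  have hs0' : (0 : ℝ) < s := hs0
  simp only [ENNReal.ofReal_eq_zero, not_le]
  positivity

end Dilation

/-! ### Asymptotics of the mode amplitudes -/

namespace SpectralFamily

variable {ι E : Type*} [Fintype ι] [NormedAddCommGroup E] [NormedSpace ℂ E]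
  {M : ℝ → E →L[ℂ] E} {φ : ι → ℝ → ℝ} {P : ι → ℝ → E →L[ℂ] E} {ω : ℝ → ℝ} {C : ℝ}

/-- The limits of the projections form a spectral family for the limiting operator. They do not
move, so the clock of the limiting family is `0`. -/
theorem exists_limit [CompleteSpace E] (h : SpectralFamily M φ P ω C) {l : Filter ℝ}
    [l.NeBot] {c : ℝ} (hω : Tendsto ω l (𝓝 c)) {M' : E →L[ℂ] E} (hM : Tendsto M l (𝓝 M'))
    {φ' : ι → ℝ} (hφ : ∀ j, Tendsto (φ j) l (𝓝 (φ' j))) :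
    ∃ P' : ι → E →L[ℂ] E, (∀ j, Tendsto (P j) l (𝓝 (P' j))) ∧
      SpectralFamily (fun _ => M') (fun j _ => φ' j) (fun j _ => P' j) (fun _ => 0) C := by
  choose P' hP' using fun j => exists_tendsto_of_norm_sub_le hω (h.norm_proj_sub_le j)
  refine ⟨P', hP', continuous_const, monotone_const, fun _ => continuous_const, fun _ => ?_,
    fun j _ => ?_, fun j _ => ?_, fun j _ _ => by simp⟩
  · have h1 : Tendsto (fun t => ∑ j, P j t) l (𝓝 (∑ j, P' j)) :=
      tendsto_finsetSum _ fun j _ => hP' j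
    simp only [h.sum_proj] at h1
    exact tendsto_nhds_unique h1 tendsto_const_nhds
  · have h1 := (hP' j).mul hM
    simp only [h.proj_mul] at h1
    refine tendsto_nhds_unique h1 (Tendsto.smul ?_ (hP' j))
    exact (Complex.continuous_ofReal.tendsto _).comp (hφ j)
  · exact le_of_tendsto (hP' j).norm (Eventually.of_forall fun t => h.norm_proj_le j t)

/-- Under a constant coefficient equation each mode has constant amplitude. -/
theorem proj_apply_of_const {M' : E →L[ℂ] E} {φ' : ι → ℝ} {P' : ι → E →L[ℂ] E}
    (h : SpectralFamily (fun _ => M') (fun j _ => φ' j) (fun j _ => P' j) (fun _ => 0) C)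
    (hC : 0 ≤ C) {r : ℝ} {v : ℝ → E}
    (hv : ∀ t, HasDerivAt v ((Complex.I * r) • M' (v t)) t) (j : ι) (t : ℝ) :
    Complex.exp (-(Complex.I * r * ((t * φ' j : ℝ) : ℂ))) • P' j (v t) = P' j (v 0) := by
  have hD : ∀ t, ‖v t‖
      ≤ Real.exp (2 * (Fintype.card ι * C) * 0) * (Fintype.card ι * C) * ‖v 0‖ := fun t =>
    h.norm_solution_le hC (by simp) hv 0 t
  have h1 := h.norm_mode_sub_le hC hD hv j 0 t
  rw [sub_self, abs_zero, mul_zero] at h1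
  have h2 := sub_eq_zero.1 (norm_le_zero_iff.1 h1)
  simpa [mode] using h2

variable {l : Filter ℝ} {P' : ι → E →L[ℂ] E} {φ' : ι → ℝ} {r : ℝ} {u : ℝ → E}

theorem phase_split (h : SpectralFamily M φ P ω C) (j : ι) (t : ℝ) :
    ∫ s in (0 : ℝ)..t, φ j s = (∫ s in (0 : ℝ)..t, (φ j s - φ' j)) + t * φ' j := by
  rw [intervalIntegral.integral_sub ((h.continuous_phase j).intervalIntegrable _ _)
    intervalIntegrable_const]
  simp

/-- Removing from a solution the oscillation of the limiting frequency leaves the mode amplitude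
times the factor `exp(i r ψ_j)`, up to an error that vanishes in the limit. -/
theorem tendsto_proj_sub_mode (h : SpectralFamily M φ P ω C) {D : ℝ} (hD : ∀ t, ‖u t‖ ≤ D)
    (j : ι) (hP : Tendsto (P j) l (𝓝 (P' j))) :
    Tendsto (fun t => Complex.exp (-(Complex.I * r * ((t * φ' j : ℝ) : ℂ))) • P' j (u t)
      - Complex.exp (Complex.I * r * ((∫ s in (0 : ℝ)..t, (φ j s - φ' j) : ℝ) : ℂ))
        • mode φ P r u j t) l (𝓝 0) := by
  have e : ∀ t, Complex.exp (-(Complex.I * r * ((t * φ' j : ℝ) : ℂ))) • P' j (u t)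
      - Complex.exp (Complex.I * r * ((∫ s in (0 : ℝ)..t, (φ j s - φ' j) : ℝ) : ℂ))
        • mode φ P r u j t
      = Complex.exp (-(Complex.I * r * ((t * φ' j : ℝ) : ℂ))) • (P' j - P j t) (u t) := by
    intro t
    rw [mode, h.phase_split (φ' := φ') j t, smul_smul, ← Complex.exp_add, sub_apply, smul_sub]
    congr 3
    generalize (∫ s in (0 : ℝ)..t, (φ j s - φ' j)) = a
    push_cast
    ring
  simp only [e]
  refine squeeze_zero_norm (a := fun t => ‖P' j - P j t‖ * D) (fun t => ?_) ?_
  · rw [norm_smul, norm_phase, one_mul]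
    exact ((P' j - P j t).le_opNorm _).trans (mul_le_mul_of_nonneg_left (hD t) (norm_nonneg _))
  · have := ((hP.const_sub (P' j)).norm).mul_const D
    simpa using this

/-- If the phase differences converge, then so does the solution carried back by the limiting
flow. -/
theorem exists_tendsto_wave [CompleteSpace E] (h : SpectralFamily M φ P ω C) (hC : 0 ≤ C)
    {M' : E →L[ℂ] E}
    (h' : SpectralFamily (fun _ => M') (fun j _ => φ' j) (fun j _ => P' j) (fun _ => 0) C)
    [l.NeBot] {c : ℝ} (hω : Tendsto ω l (𝓝 c)) (hP : ∀ j, Tendsto (P j) l (𝓝 (P' j)))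
    (hψ : ∀ j, ∃ c, Tendsto (fun t => ∫ s in (0 : ℝ)..t, (φ j s - φ' j)) l (𝓝 c))
    (hu : ∀ t, HasDerivAt u ((Complex.I * r) • M t (u t)) t) {D : ℝ} (hD : ∀ t, ‖u t‖ ≤ D)
    {q : ℝ → E} (hq : ∀ t, ∃ v : ℝ → E, v 0 = q t ∧ v t = u t ∧
      ∀ s, HasDerivAt v ((Complex.I * r) • M' (v s)) s) :
    ∃ y, Tendsto q l (𝓝 y) := by
  have hj : ∀ j, ∃ y, Tendsto (fun t => P' j (q t)) l (𝓝 y) := by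
    intro j
    obtain ⟨a, ha⟩ := hψ j
    obtain ⟨y, hy⟩ := h.exists_tendsto_mode hC hD hu j hω
    have h1 : Tendsto (fun t => Complex.exp (Complex.I * r *
        ((∫ s in (0 : ℝ)..t, (φ j s - φ' j) : ℝ) : ℂ))) l
        (𝓝 (Complex.exp (Complex.I * r * (a : ℂ)))) := by
      have : Continuous fun x : ℝ => Complex.exp (Complex.I * r * (x : ℂ)) := by fun_prop
      exact (this.tendsto a).comp ha
    have h2 := (h.tendsto_proj_sub_mode (r := r) (φ' := φ') hD j (hP j)).add (h1.smul hy)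
    refine ⟨_, h2.congr fun t => ?_⟩
    obtain ⟨v, hv0, hvt, hv⟩ := hq t
    rw [sub_add_cancel, ← hvt, h'.proj_apply_of_const hC hv j t, hv0]
  choose y hy using hj
  refine ⟨∑ j, y j, (tendsto_finsetSum _ fun j _ => hy j).congr fun t => ?_⟩
  have := congrArg (fun T : E →L[ℂ] E => T (q t)) (h'.sum_proj 0)
  simpa using this

/-- Along a sequence of times at which the solution approaches a solution of the limiting equation,
the mode amplitudes rotated by the phase differences converge. -/
theorem tendsto_exp_smul_of_asymptotic (h : SpectralFamily M φ P ω C) (hC : 0 ≤ C) {M' : E →L[ℂ] E}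
    (h' : SpectralFamily (fun _ => M') (fun j _ => φ' j) (fun j _ => P' j) (fun _ => 0) C)
    (hP : ∀ j, Tendsto (P j) l (𝓝 (P' j))) {D : ℝ} (hD : ∀ t, ‖u t‖ ≤ D) {v : ℝ → E}
    (hv : ∀ t, HasDerivAt v ((Complex.I * r) • M' (v t)) t) {t : ℕ → ℝ} (ht : Tendsto t atTop l)
    (huv : Tendsto (fun k => u (t k) - v (t k)) atTop (𝓝 0)) (j : ι) {y : E}
    (hy : Tendsto (mode φ P r u j) l (𝓝 y)) :
    Tendsto (fun k => Complex.exp (Complex.I * r *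
      ((∫ s in (0 : ℝ)..(t k), (φ j s - φ' j) : ℝ) : ℂ)) • y) atTop (𝓝 (P' j (v 0))) := by
  have h1 := (h.tendsto_proj_sub_mode (r := r) (φ' := φ') hD j (hP j)).comp ht
  have hn : ∀ x : ℝ, ‖Complex.exp (Complex.I * r * (x : ℂ))‖ = 1 := by
    intro x
    have : Complex.I * r * (x : ℂ) = ((r * x : ℝ) : ℂ) * Complex.I := by push_cast; ring
    rw [this, Complex.norm_exp_ofReal_mul_I]
  have h2 : Tendsto (fun k => Complex.exp (-(Complex.I * r * ((t k * φ' j : ℝ) : ℂ)))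
      • P' j (u (t k) - v (t k))) atTop (𝓝 0) := by
    refine squeeze_zero_norm (a := fun k => ‖P' j (u (t k) - v (t k))‖) (fun k => ?_) ?_
    · rw [norm_smul, norm_phase, one_mul]
    · simpa using (((P' j).continuous.tendsto _).comp huv).norm
  have h3 : Tendsto (fun k => Complex.exp (Complex.I * r *
      ((∫ s in (0 : ℝ)..(t k), (φ j s - φ' j) : ℝ) : ℂ)) • (y - mode φ P r u j (t k))) atTop
      (𝓝 0) := by
    refine squeeze_zero_norm (a := fun k => ‖y - mode φ P r u j (t k)‖) (fun k => ?_) ?_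
    · rw [norm_smul, hn, one_mul]
    · simpa using ((hy.comp ht).const_sub y).norm
  have h4 := ((h2.sub h1).add h3).add_const (P' j (v 0))
  simp only [sub_self, zero_add, add_zero] at h4
  refine h4.congr fun k => ?_
  rw [← h'.proj_apply_of_const hC hv j (t k), Function.comp, map_sub, smul_sub, smul_sub]
  abel

/-- A solution all of whose modes die out vanishes. -/
theorem eq_zero_of_tendsto_mode_zero (h : SpectralFamily M φ P ω C) [l.NeBot] {K : ℝ}
    (hC : 0 ≤ C) (hK : ∀ s t, |ω t - ω s| ≤ K)
    (hu : ∀ t, HasDerivAt u ((Complex.I * r) • M t (u t)) t)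
    (hy : ∀ j, Tendsto (mode φ P r u j) l (𝓝 0)) : u 0 = 0 := by
  have h1 : Tendsto (fun t => ∑ j, ‖mode φ P r u j t‖) l (𝓝 0) := by
    simpa using tendsto_finsetSum Finset.univ fun j _ => (hy j).norm
  simp only [norm_mode] at h1
  have h2 := h1.const_mul (Real.exp (2 * (Fintype.card ι * C) * K) * (Fintype.card ι * C))
  rw [mul_zero] at h2
  refine norm_le_zero_iff.1 (ge_of_tendsto h2 (Eventually.of_forall fun t => ?_))
  exact (h.norm_solution_le hC hK hu t 0).trans
    (mul_le_mul_of_nonneg_left (h.norm_le_sum t _) (by positivity))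

end SpectralFamily

theorem IsPropagator.hasDerivAt_apply {Ω H : Type*} [MeasurableSpace Ω] [NormedAddCommGroup H]
    [NormedSpace ℂ H] {G E F : ℝ → Ω → H →L[ℂ] H} (h : IsPropagator G E F) {r : ℝ} {ξ : Ω}
    {M : ℝ → H →L[ℂ] H} (hG : ∀ t, G t ξ = (r : ℂ) • M t) (x : H) (t : ℝ) :
    HasDerivAt (fun s => E s ξ x) ((Complex.I * r) • M t (E t ξ x)) t := by
  have h1 : HasDerivAt (fun s => E s ξ x) (Complex.I • G t ξ (E t ξ x)) t :=
    (((ContinuousLinearMap.apply ℂ H x).restrictScalars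
      ℝ).hasFDerivAt.comp_hasDerivAt t (h.hasDerivAt t ξ))
  refine h1.congr_deriv ?_
  rw [hG t, mul_smul]
  rfl

/-- A symbol whose value at each `ξ` is a multiple `r` of a family of operators with a
`SpectralFamily`, the constants being independent of `ξ`. -/
structure UniformSymbol {n m : ℕ}
    (G : ℝ → Space n → EuclideanSpace ℂ (Fin m) →L[ℂ] EuclideanSpace ℂ (Fin m))
    (C K : ℝ) : Prop where
  nonneg : 0 ≤ C
  stronglyMeasurable : ∀ t, StronglyMeasurable (G t)
  continuous : ∀ ξ, Continuous fun t => G t ξ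
  norm_le : ∀ t ξ, ‖G t ξ‖ ≤ K * ‖ξ‖
  family : ∀ ξ, ∃ (r : ℝ) (M : ℝ → EuclideanSpace ℂ (Fin m) →L[ℂ] EuclideanSpace ℂ (Fin m))
    (φ : Fin m → ℝ → ℝ) (P : _) (ω : ℝ → ℝ),
    SpectralFamily M φ P ω C ∧ (∀ s t, |ω t - ω s| ≤ K) ∧ ∀ t, G t ξ = (r : ℂ) • M t

namespace UniformSymbol

variable {n m : ℕ} {G : ℝ → Space n → EuclideanSpace ℂ (Fin m) →L[ℂ] EuclideanSpace ℂ (Fin m)}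
  {C K : ℝ}

/-- The inverse propagator is bounded as well, since the energy estimate holds in both directions
of time. -/
theorem exists_bounded_propagator (h : UniformSymbol G C K) :
    ∃ E F, IsPropagator G E F ∧ ∃ D : ℝ, 0 ≤ D ∧
      (∀ t ξ, ‖E t ξ‖ ≤ D) ∧ ∀ t ξ, ‖F t ξ‖ ≤ D := by
  obtain ⟨E, F, hEF⟩ := exists_isPropagator h.continuous h.stronglyMeasurable
    fun ξ => ⟨_, fun t => h.norm_le t ξ⟩
  have hC := h.nonneg
  have key : ∀ s t ξ x, ‖E t ξ x‖ ≤ Real.exp (2 * (m * C) * K) * (m * C) * ‖E s ξ x‖ := by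
    intro s t ξ x
    obtain ⟨r, M, φ, P, ω, hf, hK, hG⟩ := h.family ξ
    have := hf.norm_solution_le (r := r) (u := fun t => E t ξ x) h.nonneg hK
      (hEF.hasDerivAt_apply hG x) s t
    simpa using this
  refine ⟨E, F, hEF, Real.exp (2 * (m * C) * K) * (m * C), by positivity, fun t ξ => ?_,
    fun t ξ => ?_⟩
  · refine ContinuousLinearMap.opNorm_le_bound _ (by positivity) fun x => ?_
    simpa [hEF.zero] using key 0 t ξ x
  · refine ContinuousLinearMap.opNorm_le_bound _ (by positivity) fun x => ?_
    have h1 : E t ξ (F t ξ x) = x :=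
      congrArg (fun T : _ →L[ℂ] EuclideanSpace ℂ (Fin m) => T x) (hEF.mul_inv t ξ)
    have h2 := key t 0 ξ (F t ξ x)
    rw [h1] at h2
    simpa [hEF.zero] using h2

end UniformSymbol

/-! ### Polar coordinates and limits of symbol and roots -/

/-- On a finite-dimensional space pointwise convergence of operators is norm convergence. -/
theorem exists_tendsto_clm_of_pointwise {H : Type*} [NormedAddCommGroup H]
    [NormedSpace ℂ H] [FiniteDimensional ℂ H] {l : Filter ℝ} {T : ℝ → H →L[ℂ] H}
    (h : ∀ x, ∃ y, Tendsto (fun t => T t x) l (𝓝 y)) : ∃ T₀, Tendsto T l (𝓝 T₀) := by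
  choose y hy using h
  let b := Module.finBasis ℂ H
  have e : ∀ S : H →L[ℂ] H,
      ∑ i, (LinearMap.toContinuousLinearMap (b.coord i)).smulRight (S (b i)) = S := by
    intro S
    refine ContinuousLinearMap.coe_injective (b.ext fun k => ?_)
    simp [Finsupp.single_apply]
  refine ⟨∑ i, (LinearMap.toContinuousLinearMap (b.coord i)).smulRight (y (b i)), ?_⟩
  refine Tendsto.congr (fun t => e (T t)) (tendsto_finsetSum _ fun i _ => ?_)
  exact ((ContinuousLinearMap.smulRightL ℂ H H
    (LinearMap.toContinuousLinearMap (b.coord i))).continuous.tendsto _).comp (hy (b i))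

/-- The limit of boundedly invertible operators on a finite-dimensional space is invertible, and
the inverses converge. -/
theorem exists_tendsto_inverse {H : Type*} [NormedAddCommGroup H] [NormedSpace ℂ H]
    [FiniteDimensional ℂ H] {l : Filter ℝ} [l.NeBot] {Q R : ℝ → H →L[ℂ] H} {W : H →L[ℂ] H} {D : ℝ}
    (hQ : Tendsto Q l (𝓝 W)) (hQR : ∀ t, Q t * R t = 1) (hRQ : ∀ t, R t * Q t = 1)
    (hR : ∀ t, ‖R t‖ ≤ D) : ∃ V, Tendsto R l (𝓝 V) ∧ W * V = 1 ∧ V * W = 1 := by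
  have : CompleteSpace H := FiniteDimensional.complete ℂ H
  have hlow : ∀ x, ‖x‖ ≤ D * ‖W x‖ := by
    intro x
    have h1 : Tendsto (fun t => D * ‖Q t x‖) l (𝓝 (D * ‖W x‖)) :=
      ((((ContinuousLinearMap.apply ℂ H x).continuous.tendsto _).comp hQ).norm).const_mul D
    refine ge_of_tendsto h1 (Eventually.of_forall fun t => ?_)
    have h2 : R t (Q t x) = x := congrArg (fun T : H →L[ℂ] H => T x) (hRQ t)
    calc ‖x‖ = ‖R t (Q t x)‖ := by rw [h2]
      _ ≤ _ := (R t).le_of_opNorm_le (hR t) _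
  have hinj : Function.Injective W := by
    rw [injective_iff_map_eq_zero]
    intro x hx
    have := hlow x
    rw [hx, norm_zero, mul_zero] at this
    exact norm_le_zero_iff.1 this
  have hunit : IsUnit W := by
    rw [ContinuousLinearMap.isUnit_iff_bijective]
    exact ⟨hinj, (LinearMap.injective_iff_surjective (f := (W : H →ₗ[ℂ] H))).1 hinj⟩
  obtain ⟨w, rfl⟩ := hunit
  refine ⟨(↑w⁻¹ : H →L[ℂ] H), ?_, w.mul_inv, w.inv_mul⟩
  have h1 := (NormedRing.inverse_continuousAt w).tendsto.comp hQ
  rw [Ring.inverse_unit] at h1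
  refine h1.congr fun t => ?_
  exact Ring.inverse_unit ⟨Q t, R t, hQR t, hRQ t⟩

section Direction

variable {n m : ℕ}

/-- The unit vector in the direction of `ξ`, with the conventional value `e₀` at `ξ = 0`. -/
noncomputable def direction (e₀ ξ : Space n) : Space n :=
  open Classical in if ξ = 0 then e₀ else ‖ξ‖⁻¹ • ξ

theorem direction_of_ne (e₀ : Space n) {ξ : Space n} (h : ξ ≠ 0) :
    direction e₀ ξ = ‖ξ‖⁻¹ • ξ := by simp [direction, h]

theorem norm_direction {e₀ : Space n} (h : ‖e₀‖ = 1) (ξ : Space n) : ‖direction e₀ ξ‖ = 1 := by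
  by_cases hξ : ξ = 0
  · simp [direction, hξ, h]
  · rw [direction_of_ne e₀ hξ, norm_smul, norm_inv, norm_norm,
      inv_mul_cancel₀ (norm_ne_zero_iff.2 hξ)]

theorem direction_ne_zero {e₀ : Space n} (h : ‖e₀‖ = 1) (ξ : Space n) : direction e₀ ξ ≠ 0 :=
  fun h0 => by simpa [h0] using norm_direction h ξ

theorem norm_smul_direction {e₀ : Space n} {ξ : Space n} (hξ : ξ ≠ 0) :
    ‖ξ‖ • direction e₀ ξ = ξ := by
  rw [direction_of_ne e₀ hξ, smul_smul, mul_inv_cancel₀ (norm_ne_zero_iff.2 hξ), one_smul]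

theorem direction_smul (e₀ : Space n) {s : ℝ} (hs : 0 < s) (ξ : Space n) :
    direction e₀ (s • ξ) = direction e₀ ξ := by
  by_cases hξ : ξ = 0
  · simp [hξ]
  · rw [direction_of_ne e₀ hξ, direction_of_ne e₀ (smul_ne_zero hs.ne' hξ), norm_smul,
      Real.norm_eq_abs, abs_of_pos hs, smul_smul, mul_inv, mul_assoc, mul_comm ‖ξ‖⁻¹, ← mul_assoc,
      inv_mul_cancel₀ hs.ne', one_mul]

theorem measurable_direction (e₀ : Space n) : Measurable (direction e₀) := by
  refine Measurable.ite (measurableSet_singleton 0) measurable_const ?_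
  exact measurable_norm.inv.smul measurable_id

theorem matOp_smul (c : ℂ) (X : Matrix (Fin m) (Fin m) ℂ) : matOp (c • X) = c • matOp X :=
  map_smul (Matrix.toEuclideanCLM (n := Fin m) (𝕜 := ℂ)) c X

theorem tendsto_matOp {ι : Type*} {l : Filter ι} {X : ι → Matrix (Fin m) (Fin m) ℂ}
    {Y : Matrix (Fin m) (Fin m) ℂ} (h : ∀ i j, Tendsto (fun t => X t i j) l (𝓝 (Y i j))) :
    Tendsto (fun t => matOp (X t)) l (𝓝 (matOp Y)) := by
  rw [matOp_eq_sum Y]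
  refine Tendsto.congr (fun t => (matOp_eq_sum (X t)).symm)
    (tendsto_finsetSum _ fun i _ => tendsto_finsetSum _ fun j _ => (h i j).smul_const _)

theorem stronglyMeasurable_matOp {Ω : Type*} [MeasurableSpace Ω]
    {X : Ω → Matrix (Fin m) (Fin m) ℂ} (h : ∀ i j, Measurable fun ω => X ω i j) :
    StronglyMeasurable fun ω => matOp (X ω) := by
  simp only [matOp_eq_sum (X _)]
  exact Finset.stronglyMeasurable_fun_sum _ fun i _ => Finset.stronglyMeasurable_fun_sum _
    fun j _ => (h i j).stronglyMeasurable.smul_const _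

/-- The symbol of `A(t, D_x)` with the frequency normalised as in `∫ e^{-2πi x·ξ} f(x) dx`,
extended by zero to `ξ = 0`. -/
noncomputable def polarSymbol (e₀ : Space n) (A : ℝ → Space n → Matrix (Fin m) (Fin m) ℂ) (t : ℝ)
    (ξ : Space n) : EuclideanSpace ℂ (Fin m) →L[ℂ] EuclideanSpace ℂ (Fin m) :=
  ((2 * Real.pi * ‖ξ‖ : ℝ) : ℂ) • matOp (A t (direction e₀ ξ))

theorem polarSymbol_eq {e₀ : Space n} (he₀ : ‖e₀‖ = 1)
    {A : ℝ → Space n → Matrix (Fin m) (Fin m) ℂ}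
    (hA : ∀ (t c : ℝ) (ξ : Space n), 0 < c → ξ ≠ 0 → A t (c • ξ) = (c : ℂ) • A t ξ)
    (t : ℝ) (ξ : Space n) (hξ : ξ ≠ 0) :
    polarSymbol e₀ A t ξ = matOp (A t ((2 * Real.pi) • ξ)) := by
  have h1 : (2 * Real.pi) • ξ = (2 * Real.pi * ‖ξ‖) • direction e₀ ξ := by
    rw [mul_smul (2 * Real.pi) ‖ξ‖, norm_smul_direction hξ]
  have h2 : 0 < 2 * Real.pi * ‖ξ‖ := by
    have := norm_pos_iff.2 hξ
    positivity
  rw [h1, hA _ _ _ h2 (direction_ne_zero he₀ ξ), polarSymbol, matOp_smul]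

theorem matOp_single_apply (X : Matrix (Fin m) (Fin m) ℂ) (i j : Fin m) :
    matOp X (EuclideanSpace.single j 1) i = X i j := by
  simp

end Direction

namespace IsRegularlyHyperbolic

variable {n m : ℕ} {A : ℝ → Space n → Matrix (Fin m) (Fin m) ℂ} {φ : Fin m → ℝ → Space n → ℝ}
  {l : Filter ℝ}

theorem apply_eq_norm_smul (hA : IsRegularlyHyperbolic A φ) {e₀ : Space n} (he₀ : ‖e₀‖ = 1)
    (t : ℝ) {ξ : Space n} (hξ : ξ ≠ 0) : A t ξ = (‖ξ‖ : ℂ) • A t (direction e₀ ξ) := by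
  rw [← hA.homogeneous t ‖ξ‖ _ (norm_pos_iff.2 hξ) (direction_ne_zero he₀ ξ),
    norm_smul_direction hξ]

theorem exists_limit_symbol (hA : IsRegularlyHyperbolic A φ) {e₀ : Space n} (he₀ : ‖e₀‖ = 1)
    (hl : l = atTop ∨ l = atBot) :
    ∃ B : Space n → Matrix (Fin m) (Fin m) ℂ,
      ∀ (ξ : Space n) (i j : Fin m), ξ ≠ 0 → Tendsto (fun t => A t ξ i j) l (𝓝 (B ξ i j)) := by
  have hne : l.NeBot := by rcases hl with rfl | rfl <;> infer_instance
  obtain ⟨C, K, -, -, h⟩ := hA.exists_spectralFamily hl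
  have h1 : ∀ (ξ : Space n), ξ ≠ 0 → ∃ X : Matrix (Fin m) (Fin m) ℂ, ∀ i j,
      Tendsto (fun t => A t ξ i j) l (𝓝 (X i j)) := by
    intro ξ hξ
    obtain ⟨P, ω, -, -, ⟨c, hc⟩, -, hlip, -⟩ := h _ (norm_direction he₀ ξ)
    obtain ⟨T, hT⟩ := exists_tendsto_of_norm_sub_le (C := 1) hc
      (fun s t => by rw [one_mul]; exact hlip s t)
    refine ⟨fun i j => (‖ξ‖ : ℂ) * T (EuclideanSpace.single j 1) i, fun i j => ?_⟩
    have hc : Continuous fun S : EuclideanSpace ℂ (Fin m) →L[ℂ] EuclideanSpace ℂ (Fin m) =>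
        S (EuclideanSpace.single j 1) i :=
      (EuclideanSpace.proj (𝕜 := ℂ) i).continuous.comp
        (ContinuousLinearMap.apply ℂ _ (EuclideanSpace.single j (1 : ℂ))).continuous
    refine (((hc.tendsto T).comp hT).const_mul (‖ξ‖ : ℂ)).congr fun t => ?_
    rw [hA.apply_eq_norm_smul he₀ t hξ, Matrix.smul_apply, smul_eq_mul, Function.comp,
      matOp_single_apply]
  choose! B hB using h1
  exact ⟨B, fun ξ i j hξ => hB ξ hξ i j⟩

theorem exists_limit_root (hA : IsRegularlyHyperbolic A φ) {e₀ : Space n} (he₀ : ‖e₀‖ = 1)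
    (hl : l = atTop ∨ l = atBot) :
    ∃ φlim : Fin m → Space n → ℝ,
      ∀ (j : Fin m) (ξ : Space n), ξ ≠ 0 → Tendsto (fun t => φ j t ξ) l (𝓝 (φlim j ξ)) := by
  have hne : l.NeBot := by rcases hl with rfl | rfl <;> infer_instance
  obtain ⟨C, K, -, -, h⟩ := hA.exists_spectralFamily hl
  have h1 : ∀ (j : Fin m) (ξ : Space n), ξ ≠ 0 → ∃ y, Tendsto (fun t => φ j t ξ) l (𝓝 y) := by
    intro j ξ hξ
    have hn : (‖ξ‖ : ℂ) ≠ 0 := by exact_mod_cast norm_ne_zero_iff.2 hξ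
    obtain ⟨P, ω, -, -, ⟨c, hc⟩, -, -, hev⟩ := h _ (norm_direction he₀ ξ)
    obtain ⟨y, hy⟩ := exists_tendsto_of_norm_sub_le
      (f := fun t => ‖ξ‖⁻¹ * φ j t ξ) hc (hev (fun t => ‖ξ‖⁻¹ * φ j t ξ)
      ((hA.continuous_roots j ξ hξ).const_mul _) fun t => by
        obtain ⟨x, hx, hx'⟩ := exists_eigenvector_matOp (hA.roots t ξ hξ) j
        refine ⟨x, hx, ?_⟩
        rw [hA.apply_eq_norm_smul he₀ t hξ, matOp_smul, smul_apply] at hx'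
        push_cast
        rw [mul_smul, ← hx', smul_smul, inv_mul_cancel₀ hn, one_smul])
    refine ⟨‖ξ‖ * y, (hy.const_mul ‖ξ‖).congr fun t => ?_⟩
    rw [← mul_assoc, mul_inv_cancel₀ (norm_ne_zero_iff.2 hξ), one_mul]
  choose! φlim hφ using h1
  exact ⟨φlim, hφ⟩

theorem stronglyMeasurable_polarSymbol (hA : IsRegularlyHyperbolic A φ) (e₀ : Space n) (t : ℝ) :
    StronglyMeasurable (polarSymbol e₀ A t) := by
  have h1 : ∀ i j, Measurable fun ξ => A t (direction e₀ ξ) i j := fun i j =>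
    (measurable_of_continuousOn_compl_singleton (0 : Space n)
      (hA.continuousOn_freq t i j)).comp (measurable_direction e₀)
  have h3 : StronglyMeasurable fun ξ : Space n => ((2 * Real.pi * ‖ξ‖ : ℝ) : ℂ) :=
    (by fun_prop : Continuous fun ξ : Space n => ((2 * Real.pi * ‖ξ‖ : ℝ) : ℂ)).stronglyMeasurable
  exact h3.smul (stronglyMeasurable_matOp h1)

end IsRegularlyHyperbolic

/-! ### The wave operator -/

section Cauchy

variable {n m : ℕ} {G E F : ℝ → Space n → EuclideanSpace ℂ (Fin m) →L[ℂ] EuclideanSpace ℂ (Fin m)}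
  {C K D : ℝ}

theorem UniformSymbol.isMultiplierSolution (hG : UniformSymbol G C K) (hE : IsPropagator G E F)
    (hED : ∀ t ξ, ‖E t ξ‖ ≤ D) (f : L2Vec n m) :
    IsMultiplierSolution G
      (fun t => 𝓕⁻ (multiplier (E t) (hE.stronglyMeasurable t) (hED t) (𝓕 f))) ∧
    𝓕⁻ (multiplier (E 0) (hE.stronglyMeasurable 0) (hED 0) (𝓕 f)) = f := by
  refine ⟨isMultiplierSolution_propagator hG.stronglyMeasurable hG.norm_le hE hED f, ?_⟩
  rw [multiplier_eq_self _ _ hE.zero, FourierTransform.fourierInv_fourier_eq]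

/-- Every solution is given by the propagator on the Fourier side. -/
theorem UniformSymbol.fourier_solution_eq (hG : UniformSymbol G C K) (hE : IsPropagator G E F)
    (hED : ∀ t ξ, ‖E t ξ‖ ≤ D) {U : ℝ → L2Vec n m} (hU : IsMultiplierSolution G U) (t : ℝ) :
    𝓕 (U t) = multiplier (E t) (hE.stronglyMeasurable t) (hED t) (𝓕 (U 0)) := by
  obtain ⟨h1, h2⟩ := hG.isMultiplierSolution hE hED (U 0)
  have h3 := hU.ext hG.stronglyMeasurable hG.continuous hG.norm_le h1 h2.symm
  have h4 := congrArg (fun V : L2Vec n m => 𝓕 V) (congrFun h3 t)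
  simpa only [FourierTransform.fourier_fourierInv_eq] using h4

end Cauchy

theorem norm_sub_eq_norm_fourier_sub {n m : ℕ} (f g : L2Vec n m) : ‖f - g‖ = ‖𝓕 f - 𝓕 g‖ := by
  have h : (𝓕 (f - g) : L2Vec n m) = 𝓕 f - 𝓕 g :=
    map_sub (Lp.fourierTransformₗᵢ (Space n) (EuclideanSpace ℂ (Fin m))) f g
  rw [← h, Lp.norm_fourier_eq]

section Final

variable {n m : ℕ} {A : ℝ → Space n → Matrix (Fin m) (Fin m) ℂ} {φ : Fin m → ℝ → Space n → ℝ}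
  {l : Filter ℝ} {e₀ : Space n} {B : Space n → Matrix (Fin m) (Fin m) ℂ}
  {φlim : Fin m → Space n → ℝ}

/-- The symbols of a regularly hyperbolic system and of its limit are uniform, and direction by
direction the spectral family of the limit is the limit of the spectral families. -/
theorem IsRegularlyHyperbolic.exists_uniformSymbol (hA : IsRegularlyHyperbolic A φ)
    (he₀ : ‖e₀‖ = 1) (hl : l = atTop ∨ l = atBot)
    (hB : ∀ (ξ : Space n) (i j : Fin m), ξ ≠ 0 → Tendsto (fun t => A t ξ i j) l (𝓝 (B ξ i j)))
    (hφ : ∀ (j : Fin m) (ξ : Space n), ξ ≠ 0 → Tendsto (fun t => φ j t ξ) l (𝓝 (φlim j ξ))) :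
    ∃ C K : ℝ, UniformSymbol (polarSymbol e₀ A) C K ∧
      UniformSymbol (polarSymbol e₀ fun _ => B) C K ∧
      ∀ e : Space n, ‖e‖ = 1 → ∃ (P : Fin m → ℝ → _) (P' : Fin m → _) (ω : ℝ → ℝ) (c : ℝ),
        SpectralFamily (fun t => matOp (A t e)) (fun j t => φ j t e) P ω C ∧
        (∀ s t, |ω t - ω s| ≤ K) ∧ Tendsto ω l (𝓝 c) ∧
        SpectralFamily (fun _ => matOp (B e)) (fun j _ => φlim j e) (fun j _ => P' j)
          (fun _ => 0) C ∧
        ∀ j, Tendsto (P j) l (𝓝 (P' j)) := by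
  have hne : l.NeBot := by rcases hl with rfl | rfl <;> infer_instance
  have hcg : l.IsCountablyGenerated := by rcases hl with rfl | rfl <;> infer_instance
  obtain ⟨C, K, hC, hK, h⟩ := hA.exists_spectralFamily hl
  have hKle : K ≤ 2 * Real.pi * K := by
    have := Real.pi_gt_three
    nlinarith
  have hnorm : ∀ t ξ, ‖polarSymbol e₀ A t ξ‖ ≤ 2 * Real.pi * K * ‖ξ‖ := by
    intro t ξ
    obtain ⟨-, -, -, -, -, hb, -, -⟩ := h _ (norm_direction he₀ ξ)
    rw [polarSymbol, norm_smul, Complex.norm_real, Real.norm_eq_abs, abs_of_nonneg (by positivity)]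
    calc _ ≤ 2 * Real.pi * ‖ξ‖ * K := mul_le_mul_of_nonneg_left (hb t) (by positivity)
      _ = _ := by ring
  have hlim : ∀ ξ, Tendsto (fun t => polarSymbol e₀ A t ξ) l
      (𝓝 (polarSymbol e₀ (fun _ => B) 0 ξ)) := fun ξ =>
    (tendsto_matOp fun i j => hB _ i j (direction_ne_zero he₀ ξ)).const_smul _
  have hfam : ∀ e : Space n, ‖e‖ = 1 → ∃ (P : Fin m → ℝ → _) (P' : Fin m → _) (ω : ℝ → ℝ) (c : ℝ),
        SpectralFamily (fun t => matOp (A t e)) (fun j t => φ j t e) P ω C ∧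
        (∀ s t, |ω t - ω s| ≤ 2 * Real.pi * K) ∧ Tendsto ω l (𝓝 c) ∧
        SpectralFamily (fun _ => matOp (B e)) (fun j _ => φlim j e) (fun j _ => P' j)
          (fun _ => 0) C ∧
        ∀ j, Tendsto (P j) l (𝓝 (P' j)) := by
    intro e he
    have hne0 : e ≠ 0 := by rintro rfl; simp at he
    obtain ⟨P, ω, hP, hωK, ⟨c, hc⟩, -, -, -⟩ := h e he
    obtain ⟨P', hP', hP''⟩ := hP.exists_limit hc (tendsto_matOp fun i j => hB e i j hne0)
      (fun j => hφ j e hne0)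
    exact ⟨P, P', ω, c, hP, fun s t => (hωK s t).trans hKle, hc, hP'', hP'⟩
  have hBm : ∀ t, StronglyMeasurable (polarSymbol e₀ (fun _ => B) t) := fun _ =>
    stronglyMeasurable_of_tendsto l (hA.stronglyMeasurable_polarSymbol e₀) (tendsto_pi_nhds.2 hlim)
  refine ⟨C, 2 * Real.pi * K, ⟨hC, hA.stronglyMeasurable_polarSymbol e₀, fun ξ => ?_, hnorm,
    fun ξ => ?_⟩, ⟨hC, hBm, fun ξ => continuous_const,
    fun _ ξ => le_of_tendsto (hlim ξ).norm (Eventually.of_forall fun t => hnorm t ξ),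
    fun ξ => ?_⟩, hfam⟩
  · obtain ⟨P, ω, hP, -, -, -, hlip, -⟩ := h _ (norm_direction he₀ ξ)
    have hcont : Continuous fun t => matOp (A t (direction e₀ ξ)) := by
      refine continuous_iff_continuousAt.2 fun x => ?_
      rw [ContinuousAt, tendsto_iff_norm_sub_tendsto_zero]
      refine squeeze_zero (fun _ => norm_nonneg _) (fun z => hlip x z) ?_
      have : Continuous fun z => |ω z - ω x| := (hP.continuous_clock.sub continuous_const).abs
      simpa using this.tendsto x
    exact hcont.const_smul ((2 * Real.pi * ‖ξ‖ : ℝ) : ℂ)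
  · obtain ⟨P, P', ω, c, hP, hωK, -, -, -⟩ := hfam _ (norm_direction he₀ ξ)
    exact ⟨2 * Real.pi * ‖ξ‖, _, _, P, ω, hP, hωK, fun t => rfl⟩
  · obtain ⟨P, P', ω, c, -, -, -, hP', -⟩ := hfam _ (norm_direction he₀ ξ)
    exact ⟨2 * Real.pi * ‖ξ‖, _, _, _, _, hP', fun s t => by simpa using by positivity,
      fun t => rfl⟩

/-- Convergence of the phase differences makes the wave operator exist, frequency by frequency. -/
theorem exists_tendsto_propagators {G G' E F E' F' :
      ℝ → Space n → EuclideanSpace ℂ (Fin m) →L[ℂ] EuclideanSpace ℂ (Fin m)} {C D : ℝ}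
    (hE : IsPropagator G E F) (hE' : IsPropagator G' E' F') (hC : 0 ≤ C)
    (hD : ∀ t ξ, ‖E t ξ‖ ≤ D) [l.NeBot] {ξ : Space n} {r : ℝ}
    {M : ℝ → EuclideanSpace ℂ (Fin m) →L[ℂ] EuclideanSpace ℂ (Fin m)}
    {M' : EuclideanSpace ℂ (Fin m) →L[ℂ] EuclideanSpace ℂ (Fin m)}
    {φ : Fin m → ℝ → ℝ} {φ' : Fin m → ℝ}
    {P : Fin m → ℝ → EuclideanSpace ℂ (Fin m) →L[ℂ] EuclideanSpace ℂ (Fin m)}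
    {P' : Fin m → EuclideanSpace ℂ (Fin m) →L[ℂ] EuclideanSpace ℂ (Fin m)} {ω : ℝ → ℝ} {c : ℝ}
    (h : SpectralFamily M φ P ω C)
    (h' : SpectralFamily (fun _ => M') (fun j _ => φ' j) (fun j _ => P' j) (fun _ => 0) C)
    (hω : Tendsto ω l (𝓝 c)) (hP : ∀ j, Tendsto (P j) l (𝓝 (P' j)))
    (hψ : ∀ j, ∃ c, Tendsto (fun t => ∫ s in (0 : ℝ)..t, (φ j s - φ' j)) l (𝓝 c))
    (hG : ∀ t, G t ξ = (r : ℂ) • M t) (hG' : ∀ t, G' t ξ = (r : ℂ) • M') :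
    ∃ W, Tendsto (fun t => F' t ξ * E t ξ) l (𝓝 W) := by
  refine exists_tendsto_clm_of_pointwise fun x => ?_
  refine h.exists_tendsto_wave (u := fun t => E t ξ x) hC h' hω hP hψ
    (hE.hasDerivAt_apply hG x) (fun t => (E t ξ).le_of_opNorm_le (hD t ξ) x) fun t => ?_
  refine ⟨fun s => E' s ξ (F' t ξ (E t ξ x)), ?_, ?_, hE'.hasDerivAt_apply hG' _⟩
  · simp only [hE'.zero]
    rfl
  · exact congrArg (fun T : _ →L[ℂ] EuclideanSpace ℂ (Fin m) => T (E t ξ x)) (hE'.mul_inv t ξ)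

/-- The wave operator attached to a pair of propagators whose quotient converges pointwise. -/
theorem wave_operator {G G' E F E' F' :
      ℝ → Space n → EuclideanSpace ℂ (Fin m) →L[ℂ] EuclideanSpace ℂ (Fin m)} {C K D D' : ℝ}
    (hG : UniformSymbol G C K) (hG' : UniformSymbol G' C K)
    (hE : IsPropagator G E F) (hE' : IsPropagator G' E' F')
    (hD0 : 0 ≤ D) (hED : ∀ t ξ, ‖E t ξ‖ ≤ D) (hFD : ∀ t ξ, ‖F t ξ‖ ≤ D)
    (hD0' : 0 ≤ D') (hED' : ∀ t ξ, ‖E' t ξ‖ ≤ D') (hFD' : ∀ t ξ, ‖F' t ξ‖ ≤ D')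
    [l.NeBot] [l.IsCountablyGenerated]
    (hW : ∀ ξ, ∃ W, Tendsto (fun t => F' t ξ * E t ξ) l (𝓝 W)) :
    (∀ U : ℝ → L2Vec n m, IsMultiplierSolution G U →
      ∃ V, IsMultiplierSolution G' V ∧ IsAsymptoticTo l U V) ∧
    ∃ W : L2Vec n m →L[ℂ] L2Vec n m, Function.Bijective W ∧
      ∀ U V : ℝ → L2Vec n m, IsMultiplierSolution G U → IsMultiplierSolution G' V →
        IsAsymptoticTo l U V → V 0 = W (U 0) := by
  choose w hw using hW
  have hQm : ∀ t, StronglyMeasurable fun ξ => F' t ξ * E t ξ := fun t =>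
    (hE'.stronglyMeasurable_inv t).mul (hE.stronglyMeasurable t)
  have hRm : ∀ t, StronglyMeasurable fun ξ => F t ξ * E' t ξ := fun t =>
    (hE.stronglyMeasurable_inv t).mul (hE'.stronglyMeasurable t)
  have hQb : ∀ t ξ, ‖F' t ξ * E t ξ‖ ≤ D' * D := fun t ξ =>
    (norm_mul_le _ _).trans (mul_le_mul (hFD' t ξ) (hED t ξ) (norm_nonneg _) hD0')
  have hRb : ∀ t ξ, ‖F t ξ * E' t ξ‖ ≤ D * D' := fun t ξ =>
    (norm_mul_le _ _).trans (mul_le_mul (hFD t ξ) (hED' t ξ) (norm_nonneg _) hD0)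
  have hQR : ∀ t ξ, (F' t ξ * E t ξ) * (F t ξ * E' t ξ) = 1 := by
    intro t ξ
    rw [mul_assoc, ← mul_assoc (E t ξ), hE.mul_inv, one_mul, hE'.inv_mul]
  have hRQ : ∀ t ξ, (F t ξ * E' t ξ) * (F' t ξ * E t ξ) = 1 := by
    intro t ξ
    rw [mul_assoc, ← mul_assoc (E' t ξ), hE'.mul_inv, one_mul, hE.inv_mul]
  choose v hv hwv hvw using fun ξ => exists_tendsto_inverse (hw ξ) (fun t => hQR t ξ)
    (fun t => hRQ t ξ) (fun t => hRb t ξ)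
  have hwm : StronglyMeasurable w :=
    stronglyMeasurable_of_tendsto l hQm (tendsto_pi_nhds.2 hw)
  have hvm : StronglyMeasurable v :=
    stronglyMeasurable_of_tendsto l hRm (tendsto_pi_nhds.2 hv)
  have hwb : ∀ ξ, ‖w ξ‖ ≤ D' * D := fun ξ =>
    le_of_tendsto (hw ξ).norm (Eventually.of_forall fun t => hQb t ξ)
  have hvb : ∀ ξ, ‖v ξ‖ ≤ D * D' := fun ξ =>
    le_of_tendsto (hv ξ).norm (Eventually.of_forall fun t => hRb t ξ)
  have hconv : ∀ f : L2Vec n m, Tendsto (fun t => multiplier _ (hQm t) (hQb t) f) l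
      (𝓝 (multiplier w hwm hwb f)) := fun f => tendsto_multiplier_apply hQm hwm hQb hwb hw f
  have hone : ∀ ξ : Space n, ‖(1 : EuclideanSpace ℂ (Fin m) →L[ℂ] EuclideanSpace ℂ (Fin m))‖ ≤ 1 :=
    fun _ => ContinuousLinearMap.norm_id_le
  have hvw1 : ∀ f : L2Vec n m, multiplier v hvm hvb (multiplier w hwm hwb f) = f := fun f =>
    (multiplier_comp _ _ stronglyMeasurable_const _ _ hone hvw f).trans
      (multiplier_eq_self _ _ (fun _ => rfl) f)
  have hwv1 : ∀ f : L2Vec n m, multiplier w hwm hwb (multiplier v hvm hvb f) = f := fun f =>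
    (multiplier_comp _ _ stronglyMeasurable_const _ _ hone hwv f).trans
      (multiplier_eq_self _ _ (fun _ => rfl) f)
  let T := Lp.fourierTransformₗᵢ (Space n) (EuclideanSpace ℂ (Fin m))
  refine ⟨fun U hU => ?_, ?_⟩
  · set f : L2Vec n m := 𝓕 (U 0) with hf
    set g : L2Vec n m := 𝓕⁻ (multiplier w hwm hwb f) with hg
    have hgf : 𝓕 g = multiplier w hwm hwb f := FourierTransform.fourier_fourierInv_eq _
    refine ⟨_, (hG'.isMultiplierSolution hE' hED' g).1, ?_⟩
    have h1 : Tendsto (fun t => D' * ‖multiplier _ (hQm t) (hQb t) f - multiplier w hwm hwb f‖) l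
        (𝓝 0) := by
      simpa using ((tendsto_iff_norm_sub_tendsto_zero.1 (hconv f)).const_mul D')
    refine squeeze_zero (fun _ => norm_nonneg _) (fun t => ?_) h1
    rw [norm_sub_eq_norm_fourier_sub, FourierTransform.fourier_fourierInv_eq, hgf,
      hG.fourier_solution_eq hE hED hU t, ← hf]
    have h2 : multiplier (E t) (hE.stronglyMeasurable t) (hED t) f
        = multiplier (E' t) (hE'.stronglyMeasurable t) (hED' t)
          (multiplier _ (hQm t) (hQb t) f) :=
      (multiplier_comp _ _ _ _ _ _ (fun ξ => by
        rw [← mul_assoc, hE'.mul_inv, one_mul]) f).symm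
    rw [h2, ← map_sub]
    exact norm_multiplier_apply_le _ _ _
  · refine ⟨(T.symm.toContinuousLinearEquiv : L2Vec n m →L[ℂ] L2Vec n m).comp
      ((multiplier w hwm hwb).comp (T.toContinuousLinearEquiv : L2Vec n m →L[ℂ] L2Vec n m)),
      ?_, fun U V hU hV hUV => ?_⟩
    · have hb : Function.Bijective (multiplier w hwm hwb : L2Vec n m → L2Vec n m) :=
        Function.bijective_iff_has_inverse.2 ⟨multiplier v hvm hvb, hvw1, hwv1⟩
      exact T.symm.bijective.comp (hb.comp T.bijective)
    · set f : L2Vec n m := 𝓕 (U 0) with hf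
      set g : L2Vec n m := 𝓕 (V 0) with hg
      have h1 : Tendsto (fun t => D' * ‖U t - V t‖) l (𝓝 0) := by
        simpa using hUV.const_mul D'
      have h2 : Tendsto (fun t => multiplier _ (hQm t) (hQb t) f) l (𝓝 g) := by
        rw [tendsto_iff_norm_sub_tendsto_zero]
        refine squeeze_zero (fun _ => norm_nonneg _) (fun t => ?_) h1
        rw [norm_sub_eq_norm_fourier_sub (U t), hG.fourier_solution_eq hE hED hU t,
          hG'.fourier_solution_eq hE' hED' hV t, ← hf, ← hg]
        have h3 : multiplier _ (hQm t) (hQb t) f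
            = multiplier (F' t) (hE'.stronglyMeasurable_inv t) (hFD' t)
              (multiplier (E t) (hE.stronglyMeasurable t) (hED t) f) :=
          (multiplier_comp _ _ _ _ _ _ (fun ξ => rfl) f).symm
        have h4 : g = multiplier (F' t) (hE'.stronglyMeasurable_inv t) (hFD' t)
              (multiplier (E' t) (hE'.stronglyMeasurable t) (hED' t) g) :=
          ((multiplier_comp _ _ stronglyMeasurable_const _ _ hone
            (fun ξ => hE'.inv_mul t ξ) g).trans (multiplier_eq_self _ _ (fun _ => rfl) g)).symm
        conv_lhs => rw [h3, h4, ← map_sub]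
        exact norm_multiplier_apply_le _ _ _
      have h5 : g = multiplier w hwm hwb f := tendsto_nhds_unique h2 (hconv f)
      have h6 : V 0 = T.symm g := (T.symm_apply_apply (V 0)).symm
      rw [h6, h5]
      rfl

end Final

/-! ### Divergent phases -/

section Divergent

variable {n m : ℕ} {A : ℝ → Space n → Matrix (Fin m) (Fin m) ℂ} {φ : Fin m → ℝ → Space n → ℝ}
  {l : Filter ℝ} {e₀ : Space n} {B : Space n → Matrix (Fin m) (Fin m) ℂ}
  {φlim : Fin m → Space n → ℝ}

theorem polarSymbol_smul (e₀ : Space n) (A : ℝ → Space n → Matrix (Fin m) (Fin m) ℂ) (t : ℝ)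
    (ξ : Space n) {s : ℝ} (hs : 0 < s) :
    polarSymbol e₀ A t (s • ξ)
      = ((2 * Real.pi * ‖ξ‖ * s : ℝ) : ℂ) • matOp (A t (direction e₀ ξ)) := by
  rw [polarSymbol, direction_smul e₀ hs, norm_smul, Real.norm_eq_abs, abs_of_pos hs]
  congr 2
  ring

/-- On a single ray: if the solutions of the perturbed and of the limiting equation approach each
other along a sequence of times, at almost every frequency of the ray, and the phase differences
diverge, then the solution of the perturbed equation vanishes there. -/
theorem ae_ray_eq_zero {G G' E F E' F' :
      ℝ → Space n → EuclideanSpace ℂ (Fin m) →L[ℂ] EuclideanSpace ℂ (Fin m)} {C K D : ℝ}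
    (hE : IsPropagator G E F) (hE' : IsPropagator G' E' F') (hC : 0 ≤ C)
    (hD : ∀ t ξ, ‖E t ξ‖ ≤ D) [l.NeBot]
    {M : ℝ → EuclideanSpace ℂ (Fin m) →L[ℂ] EuclideanSpace ℂ (Fin m)}
    {M' : EuclideanSpace ℂ (Fin m) →L[ℂ] EuclideanSpace ℂ (Fin m)}
    {φ : Fin m → ℝ → ℝ} {φ' : Fin m → ℝ}
    {P : Fin m → ℝ → EuclideanSpace ℂ (Fin m) →L[ℂ] EuclideanSpace ℂ (Fin m)}
    {P' : Fin m → EuclideanSpace ℂ (Fin m) →L[ℂ] EuclideanSpace ℂ (Fin m)} {ω : ℝ → ℝ} {c : ℝ}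
    (h : SpectralFamily M φ P ω C) (hK : ∀ s t, |ω t - ω s| ≤ K)
    (h' : SpectralFamily (fun _ => M') (fun j _ => φ' j) (fun j _ => P' j) (fun _ => 0) C)
    (hω : Tendsto ω l (𝓝 c)) (hP : ∀ j, Tendsto (P j) l (𝓝 (P' j)))
    (hψ : ∀ j, Tendsto (fun t => |∫ s in (0 : ℝ)..t, (φ j s - φ' j)|) l atTop)
    {ξ : Space n} {ρ : ℝ} (hρ : 0 < ρ)
    (hG : ∀ s > 0, ∀ t, G t (s • ξ) = ((ρ * s : ℝ) : ℂ) • M t)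
    (hG' : ∀ s > 0, ∀ t, G' t (s • ξ) = ((ρ * s : ℝ) : ℂ) • M')
    {f g : Space n → EuclideanSpace ℂ (Fin m)} (hf : StronglyMeasurable f)
    {t : ℕ → ℝ} (ht : Tendsto t atTop l)
    (hfg : ∀ᵐ s ∂(volume.restrict (Set.Ioi (0 : ℝ))), Tendsto (fun k =>
      E (t k) (s • ξ) (f (s • ξ)) - E' (t k) (s • ξ) (g (s • ξ))) atTop (𝓝 0)) :
    ∀ᵐ s ∂(volume.restrict (Set.Ioi (0 : ℝ))), f (s • ξ) = 0 := by
  have hu : ∀ s : ℝ, s > 0 → ∀ τ, HasDerivAt (fun τ => E τ (s • ξ) (f (s • ξ)))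
      ((Complex.I * ((ρ * s : ℝ) : ℂ)) • M τ (E τ (s • ξ) (f (s • ξ)))) τ := fun s hs =>
    hE.hasDerivAt_apply (hG s hs) _
  have huD : ∀ s τ : ℝ, ‖E τ (s • ξ) (f (s • ξ))‖ ≤ D * ‖f (s • ξ)‖ := fun s τ =>
    (E τ (s • ξ)).le_of_opNorm_le (hD _ _) _
  have hy : ∀ (j : Fin m) (s : ℝ), s > 0 → ∃ y, Tendsto (SpectralFamily.mode φ P (ρ * s)
      (fun τ => E τ (s • ξ) (f (s • ξ))) j) l (𝓝 y) := fun j s hs =>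
    h.exists_tendsto_mode hC (huD s) (hu s hs) j hω
  choose! y hy using hy
  have hmode : ∀ (j : Fin m) (τ : ℝ), StronglyMeasurable fun s : ℝ =>
      SpectralFamily.mode φ P (ρ * s) (fun τ => E τ (s • ξ) (f (s • ξ))) j τ := by
    intro j τ
    have hs : Measurable fun s : ℝ => s • ξ := (continuous_id.smul continuous_const).measurable
    have h1 : StronglyMeasurable fun s : ℝ => E τ (s • ξ) (f (s • ξ)) :=
      isBoundedBilinearMap_apply.continuous.comp_stronglyMeasurable
        (((hE.stronglyMeasurable τ).comp_measurable hs).prodMk (hf.comp_measurable hs))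
    have h2 : Continuous fun s : ℝ => Complex.exp (-(Complex.I * ((ρ * s : ℝ) : ℂ) *
        ((∫ x in (0 : ℝ)..τ, φ j x : ℝ) : ℂ))) := by fun_prop
    exact h2.stronglyMeasurable.smul ((P j τ).continuous.comp_stronglyMeasurable h1)
  have hym : ∀ j, AEStronglyMeasurable (y j) (volume.restrict (Set.Ioi (0 : ℝ))) := fun j =>
    aestronglyMeasurable_of_tendsto_ae atTop (fun k => (hmode j (t k)).aestronglyMeasurable)
      (by
        filter_upwards [ae_restrict_mem measurableSet_Ioi] with s hs
        exact (hy j s hs).comp ht)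
  have hzero : ∀ (j : Fin m) (N : ℕ), ∀ᵐ s ∂(volume.restrict (Set.Ioo (0 : ℝ) N)), y j s = 0 := by
    intro j N
    have hsub : volume.restrict (Set.Ioo (0 : ℝ) N) ≤ volume.restrict (Set.Ioi (0 : ℝ)) :=
      Measure.restrict_mono Set.Ioo_subset_Ioi_self le_rfl
    have hx : Tendsto (fun k => |ρ * ∫ s in (0 : ℝ)..(t k), (φ j s - φ' j)|) atTop atTop := by
      simp only [abs_mul, abs_of_pos hρ]
      exact ((hψ j).comp ht).const_mul_atTop hρ
    refine ae_eq_zero_of_tendsto_exp_smul (v := fun s => P' j (g (s • ξ))) measurableSet_Ioo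
      (by simp) ((hym j).mono_measure hsub) hx ?_
    filter_upwards [ae_mono hsub hfg, ae_restrict_mem measurableSet_Ioo] with s hs hs0
    have h1 := h.tendsto_exp_smul_of_asymptotic hC h' hP (huD s)
      (hE'.hasDerivAt_apply (hG' s hs0.1) (g (s • ξ))) ht hs j (hy j s hs0.1)
    simp only [hE'.zero] at h1
    refine h1.congr fun k => ?_
    congr 2
    push_cast
    ring
  have hall : ∀ᵐ s ∂(volume.restrict (Set.Ioi (0 : ℝ))), ∀ j, y j s = 0 := by
    refine ae_all_iff.2 fun j => ?_
    have h1 : ∀ᵐ s : ℝ, ∀ N : ℕ, s ∈ Set.Ioo (0 : ℝ) N → y j s = 0 :=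
      ae_all_iff.2 fun N => (ae_restrict_iff' measurableSet_Ioo).1 (hzero j N)
    rw [ae_restrict_iff' measurableSet_Ioi]
    filter_upwards [h1] with s hs hs0
    obtain ⟨N, hN⟩ := exists_nat_gt s
    exact hs N ⟨hs0, hN⟩
  filter_upwards [hall, ae_restrict_mem measurableSet_Ioi] with s hs hs0
  have h1 := h.eq_zero_of_tendsto_mode_zero hC hK (hu s hs0)
    (fun j => by simpa only [hs j] using hy j s hs0)
  simpa [hE.zero] using h1

/-- Divergent phase differences exclude asymptotic freeness: almost every ray through the origin
carries enough frequencies for `ae_ray_eq_zero` to apply. -/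
theorem eq_zero_of_isAsymptoticTo {G G' E F E' F' :
      ℝ → Space n → EuclideanSpace ℂ (Fin m) →L[ℂ] EuclideanSpace ℂ (Fin m)} {C K D D' : ℝ}
    (hG : UniformSymbol G C K) (hG' : UniformSymbol G' C K)
    (hE : IsPropagator G E F) (hE' : IsPropagator G' E' F')
    (hED : ∀ t ξ, ‖E t ξ‖ ≤ D) (hED' : ∀ t ξ, ‖E' t ξ‖ ≤ D')
    [l.NeBot] [l.IsCountablyGenerated]
    (hray : ∀ f g : Space n → EuclideanSpace ℂ (Fin m), StronglyMeasurable f → ∀ t : ℕ → ℝ,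
      Tendsto t atTop l → ∀ᵐ ξ, (∀ᵐ s ∂(volume.restrict (Set.Ioi (0 : ℝ))), Tendsto (fun k =>
      E (t k) (s • ξ) (f (s • ξ)) - E' (t k) (s • ξ) (g (s • ξ))) atTop (𝓝 0)) →
      ∀ᵐ s ∂(volume.restrict (Set.Ioi (0 : ℝ))), f (s • ξ) = 0)
    {U V : ℝ → L2Vec n m} (hU : IsMultiplierSolution G U) (hV : IsMultiplierSolution G' V)
    (hUV : IsAsymptoticTo l U V) : U = 0 := by
  set f : L2Vec n m := 𝓕 (U 0) with hf
  set g : L2Vec n m := 𝓕 (V 0) with hg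
  set a : ℝ → L2Vec n m := fun t => multiplier (E t) (hE.stronglyMeasurable t) (hED t) f
    - multiplier (E' t) (hE'.stronglyMeasurable t) (hED' t) g with ha
  have hlim : Tendsto a l (𝓝 0) := by
    rw [tendsto_zero_iff_norm_tendsto_zero]
    refine Tendsto.congr (fun t => ?_) hUV
    rw [norm_sub_eq_norm_fourier_sub, hG.fourier_solution_eq hE hED hU t,
      hG'.fourier_solution_eq hE' hED' hV t]
  obtain ⟨t, ht, hae⟩ := (tendstoInMeasure_of_tendsto_Lp hlim).exists_seq_tendsto_ae'
  have hpt : ∀ᵐ ξ, Tendsto (fun k => E (t k) ξ (f ξ) - E' (t k) ξ (g ξ)) atTop (𝓝 0) := by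
    have h1 : ∀ᵐ ξ, ∀ k, a (t k) ξ = E (t k) ξ (f ξ) - E' (t k) ξ (g ξ) := by
      refine ae_all_iff.2 fun k => ?_
      filter_upwards [Lp.coeFn_sub (multiplier (E (t k)) (hE.stronglyMeasurable _) (hED _) f)
        (multiplier (E' (t k)) (hE'.stronglyMeasurable _) (hED' _) g),
        coeFn_multiplier (hE.stronglyMeasurable (t k)) (hED (t k)) f,
        coeFn_multiplier (hE'.stronglyMeasurable (t k)) (hED' (t k)) g] with ξ h1 h2 h3
      rw [ha, h1, Pi.sub_apply, h2, h3]
    filter_upwards [h1, hae, Lp.coeFn_zero (EuclideanSpace ℂ (Fin m)) 2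
      (volume : Measure (Space n))] with ξ h1 h2 h3
    rw [h3] at h2
    exact h2.congr h1
  have hfm := Lp.stronglyMeasurable f
  have hT : MeasurableSet {ξ | f ξ ≠ 0} :=
    (hfm.measurable (measurableSet_singleton 0)).compl
  have hf0 : f = 0 := by
    refine Lp.ext ?_
    have h1 : ∀ᵐ ξ : Space n, ξ ∉ {ξ | f ξ ≠ 0} := by
      refine ae_of_ae_ae_dilation hT ?_
      filter_upwards [ae_ae_dilation hpt, hray f g hfm t ht] with ξ h2 h3
      filter_upwards [h3 h2] with s hs
      simpa using hs
    filter_upwards [h1, Lp.coeFn_zero (EuclideanSpace ℂ (Fin m)) 2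
      (volume : Measure (Space n))] with ξ h2 h3
    rw [h3]
    simpa using h2
  funext s
  refine (Lp.fourierTransformₗᵢ (Space n) (EuclideanSpace ℂ (Fin m))).injective ?_
  have h1 := hG.fourier_solution_eq hE hED hU s
  rw [← hf, hf0, map_zero] at h1
  rw [Pi.zero_apply, map_zero]
  exact h1

end Divergent

theorem theorem1p1 {n m : ℕ} (hn : 1 ≤ n)
    (A : ℝ → Space n → Matrix (Fin m) (Fin m) ℂ) (φ : Fin m → ℝ → Space n → ℝ)
    (hA : IsRegularlyHyperbolic A φ)
    (l : Filter ℝ) (hl : l = atTop ∨ l = atBot) :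
    ∃ (B : Space n → Matrix (Fin m) (Fin m) ℂ) (φlim : Fin m → Space n → ℝ),
      (∀ (ξ : Space n) (i j : Fin m), ξ ≠ 0 → Tendsto (fun t => A t ξ i j) l (𝓝 (B ξ i j))) ∧
      (∀ (j : Fin m) (ξ : Space n), ξ ≠ 0 → Tendsto (fun t => φ j t ξ) l (𝓝 (φlim j ξ))) ∧
      -- part (i)
      ((∀ (j : Fin m) (ξ : Space n), ξ ≠ 0 →
          ∃ c : ℝ, Tendsto (fun t : ℝ => ∫ s in (0 : ℝ)..t, (φ j s ξ - φlim j ξ)) l (𝓝 c)) →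
        (∀ U : ℝ → L2Vec n m, IsSolution A U → IsAsymptoticallyFree l B U) ∧
        (∀ f : L2Vec n m, ∃! U : ℝ → L2Vec n m, IsSolution A U ∧ U 0 = f) ∧
        ∃ W : L2Vec n m →L[ℂ] L2Vec n m, Function.Bijective W ∧
          ∀ U V : ℝ → L2Vec n m, IsSolution A U → IsSolution (fun _ => B) V →
            IsAsymptoticTo l U V → V 0 = W (U 0)) ∧
      -- part (ii)
      ((∀ (j : Fin m) (ξ : Space n), ξ ≠ 0 →
          Tendsto (fun t : ℝ => |∫ s in (0 : ℝ)..t, (φ j s ξ - φlim j ξ)|) l atTop) →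
        ∀ U : ℝ → L2Vec n m, IsSolution A U → U ≠ 0 → ¬ IsAsymptoticallyFree l B U) := by
  have hne : l.NeBot := by rcases hl with rfl | rfl <;> infer_instance
  have hcg : l.IsCountablyGenerated := by rcases hl with rfl | rfl <;> infer_instance
  set e₀ : Space n := EuclideanSpace.single ⟨0, hn⟩ 1 with he₀d
  have he₀ : ‖e₀‖ = 1 := by simp [he₀d]
  obtain ⟨B, hB⟩ := hA.exists_limit_symbol he₀ hl
  obtain ⟨φlim, hφ⟩ := hA.exists_limit_root he₀ hl
  obtain ⟨C, K, hG, hG', hfam⟩ := hA.exists_uniformSymbol he₀ hl hB hφ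
  obtain ⟨E, F, hE, D, hD0, hED, hFD⟩ := hG.exists_bounded_propagator
  obtain ⟨E', F', hE', D', hD0', hED', hFD'⟩ := hG'.exists_bounded_propagator
  have hBhom : ∀ (_t : ℝ) (c : ℝ) (ξ : Space n), 0 < c → ξ ≠ 0 → B (c • ξ) = (c : ℂ) • B ξ := by
    intro _ c ξ hc hξ
    ext i j
    refine tendsto_nhds_unique (hB (c • ξ) i j (smul_ne_zero hc.ne' hξ)) ?_
    refine ((hB ξ i j hξ).const_mul (c : ℂ)).congr fun t => ?_
    rw [hA.homogeneous t c ξ hc hξ, Matrix.smul_apply, smul_eq_mul]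
  have hsolA : ∀ U : ℝ → L2Vec n m, IsSolution A U ↔ IsMultiplierSolution (polarSymbol e₀ A) U :=
    fun U => isSolution_iff_isMultiplierSolution hn (polarSymbol_eq he₀ hA.homogeneous)
  have hsolB : ∀ U : ℝ → L2Vec n m,
      IsSolution (fun _ => B) U ↔ IsMultiplierSolution (polarSymbol e₀ fun _ => B) U :=
    fun U => isSolution_iff_isMultiplierSolution hn (polarSymbol_eq he₀ hBhom)
  simp only [IsAsymptoticallyFree, hsolA]
  refine ⟨B, φlim, hB, hφ, fun hψ => ?_, fun hψ U hU hU0 hfree => ?_⟩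
  · obtain ⟨h1, h2⟩ := wave_operator hG hG' hE hE' hD0 hED hFD hD0' hED' hFD' (l := l) fun ξ => by
      have hd0 := direction_ne_zero he₀ ξ
      obtain ⟨P, P', ω, c, hP, -, hc, hP', hPP'⟩ := hfam _ (norm_direction he₀ ξ)
      exact exists_tendsto_propagators hE hE' hG.nonneg hED hP hP' hc hPP'
        (fun j => hψ j _ hd0) (fun t => rfl) (fun t => rfl)
    obtain ⟨W, hWbij, hW⟩ := h2
    refine ⟨fun U hU => ?_, fun f => ?_, W, hWbij,
      fun U V hU hV => hW U V hU ((hsolB V).1 hV)⟩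
    · obtain ⟨V, hV, hUV⟩ := h1 U hU
      exact ⟨V, (hsolB V).2 hV, hUV⟩
    obtain ⟨h3, h4⟩ := hG.isMultiplierSolution hE hED f
    exact ⟨_, ⟨h3, h4⟩, fun U hU => hU.1.ext hG.stronglyMeasurable hG.continuous hG.norm_le h3
      (hU.2.trans h4.symm)⟩
  · obtain ⟨V, hV, hUV⟩ := hfree
    have : Nonempty (Fin n) := ⟨⟨0, hn⟩⟩
    have h0 : ∀ᵐ ξ : Space n, ξ ≠ 0 := compl_mem_ae_iff.2 (measure_singleton _)
    refine hU0 (eq_zero_of_isAsymptoticTo hG hG' hE hE' hED hED' (fun f g hf t ht => ?_)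
      hU ((hsolB V).1 hV) hUV)
    filter_upwards [h0] with ξ hξ hae
    have hd0 := direction_ne_zero he₀ ξ
    obtain ⟨P, P', ω, c, hP, hωK, hc, hP', hPP'⟩ := hfam _ (norm_direction he₀ ξ)
    have hρ : 0 < 2 * Real.pi * ‖ξ‖ := by
      have := norm_pos_iff.2 hξ
      positivity
    exact ae_ray_eq_zero hE hE' hG.nonneg hED hP hωK hP' hc hPP' (fun j => hψ j _ hd0) hρ
      (fun s hs t => polarSymbol_smul e₀ A t ξ hs)
      (fun s hs t => polarSymbol_smul e₀ (fun _ => B) t ξ hs) hf ht hae
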